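/- Let $k$ be a field with separable closure $k_s$. Definitions. A $k$-scheme of based root datum $\mathcal R=(\mathcal M,\mathcal M^*,\Psi,\Psi^*,\Gamma)$ consists of commutative $k$-group schemes $\mathcal M,\mathcal M^*$ in perfect duality (with values in the constant group scheme $\mathbf Z_k$), finite $k$-schemes $\Psi,\Psi^*,\Gamma$ with closed immersions $\Gamma\hookrightarrow\Psi\hookrightarrow\mathcal M$, $\Psi^*\hookrightarrow\mathcal M^*$ and an isomorphism $\Psi\cong\Psi^*$, which over some finite Galois extension of $k$ becomes isomorphic to the constant object attached to a reduced based root datum $R=(M,M^*,\Phi,\Phi^*,\Delta)$; then $\mathcal R$ is said to be of type $R$. It is simple if $R$ is semisimple with nonempty irreducible root system. An isomorphism $R_{k_s}\cong\mathcal R_{k_s}$ determines a homomorphism $c\colon \mathrm{Gal}(k_s/k)\to \mathrm{Aut}\,R$ (the associated cocycle); the classifying field $l$ of $\mathcal R$ is the subfield of $k_s$ fixed by $\ker c$, and we put $g=|\mathrm{Gal}(l/k)|$ (so the Tits index of $\mathcal R$ is ${}^gX_{n,l}$, where $X_n$ is the Dynkin type of $R$). For $\alpha\in\mathrm{Aut}(k)$,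 a semilinear automorphism of $\mathcal R$ over $\alpha$ is an isomorphism $\mathcal R\cong{}^{\alpha}\mathcal R$, equivalently an automorphism of $\mathcal R$ lying over $\mathrm{Spec}\,\alpha$. They form a group $\mathrm{Aut}(\mathcal R\to\mathrm{Spec}\,k)$ under composition; mapping a semilinear automorphism over $\alpha$ to $\alpha^{-1}$ is a homomorphism to $\mathrm{Aut}(k)$, with image denoted $\mathrm{Aut}_{\mathcal R}(k)$ and kernel $\mathrm{Aut}\,\mathcal R$, the group of $k$-automorphisms of $\mathcal R$. For a field extension $E/k$ let $\mathrm{Aut}(E\ge k)=\{\sigma\in\mathrm{Aut}(E)\mid\sigma(k)=k\}$, and let $\mathrm{Aut}_E(k)$ be the group of automorphisms of $k$ that extend to an automorphism of $E$. Proposition. Let $\mathcal R$ be a simple $k$-scheme of based root datum of type $R$, with classifying field $l$ and $g=|\mathrm{Gal}(l/k)|$, and consider the short exact sequence $$(*)\qquad 1\to\mathrm{Aut}\,\mathcal R\to\mathrm{Aut}(\mathcal R\to\mathrm{Spec}\,k)\to\mathrm{Aut}_{\mathcal R}(k)\to1 .$$ 1. If $g=1$, then $(*)$ is isomorphic to $1\to\mathrm{Aut}\,R\to\mathrm{Aut}\,R\times\mathrm{Aut}(k)\to\mathrm{Aut}(k)\to1$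 (inclusion and projection). In particular, $(*)$ splits. 2. If $g=2$ or $g=3$, then $(*)$ is isomorphic to $1\to\mathrm{Gal}(l/k)\to\mathrm{Aut}(l\ge k)\to\mathrm{Aut}_l(k)\to1$ (inclusion and restriction). 3. If $g=6$, then every cubic subextension $l_3$ of $l/k$ is non-normal over $k$, and for every such $l_3$ the sequence $(*)$ is isomorphic to $1\to1\to\mathrm{Aut}(l_3\ge k)\to\mathrm{Aut}_{l_3}(k)\to1$ (with restriction to $k$). In particular, $(*)$ splits. In each case the isomorphism of sequences can be chosen so that its right-hand component is the identity map, as subgroups of $\mathrm{Aut}(k)$; in particular $\mathrm{Aut}_{\mathcal R}(k)$ equals $\mathrm{Aut}(k)$, $\mathrm{Aut}_l(k)$, $\mathrm{Aut}_{l_3}(k)$ respectively. -/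

import Mathlib

open CategoryTheory Limits MonoidalCategory CartesianMonoidalCategory AlgebraicGeometry

universe u v w

/-! ### Sequences of groups `1 → A → B → C → 1` -/

/-- A sequence of groups and homomorphisms `1 → A → B → C → 1`; exactness is the predicate
`GrpSeq.ShortExact`. -/
structure GrpSeq : Type (u + 1) where
  A : Type u
  B : Type u
  C : Type u
  [grpA : Group A]
  [grpB : Group B]
  [grpC : Group C]
  incl : A →* B
  proj : B →* C

namespace GrpSeq

attribute [instance] grpA grpB grpC

/-- The sequence is exact at each of its three groups. -/
def ShortExact (S : GrpSeq.{u}) : Prop :=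
  Function.Injective S.incl ∧ Function.Surjective S.proj ∧ S.incl.range = S.proj.ker

/-- The sequence splits: the projection has a section which is a homomorphism. -/
def Splits (S : GrpSeq.{u}) : Prop :=
  ∃ s : S.C →* S.B, S.proj.comp s = MonoidHom.id S.C

/-- An isomorphism of sequences of groups. -/
structure Iso (S : GrpSeq.{u}) (T : GrpSeq.{v}) where
  left : S.A ≃* T.A
  mid : S.B ≃* T.B
  right : S.C ≃* T.C
  incl_comm : ∀ a, mid (S.incl a) = T.incl (left a)
  proj_comm : ∀ b, right (S.proj b) = T.proj (mid b)

/-- The sequence `1 → ker p → B → im p → 1` of a homomorphism `p`. -/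
def ofHom {B C : Type u} [Group B] [Group C] (p : B →* C) : GrpSeq.{u} where
  A := p.ker
  B := B
  C := p.range
  incl := p.ker.subtype
  proj := p.rangeRestrict

theorem ofHom_shortExact {B C : Type u} [Group B] [Group C] (p : B →* C) :
    (ofHom p).ShortExact :=
  ⟨p.ker.subtype_injective, p.rangeRestrict_surjective, by
    change p.ker.subtype.range = p.rangeRestrict.ker
    rw [Subgroup.range_subtype, MonoidHom.ker_rangeRestrict]⟩

end GrpSeq

/-! ### Automorphisms of field extensions -/

section FieldExtensions

variable (k : Type u) (l : Type v) [Field k] [Field l] [Algebra k l]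

/-- `Aut(l ≥ k)`: the field automorphisms `σ` of `l` with `σ(k) = k`. -/
def AutPreserving : Subgroup (l ≃+* l) where
  carrier := {σ | σ '' Set.range (algebraMap k l) = Set.range (algebraMap k l)}
  one_mem' := by
    change (fun x : l => x) '' _ = _
    exact Set.image_id' _
  mul_mem' := by
    intro σ τ hσ hτ
    change (fun x => σ (τ x)) '' _ = _
    rw [← Set.image_image (g := σ) (f := τ), show τ '' _ = _ from hτ]
    exact hσ
  inv_mem' := by
    intro σ hσ
    change σ.symm '' _ = _
    conv_lhs => rw [← (show σ '' _ = _ from hσ)]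
    rw [Set.image_image]
    simp

/-- `Aut_l(k)`: the field automorphisms of `k` that extend to an automorphism of `l`. -/
def AutExtending : Subgroup (k ≃+* k) where
  carrier := {a | ∃ σ : l ≃+* l, ∀ x, σ (algebraMap k l x) = algebraMap k l (a x)}
  one_mem' := ⟨1, fun _ => rfl⟩
  mul_mem' := by
    rintro a b ⟨σ, hσ⟩ ⟨τ, hτ⟩
    exact ⟨σ * τ, fun x => by simp [RingAut.mul_apply, hσ, hτ]⟩
  inv_mem' := by
    rintro a ⟨σ, hσ⟩
    refine ⟨σ⁻¹, fun x => ?_⟩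
    change σ.symm _ = algebraMap k l (a.symm x)
    rw [RingEquiv.symm_apply_eq, hσ, RingEquiv.apply_symm_apply]

variable {k l}

theorem AutPreserving.exists_image (σ : AutPreserving k l) (x : k) :
    ∃ y : k, algebraMap k l y = (σ : l ≃+* l) (algebraMap k l x) := by
  have h : (σ : l ≃+* l) (algebraMap k l x) ∈
      (σ : l ≃+* l) '' Set.range (algebraMap k l) := ⟨_, ⟨x, rfl⟩, rfl⟩
  rw [show (σ : l ≃+* l) '' _ = _ from σ.2] at h
  exact h

/-- The value at `x ∈ k` of the restriction to `k` of `σ ∈ Aut(l ≥ k)`. -/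
noncomputable def AutPreserving.resFun (σ : AutPreserving k l) (x : k) : k :=
  (AutPreserving.exists_image σ x).choose

theorem AutPreserving.algebraMap_resFun (σ : AutPreserving k l) (x : k) :
    algebraMap k l (AutPreserving.resFun σ x) = (σ : l ≃+* l) (algebraMap k l x) :=
  (AutPreserving.exists_image σ x).choose_spec

variable (k l)

/-- Restriction of automorphisms `Aut(l ≥ k) → Aut(k)`. -/
noncomputable def AutPreserving.res : AutPreserving k l →* (k ≃+* k) where
  toFun σ :=
    { toFun := AutPreserving.resFun σ
      invFun := AutPreserving.resFun σ⁻¹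
      left_inv := fun x => (algebraMap k l).injective <| by
        rw [algebraMap_resFun, algebraMap_resFun]
        exact (σ : l ≃+* l).symm_apply_apply _
      right_inv := fun x => (algebraMap k l).injective <| by
        rw [algebraMap_resFun, algebraMap_resFun]
        exact (σ : l ≃+* l).apply_symm_apply _
      map_mul' := fun x y => (algebraMap k l).injective <| by
        simp only [algebraMap_resFun, map_mul]
      map_add' := fun x y => (algebraMap k l).injective <| by
        simp only [algebraMap_resFun, map_add] }
  map_one' := by
    ext x
    exact (algebraMap k l).injective (algebraMap_resFun _ x)
  map_mul' σ τ := by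
    ext x
    refine (algebraMap k l).injective ?_
    refine (algebraMap_resFun _ x).trans ?_
    change _ = algebraMap k l (resFun σ (resFun τ x))
    rw [algebraMap_resFun, algebraMap_resFun]
    rfl

theorem AutPreserving.algebraMap_res (σ : AutPreserving k l) (x : k) :
    algebraMap k l (AutPreserving.res k l σ x) = (σ : l ≃+* l) (algebraMap k l x) :=
  algebraMap_resFun σ x

/-- The restriction homomorphism `Aut(l ≥ k) → Aut_l(k)`. -/
noncomputable def AutPreserving.toExtending : AutPreserving k l →* AutExtending k l :=
  (AutPreserving.res k l).codRestrict (AutExtending k l) fun σ =>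
    ⟨σ, fun x => (AutPreserving.algebraMap_res k l σ x).symm⟩

/-- The inclusion `Aut(l/k) → Aut(l ≥ k)`. -/
def galToAutPreserving : (l ≃ₐ[k] l) →* AutPreserving k l where
  toFun σ := ⟨σ.toRingEquiv, by
    change σ '' _ = _
    rw [← Set.range_comp]
    congr 1
    ext x
    simp⟩
  map_one' := rfl
  map_mul' _ _ := rfl

/-- The sequence `1 → Gal(l/k) → Aut(l ≥ k) → Aut_l(k) → 1`, with inclusion and restriction. -/
noncomputable def galSeq (k l : Type u) [Field k] [Field l] [Algebra k l] : GrpSeq.{u} where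
  A := l ≃ₐ[k] l
  B := AutPreserving k l
  C := AutExtending k l
  incl := galToAutPreserving k l
  proj := AutPreserving.toExtending k l

/-- The sequence `1 → 1 → Aut(l ≥ k) → Aut_l(k) → 1`, with restriction. -/
noncomputable def trivSeq (k l : Type u) [Field k] [Field l] [Algebra k l] : GrpSeq.{u} where
  A := PUnit
  B := AutPreserving k l
  C := AutExtending k l
  incl := 1
  proj := AutPreserving.toExtending k l

/-- The sequence `1 → E → E × Aut(k) → Aut(k) → 1`, with inclusion and projection. -/
def prodSeq (E : Type u) [Group E] (k : Type u) [Field k] : GrpSeq.{u} where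
  A := E
  B := E × (k ≃+* k)
  C := k ≃+* k
  incl := MonoidHom.inl E (k ≃+* k)
  proj := MonoidHom.snd E (k ≃+* k)

end FieldExtensions

/-! ### Based root data -/

/-- A reduced based root datum `(M, M*, Φ, Φ*, Δ)`: two free abelian groups of finite rank in
perfect duality, finite sets of roots and coroots in bijection (both indexed by `ι`), and a choice
of simple roots. -/
structure BasedRootDatum : Type (u + 1) where
  M : Type u
  M' : Type u
  ι : Type u
  [addCommGroupM : AddCommGroup M]
  [addCommGroupM' : AddCommGroup M']
  [finiteM : Module.Finite ℤ M]
  [finiteM' : Module.Finite ℤ M']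
  [finiteι : Finite ι]
  P : RootDatum ι M M'
  [reduced : P.IsReduced]
  base : P.Base

namespace BasedRootDatum

attribute [instance] addCommGroupM addCommGroupM' finiteM finiteM' finiteι reduced

/-- The group of automorphisms of a based root datum. -/
def Aut (R : BasedRootDatum.{u}) : Subgroup R.P.Aut where
  carrier := {g | ∀ i, g.indexEquiv i ∈ R.base.support ↔ i ∈ R.base.support}
  one_mem' := fun _ => Iff.rfl
  mul_mem' := fun {g h} hg hh i => (hg (h.indexEquiv i)).trans (hh i)
  inv_mem' := by
    intro g hg i
    change g.indexEquiv.symm i ∈ _ ↔ _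
    rw [← hg, Equiv.apply_symm_apply]

/-- A based root datum is semisimple if the roots span `M` rationally. -/
def IsSemisimple (R : BasedRootDatum.{u}) : Prop :=
  ∀ m : R.M, ∃ n : ℤ, n ≠ 0 ∧ n • m ∈ Submodule.span ℤ (Set.range R.P.root)

/-- A based root datum is simple if it is semisimple and its root system is nonempty and
irreducible, i.e. not the union of two nonempty mutually orthogonal subsets.  (Equivalently, the
split connected reductive group that it defines is simple.) -/
structure IsSimple (R : BasedRootDatum.{u}) : Prop where
  semisimple : R.IsSemisimple
  nonempty : Nonempty R.ι
  irreducible : ∀ s : Set R.ι, s.Nonempty → sᶜ.Nonempty →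
    ∃ i ∈ s, ∃ j ∈ sᶜ, R.P.pairing i j ≠ 0

end BasedRootDatum

/-! ### Schemes of based root datum

For a set `E` the constant `k`-scheme `E_k` is `∐_{e ∈ E} Spec k`.  A morphism of `k`-schemes
`T ⟶ ℤ_k` is the same thing as a locally constant function from the underlying space of `T` to
`ℤ`, i.e. an element of `C(T, ℤ)`; this is also the form in which the constant sheaf
`continuousMapPresheafAb ℤ` appears in Mathlib, and it is the form in which morphisms to `ℤ_k` are
used below. -/

section Schemes

open scoped MonObj

/-- `Spec A` as a `k`-scheme. -/
noncomputable def specOver (k : Type u) [Field k] (A : Type u) [CommRing A] [Algebra k A] :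
    Over (Spec (.of k)) :=
  Over.mk (Spec.map (CommRingCat.ofHom (algebraMap k A)))

/-- The morphism `Spec B ⟶ Spec A` of `k`-schemes induced by a homomorphism `A → B`. -/
noncomputable def specOverMap {k : Type u} [Field k] {A B : Type u} [CommRing A] [CommRing B]
    [Algebra k A] [Algebra k B] (g : A →ₐ[k] B) : specOver k B ⟶ specOver k A :=
  Over.homMk (Spec.map (CommRingCat.ofHom (g : A →+* B))) <| by
    change Spec.map _ ≫ Spec.map _ = Spec.map _
    rw [← Spec.map_comp, ← CommRingCat.ofHom_comp, AlgHom.comp_algebraMap]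

theorem specOverMap_id {k : Type u} [Field k] {A : Type u} [CommRing A] [Algebra k A] :
    specOverMap (AlgHom.id k A) = 𝟙 (specOver k A) :=
  Over.OverMorphism.ext (Spec.map_id _)

theorem specOverMap_comp {k : Type u} [Field k] {A B C : Type u} [CommRing A] [CommRing B]
    [CommRing C] [Algebra k A] [Algebra k B] [Algebra k C] (g : B →ₐ[k] C) (h : A →ₐ[k] B) :
    specOverMap (g.comp h) = specOverMap g ≫ specOverMap h :=
  Over.OverMorphism.ext <| by
    change Spec.map _ = Spec.map _ ≫ Spec.map _
    rw [← Spec.map_comp]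
    rfl

/-- The pullback of a morphism `χ : Y ⟶ ℤ_k` along a morphism `f : X ⟶ Y`. -/
def pullInt {X Y : Scheme.{u}} (f : X ⟶ Y) (χ : C(Y, ℤ)) : C(X, ℤ) :=
  χ.comp f.base.hom

/-- The value `⟨x, y⟩ : T ⟶ ℤ_k` of a pairing `e : X ×ₖ Y ⟶ ℤ_k` at `T`-points `x`, `y`. -/
noncomputable def evalPair {k : Type u} [Field k] {X Y T : Over (Spec (.of k))}
    (e : C((X ⊗ Y).left, ℤ)) (x : T ⟶ X) (y : T ⟶ Y) : C(T.left, ℤ) :=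
  pullInt (lift x y).left e

/-- A bilinear morphism `e : X ×ₖ Y ⟶ ℤ_k` of group schemes, i.e. a duality. -/
structure IsDuality {k : Type u} [Field k] {X Y : Over (Spec (.of k))} [GrpObj X] [GrpObj Y]
    (e : C((X ⊗ Y).left, ℤ)) : Prop where
  mul_left : ∀ {T : Over (Spec (.of k))} (x x' : T ⟶ X) (y : T ⟶ Y),
    evalPair e (x * x') y = evalPair e x y + evalPair e x' y
  mul_right : ∀ {T : Over (Spec (.of k))} (x : T ⟶ X) (y y' : T ⟶ Y),
    evalPair e x (y * y') = evalPair e x y + evalPair e x y'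

/-- An element of `Hom_A(X_A, ℤ_A)`, i.e. of the `A`-points of the dual of `X`: a morphism
`χ : X ×ₖ Spec A ⟶ ℤ_k` which is additive in the first variable. -/
def IsCharacter {k : Type u} [Field k] {X : Over (Spec (.of k))} [GrpObj X]
    (A : Type u) [CommRing A] [Algebra k A] (χ : C((X ⊗ specOver k A).left, ℤ)) : Prop :=
  ∀ {T : Over (Spec (.of k))} (x x' : T ⟶ X) (a : T ⟶ specOver k A),
    evalPair χ (x * x') a = evalPair χ x a + evalPair χ x' a

/-- The duality `e` is perfect: for every `k`-algebra `A`, the map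
`Y(A) → Hom_A(X_A, ℤ_A)`, `y ↦ e(·, y)`, is bijective. -/
def IsPerfectDuality {k : Type u} [Field k] {X Y : Over (Spec (.of k))} [GrpObj X] [GrpObj Y]
    (e : C((X ⊗ Y).left, ℤ)) : Prop :=
  IsDuality e ∧
  ∀ (A : Type u) [CommRing A] [Algebra k A] (χ : C((X ⊗ specOver k A).left, ℤ)),
    IsCharacter A χ →
    ∃! y : specOver k A ⟶ Y, ∀ {T : Over (Spec (.of k))} (x : T ⟶ X) (a : T ⟶ specOver k A),
      evalPair χ x a = evalPair e x (a ≫ y)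

/-- The data underlying a `k`-scheme of based root datum `(𝓜, 𝓜*, Ψ, Ψ*, Γ)`: commutative
`k`-group schemes `𝓜`, `𝓜*` in perfect duality, finite `k`-schemes with closed immersions
`Γ ↪ Ψ ↪ 𝓜` and `Ψ* ↪ 𝓜*`, and an isomorphism `Ψ ≅ Ψ*`. -/
structure PreBasedRootDatumScheme (k : Type u) [Field k] : Type (u + 1) where
  M : Over (Spec (.of k))
  M' : Over (Spec (.of k))
  [grpM : GrpObj M]
  [commM : IsCommMonObj M]
  [grpM' : GrpObj M']
  [commM' : IsCommMonObj M']
  pair : C((M ⊗ M').left, ℤ)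
  perfect : IsPerfectDuality pair
  Ψ : Over (Spec (.of k))
  Ψ' : Over (Spec (.of k))
  Γ : Over (Spec (.of k))
  [finiteΨ : IsFinite Ψ.hom]
  [finiteΨ' : IsFinite Ψ'.hom]
  [finiteΓ : IsFinite Γ.hom]
  rootIncl : Ψ ⟶ M
  corootIncl : Ψ' ⟶ M'
  simpleIncl : Γ ⟶ Ψ
  [closedRoot : IsClosedImmersion rootIncl.left]
  [closedCoroot : IsClosedImmersion corootIncl.left]
  [closedSimple : IsClosedImmersion simpleIncl.left]
  rootIso : Ψ ≅ Ψ'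

attribute [instance] PreBasedRootDatumScheme.grpM PreBasedRootDatumScheme.commM
  PreBasedRootDatumScheme.grpM' PreBasedRootDatumScheme.commM'
  PreBasedRootDatumScheme.finiteΨ PreBasedRootDatumScheme.finiteΨ'
  PreBasedRootDatumScheme.finiteΓ PreBasedRootDatumScheme.closedRoot
  PreBasedRootDatumScheme.closedCoroot PreBasedRootDatumScheme.closedSimple

/-- For a `k`-scheme `X` and a field extension `l` of `k`, a family `x` of `l`-points of `X`
indexed by a set `E` amounts to a morphism of `l`-schemes `E_l = ∐_E Spec l ⟶ X ×ₖ Spec l = X_l`;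
this is the condition that this morphism is an isomorphism. -/
def IsConstantVia {k : Type u} [Field k] (l : Type u) [Field l] [Algebra k l]
    (X : Over (Spec (.of k))) {E : Type u} (x : E → (specOver k l ⟶ X)) : Prop :=
  IsIso (Sigma.desc (fun e : E => (lift (x e) (𝟙 (specOver k l))).left) :
    (∐ fun _ : E => (specOver k l).left) ⟶ (X ⊗ specOver k l).left)

/-- An isomorphism `R_l ≅ 𝓡_l` between the split `l`-scheme of based root datum of type `R` and
the base change of `𝓡` to `l`.  All its components are isomorphisms from a constant scheme, given
by families of `l`-points.  The map `wt` is the isomorphism `f : M_l ≅ 𝓜_l` of group schemes, and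
`cowt` is the inverse `M*_l ≅ 𝓜*_l` of its transpose. -/
structure SplittingOver {k : Type u} [Field k] (𝓡 : PreBasedRootDatumScheme k)
    (R : BasedRootDatum.{u}) (l : Type u) [Field l] [Algebra k l] where
  wt : R.M → (specOver k l ⟶ 𝓡.M)
  cowt : R.M' → (specOver k l ⟶ 𝓡.M')
  root : R.ι → (specOver k l ⟶ 𝓡.Ψ)
  coroot : R.ι → (specOver k l ⟶ 𝓡.Ψ')
  simple : R.base.support → (specOver k l ⟶ 𝓡.Γ)
  wt_add : ∀ x y, wt (x + y) = wt x * wt y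
  cowt_add : ∀ x y, cowt (x + y) = cowt x * cowt y
  isConstant_wt : IsConstantVia l 𝓡.M wt
  isConstant_cowt : IsConstantVia l 𝓡.M' cowt
  isConstant_root : IsConstantVia l 𝓡.Ψ root
  isConstant_coroot : IsConstantVia l 𝓡.Ψ' coroot
  isConstant_simple : IsConstantVia l 𝓡.Γ simple
  pair_eq : ∀ x y, evalPair 𝓡.pair (wt x) (cowt y) =
    ContinuousMap.const _ (R.P.toLinearMap x y)
  root_incl : ∀ i, root i ≫ 𝓡.rootIncl = wt (R.P.root i)
  coroot_incl : ∀ i, coroot i ≫ 𝓡.corootIncl = cowt (R.P.coroot i)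
  simple_incl : ∀ i, simple i ≫ 𝓡.simpleIncl = root i
  root_iso : ∀ i, root i ≫ 𝓡.rootIso.hom = coroot i

/-- `𝓡` is of type `R`: it becomes isomorphic to the split scheme of based root datum of type `R`
over a finite Galois extension of `k`. -/
def PreBasedRootDatumScheme.IsOfType {k : Type u} [Field k] (𝓡 : PreBasedRootDatumScheme k)
    (R : BasedRootDatum.{u}) : Prop :=
  ∃ (l : Type u) (_ : Field l) (_ : Algebra k l),
    FiniteDimensional k l ∧ IsGalois k l ∧ Nonempty (SplittingOver 𝓡 R l)

/-- A `k`-scheme of based root datum. -/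
structure BasedRootDatumScheme (k : Type u) [Field k] : Type (u + 1)
    extends PreBasedRootDatumScheme k where
  exists_type : ∃ R : BasedRootDatum.{u}, toPreBasedRootDatumScheme.IsOfType R

/-- The subgroup of those `g ∈ Gal(K/k)` with `ᵍf = f`, where `f : R_K ≅ 𝓡_K`.  As the cocycle
`c : Gal(K/k) → Aut R_K = Aut R` of `𝓡` corresponding to `f` is given by `c_g = f⁻¹ ∘ ᵍf`, this is
the kernel of `c`. -/
def SplittingOver.cocycleKer {k : Type u} [Field k] {𝓡 : PreBasedRootDatumScheme k}
    {R : BasedRootDatum.{u}} {K : Type u} [Field K] [Algebra k K] (f : SplittingOver 𝓡 R K) :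
    Subgroup (K ≃ₐ[k] K) where
  carrier := {g | ∀ m, specOverMap (g : K →ₐ[k] K) ≫ f.wt m = f.wt m}
  one_mem' := fun m => by
    have h : specOverMap ((1 : K ≃ₐ[k] K) : K →ₐ[k] K) = 𝟙 _ := specOverMap_id
    rw [h, Category.id_comp]
  mul_mem' := by
    intro g g' hg hg' m
    have h : specOverMap ((g * g' : K ≃ₐ[k] K) : K →ₐ[k] K) =
        specOverMap (g : K →ₐ[k] K) ≫ specOverMap (g' : K →ₐ[k] K) :=
      specOverMap_comp (g : K →ₐ[k] K) (g' : K →ₐ[k] K)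
    rw [h, Category.assoc, hg' m, hg m]
  inv_mem' := by
    intro g hg m
    have h : specOverMap ((g⁻¹ : K ≃ₐ[k] K) : K →ₐ[k] K) ≫ specOverMap (g : K →ₐ[k] K) = 𝟙 _ := by
      have h' : ((g⁻¹ : K ≃ₐ[k] K) : K →ₐ[k] K).comp (g : K →ₐ[k] K) = AlgHom.id k K :=
        AlgHom.ext fun x => g.symm_apply_apply x
      rw [← specOverMap_comp, h', specOverMap_id]
    conv_lhs => rw [← hg m]
    rw [← Category.assoc, h, Category.id_comp]

/-- The classifying field of `𝓡` in a separable closure `K` of `k`, computed from an isomorphism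
`f : R_K ≅ 𝓡_K`: the field fixed by the kernel of the corresponding cocycle. -/
noncomputable def SplittingOver.classifyingField {k : Type u} [Field k]
    {𝓡 : PreBasedRootDatumScheme k} {R : BasedRootDatum.{u}} {K : Type u} [Field K] [Algebra k K]
    (f : SplittingOver 𝓡 R K) : IntermediateField k K :=
  IntermediateField.fixedField f.cocycleKer

/-! ### Semilinear automorphisms -/

/-- The automorphism `Spec α` of `Spec k`. -/
noncomputable def specAut {k : Type u} [Field k] (α : k ≃+* k) :
    Spec (.of k) ⟶ Spec (.of k) :=
  Spec.map (CommRingCat.ofHom (α : k →+* k))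

/-- For `f : X ⟶ X` and `g : Y ⟶ Y` over the same morphism `s` of the base, the morphism
`f × g : X ×ₖ Y ⟶ X ×ₖ Y` over `s`. -/
noncomputable def prodMap {k : Type u} [Field k] {X Y : Over (Spec (.of k))}
    {s : Spec (.of k) ⟶ Spec (.of k)} {f : X.left ⟶ X.left} {g : Y.left ⟶ Y.left}
    (hf : X.hom ≫ s = f ≫ X.hom) (hg : Y.hom ≫ s = g ≫ Y.hom) :
    (X ⊗ Y).left ⟶ (X ⊗ Y).left :=
  pullback.map X.hom Y.hom X.hom Y.hom f g s hf hg

/-- `(f, f')` is a semilinear automorphism of `𝓡` over `α ∈ Aut(k)`.  An isomorphism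
`𝓡 ≅ ᵅ𝓡` is viewed, through the projection `ᵅ𝓜 = 𝓜 ×ₖ Spec k ⟶ 𝓜`, as an automorphism `f` of
the scheme `𝓜` over `Spec α`.  It has to be compatible with the group law, to map `Ψ` and `Γ`
isomorphically to themselves, and its transpose has to map `Ψ*` isomorphically to itself; `f'` is
the inverse of the transpose of `f`, i.e. the unique semilinear automorphism of `𝓜*` over `α` with
`⟨f x, f' y⟩ = ⟨x, y⟩`. -/
structure IsSemilinear {k : Type u} [Field k] (𝓡 : PreBasedRootDatumScheme k) (α : k ≃+* k)
    (f : CategoryTheory.Aut 𝓡.M.left) (f' : CategoryTheory.Aut 𝓡.M'.left) : Prop where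
  base : 𝓡.M.hom ≫ specAut α = f.hom ≫ 𝓡.M.hom
  base' : 𝓡.M'.hom ≫ specAut α = f'.hom ≫ 𝓡.M'.hom
  mul : prodMap base base ≫ μ[𝓡.M].left = μ[𝓡.M].left ≫ f.hom
  mul' : prodMap base' base' ≫ μ[𝓡.M'].left = μ[𝓡.M'].left ≫ f'.hom
  pair : pullInt (prodMap base base') 𝓡.pair = 𝓡.pair
  root : ∃ g : CategoryTheory.Aut 𝓡.Ψ.left,
    g.hom ≫ 𝓡.rootIncl.left = 𝓡.rootIncl.left ≫ f.hom
  coroot : ∃ g : CategoryTheory.Aut 𝓡.Ψ'.left,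
    g.hom ≫ 𝓡.corootIncl.left = 𝓡.corootIncl.left ≫ f'.hom
  simple : ∃ g : CategoryTheory.Aut 𝓡.Γ.left,
    g.hom ≫ (𝓡.simpleIncl ≫ 𝓡.rootIncl).left = (𝓡.simpleIncl ≫ 𝓡.rootIncl).left ≫ f.hom

theorem specAut_one {k : Type u} [Field k] : specAut (1 : k ≃+* k) = 𝟙 _ :=
  Spec.map_id _

theorem specAut_mul {k : Type u} [Field k] (α β : k ≃+* k) :
    specAut (α * β) = specAut α ≫ specAut β := by
  unfold specAut
  rw [← Spec.map_comp]
  rfl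

section prodMap

variable {k : Type u} [Field k] {X Y : Over (Spec (.of k))}

theorem prodMap_id {f : X.left ⟶ X.left} {g : Y.left ⟶ Y.left}
    {s : Spec (.of k) ⟶ Spec (.of k)}
    (hs : s = 𝟙 _) (hf' : f = 𝟙 _) (hg' : g = 𝟙 _)
    (hf : X.hom ≫ s = f ≫ X.hom) (hg : Y.hom ≫ s = g ≫ Y.hom) :
    prodMap hf hg = 𝟙 (X ⊗ Y).left := by
  subst hs hf' hg'
  exact pullback.map_id

theorem prodMap_comp {s s' : Spec (.of k) ⟶ Spec (.of k)} {f f' : X.left ⟶ X.left}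
    {g g' : Y.left ⟶ Y.left} (hf : X.hom ≫ s = f ≫ X.hom) (hg : Y.hom ≫ s = g ≫ Y.hom)
    (hf' : X.hom ≫ s' = f' ≫ X.hom) (hg' : Y.hom ≫ s' = g' ≫ Y.hom)
    {s'' : Spec (.of k) ⟶ Spec (.of k)} {f'' : X.left ⟶ X.left} {g'' : Y.left ⟶ Y.left}
    (hs : s'' = s ≫ s') (hff : f'' = f ≫ f') (hgg : g'' = g ≫ g')
    (hf'' : X.hom ≫ s'' = f'' ≫ X.hom) (hg'' : Y.hom ≫ s'' = g'' ≫ Y.hom) :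
    prodMap hf'' hg'' = prodMap hf hg ≫ prodMap hf' hg' := by
  subst hs hff hgg
  exact (pullback.map_comp f f' g g' s s' hf hg hf' hg').symm

theorem pullInt_id {X : Scheme.{u}} (χ : C(X, ℤ)) : pullInt (𝟙 X) χ = χ := rfl

theorem pullInt_comp {X Y Z : Scheme.{u}} (f : X ⟶ Y) (g : Y ⟶ Z) (χ : C(Z, ℤ)) :
    pullInt (f ≫ g) χ = pullInt f (pullInt g χ) := by
  ext x
  simp [pullInt]

end prodMap

namespace IsSemilinear

variable {k : Type u} [Field k] {𝓡 : PreBasedRootDatumScheme k}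

theorem one : IsSemilinear 𝓡 1 1 1 where
  base := by
    rw [specAut_one]
    exact (Category.comp_id _).trans (Category.id_comp _).symm
  base' := by
    rw [specAut_one]
    exact (Category.comp_id _).trans (Category.id_comp _).symm
  mul := by
    rw [prodMap_id specAut_one rfl rfl]
    exact (Category.id_comp _).trans (Category.comp_id _).symm
  mul' := by
    rw [prodMap_id specAut_one rfl rfl]
    exact (Category.id_comp _).trans (Category.comp_id _).symm
  pair := by
    rw [prodMap_id specAut_one rfl rfl, pullInt_id]
  root := ⟨1, (Category.id_comp _).trans (Category.comp_id _).symm⟩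
  coroot := ⟨1, (Category.id_comp _).trans (Category.comp_id _).symm⟩
  simple := ⟨1, (Category.id_comp _).trans (Category.comp_id _).symm⟩

theorem comp {α β : k ≃+* k} {f g : CategoryTheory.Aut 𝓡.M.left}
    {f' g' : CategoryTheory.Aut 𝓡.M'.left}
    (hf : IsSemilinear 𝓡 α f f') (hg : IsSemilinear 𝓡 β g g') :
    IsSemilinear 𝓡 (β * α) (f * g) (f' * g') := by
  have b : 𝓡.M.hom ≫ specAut (β * α) = (f * g).hom ≫ 𝓡.M.hom := by
    rw [specAut_mul, ← Category.assoc, hg.base, Category.assoc, hf.base]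
    exact (Category.assoc _ _ _).symm
  have b' : 𝓡.M'.hom ≫ specAut (β * α) = (f' * g').hom ≫ 𝓡.M'.hom := by
    rw [specAut_mul, ← Category.assoc, hg.base', Category.assoc, hf.base']
    exact (Category.assoc _ _ _).symm
  refine ⟨b, b', ?_, ?_, ?_, ?_, ?_, ?_⟩
  · rw [prodMap_comp hg.base hg.base hf.base hf.base (specAut_mul _ _) rfl rfl b b,
      Category.assoc, hf.mul, ← Category.assoc, hg.mul, Category.assoc]
    rfl
  · rw [prodMap_comp hg.base' hg.base' hf.base' hf.base' (specAut_mul _ _) rfl rfl b' b',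
      Category.assoc, hf.mul', ← Category.assoc, hg.mul', Category.assoc]
    rfl
  · rw [prodMap_comp hg.base hg.base' hf.base hf.base' (specAut_mul _ _) rfl rfl b b',
      pullInt_comp, hf.pair, hg.pair]
  · obtain ⟨r, hr⟩ := hf.root
    obtain ⟨t, ht⟩ := hg.root
    refine ⟨r * t, ?_⟩
    change (t.hom ≫ r.hom) ≫ _ = _ ≫ (g.hom ≫ f.hom)
    rw [Category.assoc, hr, ← Category.assoc, ht, Category.assoc]
  · obtain ⟨r, hr⟩ := hf.coroot
    obtain ⟨t, ht⟩ := hg.coroot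
    refine ⟨r * t, ?_⟩
    change (t.hom ≫ r.hom) ≫ _ = _ ≫ (g'.hom ≫ f'.hom)
    rw [Category.assoc, hr, ← Category.assoc, ht, Category.assoc]
  · obtain ⟨r, hr⟩ := hf.simple
    obtain ⟨t, ht⟩ := hg.simple
    refine ⟨r * t, ?_⟩
    change (t.hom ≫ r.hom) ≫ _ = _ ≫ (g.hom ≫ f.hom)
    rw [Category.assoc, hr, ← Category.assoc, ht, Category.assoc]

theorem inv {α : k ≃+* k} {f : CategoryTheory.Aut 𝓡.M.left}
    {f' : CategoryTheory.Aut 𝓡.M'.left} (hf : IsSemilinear 𝓡 α f f') :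
    IsSemilinear 𝓡 α⁻¹ f⁻¹ f'⁻¹ := by
  have hs : specAut α ≫ specAut α⁻¹ = 𝟙 _ := by
    rw [← specAut_mul, mul_inv_cancel, specAut_one]
  have hs' : 𝟙 _ = specAut α⁻¹ ≫ specAut α := by
    rw [← specAut_mul, inv_mul_cancel, specAut_one]
  have i : 𝟙 _ = f⁻¹.hom ≫ f.hom := f.inv_hom_id.symm
  have i' : 𝟙 _ = f'⁻¹.hom ≫ f'.hom := f'.inv_hom_id.symm
  have b : 𝓡.M.hom ≫ specAut α⁻¹ = f⁻¹.hom ≫ 𝓡.M.hom := by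
    refine (Iso.eq_inv_comp f).2 ?_
    rw [← Category.assoc, ← hf.base, Category.assoc, hs, Category.comp_id]
  have b' : 𝓡.M'.hom ≫ specAut α⁻¹ = f'⁻¹.hom ≫ 𝓡.M'.hom := by
    refine (Iso.eq_inv_comp f').2 ?_
    rw [← Category.assoc, ← hf.base', Category.assoc, hs, Category.comp_id]
  have e {X : Over (Spec (.of k))} : X.hom ≫ 𝟙 (Spec (.of k)) = 𝟙 X.left ≫ X.hom :=
    (Category.comp_id _).trans (Category.id_comp _).symm
  refine ⟨b, b', ?_, ?_, ?_, ?_, ?_, ?_⟩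
  · refine (Iso.eq_comp_inv f).2 ?_
    rw [Category.assoc, ← hf.mul, ← Category.assoc,
      ← prodMap_comp b b hf.base hf.base hs' i i e e, prodMap_id rfl rfl rfl, Category.id_comp]
  · refine (Iso.eq_comp_inv f').2 ?_
    rw [Category.assoc, ← hf.mul', ← Category.assoc,
      ← prodMap_comp b' b' hf.base' hf.base' hs' i' i' e e, prodMap_id rfl rfl rfl,
      Category.id_comp]
  · conv_lhs => rw [← hf.pair]
    rw [← pullInt_comp, ← prodMap_comp b b' hf.base hf.base' hs' i i' e e,
      prodMap_id rfl rfl rfl, pullInt_id]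
  · obtain ⟨r, hr⟩ := hf.root
    refine ⟨r⁻¹, (Iso.inv_comp_eq r).2 ?_⟩
    rw [← Category.assoc]
    exact (Iso.eq_comp_inv f).2 hr.symm
  · obtain ⟨r, hr⟩ := hf.coroot
    refine ⟨r⁻¹, (Iso.inv_comp_eq r).2 ?_⟩
    rw [← Category.assoc]
    exact (Iso.eq_comp_inv f').2 hr.symm
  · obtain ⟨r, hr⟩ := hf.simple
    refine ⟨r⁻¹, (Iso.inv_comp_eq r).2 ?_⟩
    rw [← Category.assoc]
    exact (Iso.eq_comp_inv f).2 hr.symm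

end IsSemilinear

/-- The group `Aut(𝓡 → Spec k)` of semilinear automorphisms of `𝓡`.  Its elements are recorded as
triples `(α⁻¹, f, f')` where `(f, f')` is a semilinear automorphism over `α`; the group law is
composition of morphisms. -/
noncomputable def semilinearAut {k : Type u} [Field k] (𝓡 : PreBasedRootDatumScheme k) :
    Subgroup ((k ≃+* k) × CategoryTheory.Aut 𝓡.M.left × CategoryTheory.Aut 𝓡.M'.left) where
  carrier := {p | IsSemilinear 𝓡 p.1⁻¹ p.2.1 p.2.2}
  one_mem' := by
    change IsSemilinear 𝓡 (1 : k ≃+* k)⁻¹ 1 1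
    rw [inv_one]
    exact IsSemilinear.one
  mul_mem' := by
    intro p q hp hq
    change IsSemilinear 𝓡 (p.1 * q.1)⁻¹ (p.2.1 * q.2.1) (p.2.2 * q.2.2)
    rw [mul_inv_rev]
    exact IsSemilinear.comp hp hq
  inv_mem' := by
    intro p hp
    exact IsSemilinear.inv hp

/-- The homomorphism `Aut(𝓡 → Spec k) → Aut(k)` which maps a semilinear automorphism over `α` to
`α⁻¹`. -/
noncomputable def semilinearAutToAut {k : Type u} [Field k] (𝓡 : PreBasedRootDatumScheme k) :
    semilinearAut 𝓡 →* (k ≃+* k) :=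
  (MonoidHom.fst _ _).comp (semilinearAut 𝓡).subtype

/-- The short exact sequence `1 → Aut 𝓡 → Aut(𝓡 → Spec k) → Aut_𝓡(k) → 1`, where `Aut 𝓡` consists
of the semilinear automorphisms over the identity of `k` and `Aut_𝓡(k) ≤ Aut(k)` is the image of
`Aut(𝓡 → Spec k)`. -/
noncomputable def semilinearSeq {k : Type u} [Field k] (𝓡 : PreBasedRootDatumScheme k) : GrpSeq.{u} :=
  GrpSeq.ofHom (semilinearAutToAut 𝓡)

theorem semilinearSeq_shortExact {k : Type u} [Field k] (𝓡 : PreBasedRootDatumScheme k) :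
    (semilinearSeq 𝓡).ShortExact :=
  GrpSeq.ofHom_shortExact _

end Schemes

/-!
Galois descent turns the statement into one about groups. Let `K` be the separable closure, `G =
Gal(K/k)`, `A = Aut R` and `c : G → A` the cocycle of the splitting `f`. A semilinear automorphism
`p` and an automorphism `σ` of `K` over the same automorphism of `k` together act on the split
form over `K`, hence on `R` by some `φ ∈ A` (`SplittingOver.Induces`,
`SplittingOver.exists_induces`). The pairs `(σ, φ)` which arise in this way are exactly those with
`φ c(τ) φ⁻¹ = c(σ τ σ⁻¹)` for all `τ ∈ G` (`Induces.mem_twistedPairs`, `exists_semilinear`), and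
two such pairs define the same `p` if and only if they differ by a pair `(τ, c(τ))`. The converse
rests on descent for morphisms out of a scheme which becomes constant over `K`
(`IsConstantVia.exists_hom`): such a scheme is discrete and reduced, so it is a disjoint union of
spectra of subfields of `K`, and descent is Galois theory for each of them.

The group `A` is small. It acts faithfully on the leaves of the Dynkin graph. By positivity of the
Gram matrix of the simple roots this graph is a tree with at most three leaves, so `A` embeds in
`S₃` (`IsSimple.exists_injective_perm`). If `A` has an element of order three, the diagram is
`D₄`, and `A` also contains an involution (`IsSimple.exists_involution`): the reflection which
interchanges two end vertices preserves the lattice `M`, because `M` is stable under the element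
of order three.

Since `l` is the field fixed by `ker c`, the order of `Gal(l/k)` is that of the image `C` of `c`.
If `C` is trivial, every pair `(σ, φ)` is allowed, and `p` amounts to `φ` and an automorphism of
`k` (`exists_mulEquiv_prod`). Otherwise each `p` has a preferred representative `(σ, φ)`, unique
up to the automorphisms fixing a subextension `E`, with `σ` preserving `E` and `φ` in a subgroup
`H` of `A`. Then `p ↦ σ|_E` is an isomorphism onto `Aut(E ≥ k)` (`exists_mulEquiv_autPreserving`).
For `|C| = 2` one takes `E = l` and `H = 1`. For `|C| = 3` one takes `E = l` and for `H` a
subgroup of order two, which exists by the above and realizes the inversion of `C`. For `|C| = 6`,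
where `C = A ≅ S₃`, one takes `E = l₃` and `H = 1`, because every automorphism of `S₃` is inner.
The conditions which these choices have to satisfy are collected in `IsTwistComplement`. In the
last case the centre of `A` is trivial, so `𝓡` has no automorphisms over `k` and the sequence
splits.
-/

/-! ### Schemes which become constant over a field extension -/

section ConstantSchemes

variable {k : Type u} [Field k] {K : Type u} [Field K] [Algebra k K]

instance : Unique ((specOver k K).left : Scheme.{u}) := inferInstanceAs (Unique (Spec (.of K)))

instance : IsIntegral ((specOver k K).left : Scheme.{u}) :=
  inferInstanceAs (IsIntegral (Spec (.of K)))

variable {X Y : Over (Spec (.of k))} {E : Type u} {x : E → (specOver k K ⟶ X)}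

theorem ι_comp_sigmaDesc (x : E → (specOver k K ⟶ X)) (e : E) :
    Sigma.ι (fun _ : E => (specOver k K).left) e ≫
      Sigma.desc (fun e : E => (lift (x e) (𝟙 (specOver k K))).left) =
      (lift (x e) (𝟙 (specOver k K))).left :=
  Sigma.ι_desc _ _

/-- The preimage in `T` of the component of `X_K` given by a point of `X`. -/
noncomputable def componentPreimage {T : Over (Spec (.of k))} (t : T ⟶ X ⊗ specOver k K)
    (y : specOver k K ⟶ X) : Over (Spec (.of k)) :=
  Over.mk (pullback.fst t.left (lift y (𝟙 (specOver k K))).left ≫ T.hom)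

/-- The projection of the preimage of a component of `X_K` to `T`. -/
noncomputable def componentFst {T : Over (Spec (.of k))} (t : T ⟶ X ⊗ specOver k K)
    (y : specOver k K ⟶ X) : componentPreimage t y ⟶ T :=
  Over.homMk (pullback.fst _ _) rfl

/-- The projection of the preimage of a component of `X_K` to that component. -/
noncomputable def componentSnd {T : Over (Spec (.of k))} (t : T ⟶ X ⊗ specOver k K)
    (y : specOver k K ⟶ X) : componentPreimage t y ⟶ specOver k K :=
  Over.homMk (pullback.snd _ _) <| by
    change _ = pullback.fst t.left (lift y (𝟙 (specOver k K))).left ≫ T.hom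
    rw [← Over.w t, pullback.condition_assoc, Over.w]
    rfl

/-- The preimage of a component: over it, `t` factors through the point defining the component. -/
theorem componentFst_comp {T : Over (Spec (.of k))} (t : T ⟶ X ⊗ specOver k K)
    (y : specOver k K ⟶ X) :
    componentFst t y ≫ t = componentSnd t y ≫ lift y (𝟙 (specOver k K)) :=
  Over.OverMorphism.ext pullback.condition

namespace IsConstantVia

variable (hx : IsConstantVia K X x)
include hx

theorem isOpenImmersion (e : E) : IsOpenImmersion (lift (x e) (𝟙 (specOver k K))).left := by
  have : IsIso _ := hx
  rw [← ι_comp_sigmaDesc]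
  infer_instance

theorem exists_mem_range (z : (X ⊗ specOver k K).left) :
    ∃ e, z ∈ Set.range (lift (x e) (𝟙 (specOver k K))).left := by
  have : IsIso _ := hx
  obtain ⟨y, rfl⟩ := (Sigma.desc
    (fun e : E => (lift (x e) (𝟙 (specOver k K))).left)).surjective z
  obtain ⟨e, y, rfl⟩ := Scheme.Cover.exists_eq (sigmaOpenCover fun _ : E => (specOver k K).left) y
  exact ⟨e, y, congrArg (fun f => f.base y) (ι_comp_sigmaDesc x e).symm⟩

theorem eq_of_apply_eq {e e' : E} {y y' : (specOver k K).left}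
    (h : (lift (x e) (𝟙 (specOver k K))).left y = (lift (x e') (𝟙 (specOver k K))).left y') :
    e = e' := by
  have : IsIso _ := hx
  rw [← ι_comp_sigmaDesc, ← ι_comp_sigmaDesc, Scheme.Hom.comp_apply, Scheme.Hom.comp_apply] at h
  have h' := (sigmaι_eq_iff _ _ _ _ _).1 ((Sigma.desc
    (fun e : E => (lift (x e) (𝟙 (specOver k K))).left)).isOpenEmbedding.injective h)
  exact congrArg Sigma.fst h'

/-- The open cover of a scheme over `X_K` by the preimages of the components of `X_K`. -/
noncomputable def cover {T : Over (Spec (.of k))} (t : T ⟶ X ⊗ specOver k K) :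
    T.left.OpenCover where
  I₀ := E
  X e := pullback t.left (lift (x e) (𝟙 (specOver k K))).left
  f e := pullback.fst _ _
  mem₀ := by
    rw [Scheme.presieve₀_mem_precoverage_iff]
    refine ⟨fun z => ?_, fun e => ?_⟩
    · obtain ⟨e, y, hy⟩ := hx.exists_mem_range (t.left z)
      obtain ⟨p, hp, -⟩ := Scheme.Pullback.exists_preimage_pullback z y hy.symm
      exact ⟨e, p, hp⟩
    · have := hx.isOpenImmersion e
      infer_instance

theorem exists_cover_point {T : Over (Spec (.of k))} (t : T ⟶ X ⊗ specOver k K) (z : T.left) :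
    ∃ (e : E) (P : Over (Spec (.of k))) (a : P ⟶ T) (b : P ⟶ specOver k K),
      a ≫ t = b ≫ lift (x e) (𝟙 _) ∧ z ∈ Set.range a.left := by
  obtain ⟨e, p, hp⟩ := Scheme.Cover.exists_eq (hx.cover t) z
  exact ⟨e, _, componentFst t (x e), componentSnd t (x e), componentFst_comp t (x e), p, hp⟩

theorem hom_ext_prod {T : Over (Spec (.of k))} (t : T ⟶ X ⊗ specOver k K) {Z : Scheme.{u}}
    {g₁ g₂ : T.left ⟶ Z}
    (h : ∀ (e : E) (P : Over (Spec (.of k))) (a : P ⟶ T) (b : P ⟶ specOver k K),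
      a ≫ t = b ≫ lift (x e) (𝟙 _) → a.left ≫ g₁ = a.left ≫ g₂) : g₁ = g₂ := by
  refine Scheme.Cover.hom_ext (hx.cover t) _ _ fun e => ?_
  exact h e _ (componentFst t (x e)) (componentSnd t (x e)) (componentFst_comp t (x e))

end IsConstantVia

instance (T : Over (Spec (.of k))) : Surjective (fst T (specOver k K)).left := by
  change Surjective (pullback.fst _ _)
  infer_instance

instance (T : Over (Spec (.of k))) : Flat (fst T (specOver k K)).left := by
  change Flat (pullback.fst _ _)
  infer_instance

instance (T : Over (Spec (.of k))) : UniversallyOpen (fst T (specOver k K)).left := by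
  change UniversallyOpen (pullback.fst _ _)
  infer_instance

namespace IsConstantVia

variable (hx : IsConstantVia K X x)
include hx

/-- Every point of a scheme over `X` is in the image of a scheme on which the morphism to `X` factors
through one of the given points. -/
theorem exists_point {T : Over (Spec (.of k))} (t : T ⟶ X) (z : T.left) :
    ∃ (e : E) (P : Over (Spec (.of k))) (a : P ⟶ T) (b : P ⟶ specOver k K),
      a ≫ t = b ≫ x e ∧ z ∈ Set.range a.left := by
  obtain ⟨w, rfl⟩ := (fst T (specOver k K)).left.surjective z
  obtain ⟨e, P, a, b, h, p, hp⟩ := hx.exists_cover_point (t ▷ _) w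
  refine ⟨e, P, a ≫ fst _ _, b, ?_, p, ?_⟩
  · simpa using h =≫ fst _ _
  · rw [← hp]
    rfl

/-- Morphisms out of a scheme over `X` are determined by their restrictions to the schemes on
which the morphism to `X` factors through one of the given points. -/
theorem hom_ext_of_factors {T : Over (Spec (.of k))} (t : T ⟶ X) {Z : Scheme.{u}}
    {g₁ g₂ : T.left ⟶ Z}
    (h : ∀ (e : E) (P : Over (Spec (.of k))) (a : P ⟶ T) (b : P ⟶ specOver k K),
      a ≫ t = b ≫ x e → a.left ≫ g₁ = a.left ≫ g₂) : g₁ = g₂ := by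
  have : Epi (fst T (specOver k K)).left := Flat.epi_of_flat_of_surjective _
  rw [← cancel_epi (fst T (specOver k K)).left]
  refine hx.hom_ext_prod (t ▷ _) fun e P a b hab => ?_
  have := h e P (a ≫ fst _ _) b (by simpa using hab =≫ fst _ _)
  simpa using this

theorem hom_ext {Z : Scheme.{u}} {g₁ g₂ : X.left ⟶ Z}
    (h : ∀ e, (x e).left ≫ g₁ = (x e).left ≫ g₂) : g₁ = g₂ := by
  refine hx.hom_ext_of_factors (𝟙 X) fun e P a b hab => ?_
  rw [Category.comp_id] at hab
  rw [hab, Over.comp_left, Category.assoc, Category.assoc, h]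

theorem hom_ext_prod_points {E' : Type u} {y : E' → (specOver k K ⟶ Y)}
    (hy : IsConstantVia K Y y) {Z : Scheme.{u}} {g₁ g₂ : (X ⊗ Y).left ⟶ Z}
    (h : ∀ e e', (lift (x e) (y e')).left ≫ g₁ = (lift (x e) (y e')).left ≫ g₂) : g₁ = g₂ := by
  refine hx.hom_ext_of_factors (fst X Y) fun e P a b hab => ?_
  refine hy.hom_ext_prod (lift (a ≫ snd X Y) b) fun e' P' a' b' hab' => ?_
  have h₁ : a' ≫ a ≫ snd X Y = b' ≫ y e' := by simpa using hab' =≫ fst _ _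
  have h₂ : a' ≫ b = b' := by simpa using hab' =≫ snd _ _
  have h₃ : a' ≫ a = b' ≫ lift (x e) (y e') := by
    ext1
    · rw [Category.assoc, hab, ← Category.assoc, h₂]
      simp
    · simpa using h₁
  rw [← Category.assoc, ← Category.assoc, ← Over.comp_left, h₃, Over.comp_left,
    Category.assoc, Category.assoc, h]

theorem exists_prod_point {E' : Type u} {y : E' → (specOver k K ⟶ Y)}
    (hy : IsConstantVia K Y y) (z : (X ⊗ Y).left) :
    ∃ e e', z ∈ Set.range (lift (x e) (y e')).left := by
  obtain ⟨e, P, a, b, hab, p, rfl⟩ := hx.exists_point (fst X Y) z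
  obtain ⟨e', P', a', b', hab', p', rfl⟩ := hy.exists_cover_point (lift (a ≫ snd X Y) b) p
  have h₁ : a' ≫ a ≫ snd X Y = b' ≫ y e' := by simpa using hab' =≫ fst _ _
  have h₂ : a' ≫ b = b' := by simpa using hab' =≫ snd _ _
  have h₃ : a' ≫ a = b' ≫ lift (x e) (y e') := by
    ext1
    · rw [Category.assoc, hab, ← Category.assoc, h₂]
      simp
    · simpa using h₁
  refine ⟨e, e', b'.left p', ?_⟩
  rw [← Scheme.Hom.comp_apply, ← Over.comp_left, ← h₃]
  rfl

theorem injective : Function.Injective x := by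
  intro e e' h
  exact hx.eq_of_apply_eq (y := default) (y' := default) (by rw [h])

/-- Every `K`-point of `X` is one of the given points: `Spec K` is a single point, so a section of
`X_K` lands in one component. -/
theorem surjective : Function.Surjective x := by
  intro z
  obtain ⟨e, y, hy⟩ := hx.exists_mem_range ((lift z (𝟙 (specOver k K))).left default)
  have := hx.isOpenImmersion e
  have hr : Set.range (lift z (𝟙 (specOver k K))).left ⊆
      Set.range (lift (x e) (𝟙 (specOver k K))).left := by
    rintro _ ⟨w, rfl⟩
    rw [Subsingleton.elim w default]
    exact ⟨y, hy⟩
  set g := IsOpenImmersion.lift (lift (x e) (𝟙 (specOver k K))).left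
    (lift z (𝟙 (specOver k K))).left hr with hg
  have hgf : g ≫ (lift (x e) (𝟙 (specOver k K))).left = (lift z (𝟙 (specOver k K))).left :=
    IsOpenImmersion.lift_fac _ _ _
  have h₁ : g = 𝟙 _ := by
    have := hgf =≫ (snd X (specOver k K)).left
    simpa only [Category.assoc, ← Over.comp_left, lift_snd, Over.id_left, Category.comp_id]
      using this
  have h₂ := hgf =≫ (fst X (specOver k K)).left
  rw [h₁, Category.id_comp, ← Over.comp_left, ← Over.comp_left, lift_fst, lift_fst] at h₂
  exact ⟨e, Over.OverMorphism.ext h₂⟩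

end IsConstantVia

end ConstantSchemes

/-! ### Galois descent for morphisms out of étale schemes -/

section GaloisDescent

variable {k : Type u} [Field k] {K : Type u} [Field K] [Algebra k K]

/-- A homomorphism into a Galois extension that is invariant under the automorphisms fixing a
subextension `κ` takes values in `κ`. -/
theorem exists_ringHom_comp_eq_of_fixed [IsGalois k K] {κ L : Type*} [Field κ] [Field L]
    (s : k →+* κ) (i : κ →+* K) (hi : i.comp s = algebraMap k K) (j : L →+* K)
    (h : ∀ τ : K ≃ₐ[k] K, (∀ a, τ (i a) = i a) → ∀ b, τ (j b) = j b) :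
    ∃ j' : L →+* κ, i.comp j' = j := by
  let := s.toAlgebra
  let i' : κ →ₐ[k] K := ⟨i, fun c => congrArg (fun f => f c) hi⟩
  have hr : ∀ b, j b ∈ i.range := by
    intro b
    change j b ∈ i'.fieldRange
    rw [← InfiniteGalois.fixedField_fixingSubgroup i'.fieldRange,
      IntermediateField.mem_fixedField_iff]
    intro τ hτ
    refine h τ (fun a => ?_) b
    exact (IntermediateField.mem_fixingSubgroup_iff _ _).1 hτ _ ⟨a, rfl⟩
  let e : κ ≃+* i.range := RingEquiv.ofBijective i.rangeRestrict
    ⟨fun a b hab => i.injective (congrArg Subtype.val hab), i.rangeRestrict_surjective⟩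
  refine ⟨(e.symm : i.range →+* κ).comp (j.codRestrict i.range hr), ?_⟩
  ext b
  have : i.rangeRestrict (e.symm (j.codRestrict i.range hr b)) = j.codRestrict i.range hr b :=
    e.apply_symm_apply _
  exact congrArg Subtype.val this

/-- Two embeddings of an extension of `k` into a Galois extension of `k` are conjugate. -/
theorem exists_algEquiv_comp_eq [IsGalois k K] {κ : Type*} [Field κ] (s : k →+* κ) (i i' : κ →+* K)
    (hi : i.comp s = algebraMap k K) (hi' : i'.comp s = algebraMap k K) :
    ∃ τ : K ≃ₐ[k] K, ∀ a, τ (i a) = i' a := by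
  let := s.toAlgebra
  let := i.toAlgebra
  have : IsScalarTower k κ K := .of_algebraMap_eq' hi.symm
  let f : κ →ₐ[k] K := ⟨i', fun c => congrArg (fun f => f c) hi'⟩
  let g : K →ₐ[k] K := f.liftNormal K
  refine ⟨AlgEquiv.ofBijective g (Algebra.IsAlgebraic.algHom_bijective g), fun a => ?_⟩
  exact f.liftNormal_commutes K a

variable {X : Over (Spec (.of k))} {E : Type u} {x : E → (specOver k K ⟶ X)}

/-- The projection `X_K → X` is open, and `X_K` is a disjoint union of one-point spaces. -/
theorem IsConstantVia.discreteTopology (hx : IsConstantVia K X x) : DiscreteTopology X.left := by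
  refine discreteTopology_iff_isOpen_singleton.2 fun z => ?_
  obtain ⟨w, rfl⟩ := (fst X (specOver k K)).left.surjective z
  obtain ⟨e, y, rfl⟩ := hx.exists_mem_range w
  have := hx.isOpenImmersion e
  have h := (fst X (specOver k K)).left.isOpenMap _
    (lift (x e) (𝟙 (specOver k K))).left.isOpenEmbedding.isOpen_range
  convert h
  rw [Set.range_unique, Set.image_singleton, Subsingleton.elim y default]

/-- Reducedness descends along the faithfully flat projection `X_K → X`. -/
theorem IsConstantVia.isReduced (hx : IsConstantVia K X x) : IsReduced X.left := by
  have : IsIso _ := hx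
  have : ∀ e, IsReduced ((sigmaOpenCover fun _ : E => (specOver k K).left).X e) :=
    fun _ => inferInstanceAs (IsReduced (specOver k K).left)
  have : IsReduced (∐ fun _ : E => (specOver k K).left) :=
    IsReduced.of_openCover _ (sigmaOpenCover _)
  have : IsReduced (X ⊗ specOver k K).left := isReduced_of_isOpenImmersion
    (inv (Sigma.desc (fun e : E => (lift (x e) (𝟙 (specOver k K))).left)))
  have (z : X.left) : _root_.IsReduced (X.left.presheaf.stalk z) := by
    obtain ⟨w, rfl⟩ := (fst X (specOver k K)).left.surjective z
    refine isReduced_of_injective ((fst X (specOver k K)).left.stalkMap w).hom ?_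
    algebraize [((fst X (specOver k K)).left.stalkMap w).hom]
    have : Module.FaithfullyFlat (X.left.presheaf.stalk ((fst X (specOver k K)).left w))
        ((X ⊗ specOver k K).left.presheaf.stalk w) :=
      @Module.FaithfullyFlat.of_flat_of_isLocalHom _ _ _ _ _ _ _
        (Flat.stalkMap _ w) ((fst X (specOver k K)).left.toLRSHom.prop w)
    exact ‹RingHom.FaithfullyFlat _›.injective
  exact isReduced_of_isReduced_stalk _

/-- In a reduced discrete scheme every point is the image of an open immersion of the spectrum of
a field. -/
theorem exists_field_openImmersion (Z : Scheme.{u}) [DiscreteTopology Z] [IsReduced Z] (z : Z) :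
    ∃ (κ : Type u) (_ : Field κ) (j : Spec (.of κ) ⟶ Z), IsOpenImmersion j ∧
      Set.range j = {z} := by
  let U : Z.Opens := ⟨{z}, isOpen_discrete _⟩
  have : Subsingleton U := inferInstanceAs (Subsingleton ({z} : Set Z))
  have : Nonempty U := inferInstanceAs (Nonempty ({z} : Set Z))
  have : IrreducibleSpace U :=
    { toNonempty := ‹_›, isPreirreducible_univ := Set.subsingleton_univ.isPreirreducible }
  have : IsIntegral U := isIntegral_of_irreducibleSpace_of_isReduced _
  refine ⟨Γ(U, ⊤), (isField_of_isIntegral_of_subsingleton (U : Scheme.{u})).toField,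
    (U : Scheme.{u}).isoSpec.inv ≫ U.ι, ?_, ?_⟩
  · exact inferInstanceAs (IsOpenImmersion ((U : Scheme.{u}).isoSpec.inv ≫ U.ι))
  · refine (Set.range_comp U.ι (U : Scheme.{u}).isoSpec.inv).trans ?_
    have h := (U : Scheme.{u}).isoSpec.inv.homeomorph.surjective.range_eq
    refine (congrArg (U.ι '' ·) h).trans ?_
    rw [Set.image_univ]
    exact U.range_ι

/-- A `K`-point which is invariant under the automorphisms fixing a subextension `κ` comes from a
`κ`-point. -/
theorem exists_specMap_comp_eq_of_fixed [IsGalois k K] {κ : Type u} [Field κ] (s : k →+* κ)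
    (i : κ →+* K) (hi : i.comp s = algebraMap k K) {Z : Scheme.{u}} (y : Spec (.of K) ⟶ Z)
    (h : ∀ τ : K ≃ₐ[k] K, (∀ a, τ (i a) = i a) →
      Spec.map (CommRingCat.ofHom (τ : K →+* K)) ≫ y = y) :
    ∃ y' : Spec (.of κ) ⟶ Z, Spec.map (CommRingCat.ofHom i) ≫ y' = y := by
  obtain ⟨⟨z, j⟩, rfl⟩ := (Scheme.SpecToEquivOfField K Z).symm.surjective y
  simp only [Scheme.SpecToEquivOfField_symm_apply] at h ⊢
  obtain ⟨j', hj'⟩ := exists_ringHom_comp_eq_of_fixed s i hi j.hom fun τ hτ b => by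
    have h' := h τ hτ
    rw [← Category.assoc, cancel_mono, ← Spec.map_comp] at h'
    exact congrArg (fun f => f.hom b) (Spec.map_injective h')
  refine ⟨Spec.map (CommRingCat.ofHom j') ≫ Z.fromSpecResidueField z, ?_⟩
  rw [← Category.assoc, ← Spec.map_comp, ← CommRingCat.ofHom_comp, hj']
  rfl

/-- Galois descent for morphisms out of a reduced discrete scheme: a Galois equivariant family of
`K`-points of `Z` indexed by a family of `K`-points meeting every point of `X` comes from a
morphism `X ⟶ Z`. -/
theorem exists_hom_of_discreteTopology [IsGalois k K] {X Z : Scheme.{u}} [DiscreteTopology X]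
    [IsReduced X] (p : X ⟶ Spec (.of k)) {E : Type u} (x : E → (Spec (.of K) ⟶ X))
    (hxp : ∀ e, x e ≫ p = Spec.map (CommRingCat.ofHom (algebraMap k K)))
    (hpt : ∀ z, ∃ e, x e default = z) (y : E → (Spec (.of K) ⟶ Z))
    (h : ∀ (τ : K ≃ₐ[k] K) (e e' : E),
      Spec.map (CommRingCat.ofHom (τ : K →+* K)) ≫ x e = x e' →
      Spec.map (CommRingCat.ofHom (τ : K →+* K)) ≫ y e = y e') :
    ∃ F : X ⟶ Z, ∀ e, x e ≫ F = y e := by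
  choose κ hκ j hj hjr using exists_field_openImmersion X
  have hs (z : X) : ∃ s : k →+* κ z, j z ≫ p = Spec.map (CommRingCat.ofHom s) :=
    ⟨(Spec.preimage (j z ≫ p)).hom, (Spec.map_preimage _).symm⟩
  choose s hs using hs
  -- Every point with image `z` factors through the spectrum of the field at `z`.
  have hfac (e : E) (z : X) (hez : x e default = z) :
      ∃ i : κ z →+* K, i.comp (s z) = algebraMap k K ∧
        x e = Spec.map (CommRingCat.ofHom i) ≫ j z := by
    have := hj z
    have hr : Set.range (x e) ⊆ Set.range (j z) := by
      rw [hjr, Set.range_unique, hez]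
    have hl := IsOpenImmersion.lift_fac (j z) (x e) hr
    obtain ⟨i, hi⟩ := Spec.map_surjective (IsOpenImmersion.lift (j z) (x e) hr)
    rw [← hi] at hl
    refine ⟨i.hom, ?_, hl.symm⟩
    have hw := hxp e
    rw [← hl, Category.assoc, hs, ← Spec.map_comp] at hw
    exact congrArg CommRingCat.Hom.hom (Spec.map_injective hw)
  choose e he using hpt
  choose i hi hie using fun z => hfac (e z) z (he z)
  have hy' (z : X) : ∃ y' : Spec (.of (κ z)) ⟶ Z,
      Spec.map (CommRingCat.ofHom (i z)) ≫ y' = y (e z) := by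
    refine exists_specMap_comp_eq_of_fixed (s z) (i z) (hi z) _ fun τ hτ => ?_
    refine h τ (e z) (e z) ?_
    rw [hie, ← Category.assoc, ← Spec.map_comp, ← CommRingCat.ofHom_comp]
    congr 3
    ext a
    exact hτ a
  choose y' hy' using hy'
  let 𝒰 : X.OpenCover :=
    { I₀ := X
      X := fun z => Spec (.of (κ z))
      f := j
      mem₀ := by
        rw [Scheme.presieve₀_mem_precoverage_iff]
        exact ⟨fun z => ⟨z, by rw [hjr]; rfl⟩, hj⟩ }
  have hglue (z z' : X) :
      pullback.fst (j z) (j z') ≫ y' z = pullback.snd (j z) (j z') ≫ y' z' := by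
    by_cases hz : z = z'
    · subst hz
      have := hj z
      rw [(cancel_mono (j z)).1 (pullback.condition (f := j z) (g := j z))]
    · have : IsEmpty (pullback (j z) (j z') : Scheme.{u}) := by
        refine ⟨fun q => hz ?_⟩
        have h₁ : j z (pullback.fst (j z) (j z') q) ∈ Set.range (j z) := ⟨_, rfl⟩
        have h₂ : j z' (pullback.snd (j z) (j z') q) ∈ Set.range (j z') := ⟨_, rfl⟩
        rw [hjr, Set.mem_singleton_iff] at h₁ h₂
        refine h₁.symm.trans (Eq.trans ?_ h₂)
        rw [← Scheme.Hom.comp_apply, pullback.condition, Scheme.Hom.comp_apply]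
      exact isInitialOfIsEmpty.hom_ext _ _
  refine ⟨𝒰.glueMorphisms y' hglue, fun e' => ?_⟩
  obtain ⟨z, hz⟩ : ∃ z, x e' default = z := ⟨_, rfl⟩
  obtain ⟨i', hi', hie'⟩ := hfac e' z hz
  have hF : j z ≫ 𝒰.glueMorphisms y' hglue = y' z := 𝒰.ι_glueMorphisms y' hglue z
  -- All points with image `z` are conjugate.
  obtain ⟨τ, hτ⟩ := exists_algEquiv_comp_eq (s z) (i z) i' (hi z) hi'
  have hτ' : Spec.map (CommRingCat.ofHom (τ : K →+* K)) ≫ Spec.map (CommRingCat.ofHom (i z)) =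
      Spec.map (CommRingCat.ofHom i') := by
    rw [← Spec.map_comp, ← CommRingCat.ofHom_comp]
    congr 2
    ext a
    exact hτ a
  rw [← h τ (e z) e', ← hy', hie', Category.assoc, hF, ← hτ', Category.assoc]
  rw [hie, hie', ← hτ', Category.assoc]

/-- Galois descent for morphisms out of a scheme `X` that becomes constant over a Galois extension
`K` of `k`: a family of `K`-points of `Z` indexed by the `K`-points of `X` comes from a morphism
`X ⟶ Z` as soon as it is equivariant for the Galois group. -/
theorem IsConstantVia.exists_hom [IsGalois k K] (hx : IsConstantVia K X x) {Z : Scheme.{u}}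
    (y : E → ((specOver k K).left ⟶ Z))
    (h : ∀ (τ : K ≃ₐ[k] K) (e e' : E), specOverMap (τ : K →ₐ[k] K) ≫ x e = x e' →
      (specOverMap (τ : K →ₐ[k] K)).left ≫ y e = y e') :
    ∃ F : X.left ⟶ Z, ∀ e, (x e).left ≫ F = y e := by
  have := hx.discreteTopology
  have := hx.isReduced
  refine exists_hom_of_discreteTopology (K := K) X.hom (fun e => (x e).left) (fun e => Over.w (x e))
    (fun z => ?_) y fun τ e e' hee' => h τ e e' (Over.OverMorphism.ext hee')
  obtain ⟨e, P, a, b, hab, q, rfl⟩ := hx.exists_point (𝟙 X) z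
  refine ⟨e, ?_⟩
  rw [Category.comp_id] at hab
  rw [hab, Over.comp_left, Scheme.Hom.comp_apply, Subsingleton.elim (b.left q) default]
  rfl

end GaloisDescent

/-! ### Semilinear automorphisms and points -/

section SemilinearPoints

variable {k : Type u} [Field k] {K : Type u} [Field K] [Algebra k K]
  {X : Over (Spec (.of k))} {E : Type u} {x : E → (specOver k K ⟶ X)}

/-- The morphism `Spec σ` of the scheme underlying `specOver k K`, for an automorphism `σ` of `K`
which need not fix `k`. -/
noncomputable def specOverAut (k : Type u) [Field k] {K : Type u} [Field K] [Algebra k K]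
    (σ : K ≃+* K) : (specOver k K).left ⟶ (specOver k K).left :=
  specAut σ

theorem specOverAut_one : specOverAut k (1 : K ≃+* K) = 𝟙 _ := specAut_one

theorem specOverAut_mul (σ τ : K ≃+* K) :
    specOverAut k (σ * τ) = specOverAut k σ ≫ specOverAut k τ := specAut_mul σ τ

theorem specOverAut_comp_inv (σ : K ≃+* K) :
    specOverAut k σ ≫ specOverAut k σ⁻¹ = 𝟙 _ := by
  rw [← specOverAut_mul, mul_inv_cancel, specOverAut_one]

theorem specOverAut_inv_comp (σ : K ≃+* K) :
    specOverAut k σ⁻¹ ≫ specOverAut k σ = 𝟙 _ := by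
  rw [← specOverAut_mul, inv_mul_cancel, specOverAut_one]

theorem specOverAut_comp_inv_assoc (σ : K ≃+* K) {Z : Scheme.{u}} (f : (specOver k K).left ⟶ Z) :
    specOverAut k σ ≫ specOverAut k σ⁻¹ ≫ f = f := by
  rw [← Category.assoc, specOverAut_comp_inv, Category.id_comp]

theorem specOverAut_inv_comp_assoc (σ : K ≃+* K) {Z : Scheme.{u}} (f : (specOver k K).left ⟶ Z) :
    specOverAut k σ⁻¹ ≫ specOverAut k σ ≫ f = f := by
  rw [← Category.assoc, specOverAut_inv_comp, Category.id_comp]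

theorem specOverMap_left_eq (τ : K ≃ₐ[k] K) :
    (specOverMap (τ : K →ₐ[k] K)).left = specOverAut k (τ : K ≃+* K) := rfl

theorem specOverAut_hom (σ : AutPreserving k K) :
    specOverAut k (σ : K ≃+* K) ≫ (specOver k K).hom =
      (specOver k K).hom ≫ specAut (AutPreserving.res k K σ) := by
  change Spec.map _ ≫ Spec.map _ = Spec.map _ ≫ Spec.map _
  rw [← Spec.map_comp, ← Spec.map_comp]
  congr 1
  ext c
  exact (AutPreserving.algebraMap_res k K σ c).symm

theorem specOverAut_inv_hom (σ : AutPreserving k K) :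
    specOverAut k (σ : K ≃+* K)⁻¹ ≫ (specOver k K).hom =
      (specOver k K).hom ≫ specAut (AutPreserving.res k K σ)⁻¹ := by
  have := specOverAut_hom σ⁻¹
  rwa [map_inv] at this

/-- The `K`-point `x ↦ F ∘ x ∘ Spec σ` obtained from a semilinear endomorphism `F` over
`(res σ)⁻¹`. -/
theorem exists_point_of_semilinear (σ : AutPreserving k K) {F : X.left ⟶ X.left}
    (hF : X.hom ≫ specAut (AutPreserving.res k K σ)⁻¹ = F ≫ X.hom) (y : specOver k K ⟶ X) :
    ∃ z : specOver k K ⟶ X, z.left = specOverAut k (σ : K ≃+* K) ≫ y.left ≫ F := by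
  refine ⟨Over.homMk (specOverAut k (σ : K ≃+* K) ≫ y.left ≫ F) ?_, rfl⟩
  rw [Category.assoc, Category.assoc, ← hF, ← Category.assoc y.left, Over.w, ← Category.assoc,
    specOverAut_hom, Category.assoc, ← specAut_mul, mul_inv_cancel, specAut_one, Category.comp_id]

/-- A semilinear automorphism of `X` over `(res σ)⁻¹`, composed with `σ`, permutes the `K`-points. -/
theorem IsConstantVia.exists_perm (hx : IsConstantVia K X x) (σ : AutPreserving k K)
    (F : X.left ≅ X.left)
    (hF : X.hom ≫ specAut (AutPreserving.res k K σ)⁻¹ = F.hom ≫ X.hom) :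
    ∃ π : E ≃ E, ∀ e, specOverAut k (σ : K ≃+* K) ≫ (x e).left ≫ F.hom = (x (π e)).left := by
  have hF' : X.hom ≫ specAut (AutPreserving.res k K σ⁻¹)⁻¹ = F.inv ≫ X.hom := by
    rw [map_inv, inv_inv, Iso.eq_inv_comp, ← Category.assoc, ← hF, Category.assoc, ← specAut_mul,
      inv_mul_cancel, specAut_one, Category.comp_id]
  have h₁ (e : E) : ∃ e', specOverAut k (σ : K ≃+* K) ≫ (x e).left ≫ F.hom = (x e').left := by
    obtain ⟨z, hz⟩ := exists_point_of_semilinear σ hF (x e)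
    obtain ⟨e', rfl⟩ := hx.surjective z
    exact ⟨e', hz.symm⟩
  have h₂ (e : E) : ∃ e', specOverAut k (σ : K ≃+* K)⁻¹ ≫ (x e).left ≫ F.inv = (x e').left := by
    obtain ⟨z, hz⟩ := exists_point_of_semilinear σ⁻¹ hF' (x e)
    obtain ⟨e', rfl⟩ := hx.surjective z
    exact ⟨e', hz.symm⟩
  choose π hπ using h₁
  choose π' hπ' using h₂
  refine ⟨⟨π, π', fun e => hx.injective (Over.OverMorphism.ext ?_),
    fun e => hx.injective (Over.OverMorphism.ext ?_)⟩, hπ⟩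
  · rw [← hπ', ← hπ, Category.assoc, Category.assoc, Iso.hom_inv_id, Category.comp_id,
      specOverAut_inv_comp_assoc]
  · rw [← hπ, ← hπ', Category.assoc, Category.assoc, Iso.inv_hom_id, Category.comp_id,
      specOverAut_comp_inv_assoc]

/-- A permutation `π` of the `K`-points of `X` which intertwines the action of each `τ` in the
Galois group with that of `σ τ σ⁻¹` comes from an automorphism of the scheme `X` over
`(res σ)⁻¹`. -/
theorem IsConstantVia.exists_aut [IsGalois k K] (hx : IsConstantVia K X x) (σ : AutPreserving k K)
    (π : E ≃ E)
    (h : ∀ (τ : K ≃ₐ[k] K) (e e' : E),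
      specOverAut k (τ : K ≃+* K) ≫ (x e).left = (x e').left →
      specOverAut k ((σ : K ≃+* K) * (τ : K ≃+* K) * (σ : K ≃+* K)⁻¹) ≫ (x (π e)).left =
        (x (π e')).left) :
    ∃ F : CategoryTheory.Aut X.left,
      X.hom ≫ specAut (AutPreserving.res k K σ)⁻¹ = F.hom ≫ X.hom ∧
      ∀ e, specOverAut k (σ : K ≃+* K) ≫ (x e).left ≫ F.hom = (x (π e)).left := by
  obtain ⟨F, hF⟩ := hx.exists_hom
    (fun e => specOverAut k (σ : K ≃+* K)⁻¹ ≫ (x (π e)).left) fun τ e e' hee' => by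
      have h' := h τ e e' (congrArg Over.Hom.left hee')
      rw [specOverMap_left_eq, ← h', ← Category.assoc, ← Category.assoc, ← specOverAut_mul,
        ← specOverAut_mul]
      congr 2
      group
  have hF' : ∀ e, specOverAut k (σ : K ≃+* K) ≫ (x e).left ≫ F = (x (π e)).left := fun e => by
    rw [hF, specOverAut_comp_inv_assoc]
  obtain ⟨F', hF''⟩ := hx.exists_hom
    (fun e => specOverAut k (σ : K ≃+* K) ≫ (x (π.symm e)).left) fun τ e e' hee' => by
      obtain ⟨τ', hτ'⟩ : ∃ τ' : K ≃ₐ[k] K,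
          (τ' : K ≃+* K) = (σ : K ≃+* K)⁻¹ * (τ : K ≃+* K) * (σ : K ≃+* K) := by
        refine ⟨AlgEquiv.ofRingEquiv
          (f := (σ : K ≃+* K)⁻¹ * (τ : K ≃+* K) * (σ : K ≃+* K)) fun c => ?_, rfl⟩
        change (σ : K ≃+* K).symm (τ ((σ : K ≃+* K) _)) = _
        rw [← AutPreserving.algebraMap_res k K σ, AlgEquiv.commutes,
          AutPreserving.algebraMap_res k K σ, RingEquiv.symm_apply_apply]
      obtain ⟨b, hb⟩ := hx.surjective (specOverMap (τ' : K →ₐ[k] K) ≫ x (π.symm e))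
      have hb' : specOverAut k (τ' : K ≃+* K) ≫ (x (π.symm e)).left = (x b).left := by
        rw [hb]
        rfl
      have h' := h τ' _ _ hb'
      have hc : (σ : K ≃+* K) * (τ' : K ≃+* K) * (σ : K ≃+* K)⁻¹ = (τ : K ≃+* K) := by
        rw [hτ']
        group
      rw [hc, Equiv.apply_symm_apply] at h'
      have he' : e' = π b := hx.injective (hee'.symm.trans (Over.OverMorphism.ext h'))
      rw [he', Equiv.symm_apply_apply, ← hb', specOverMap_left_eq, ← Category.assoc,
        ← Category.assoc, ← specOverAut_mul, ← specOverAut_mul, hτ']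
      congr 2
      group
  refine ⟨⟨F, F', hx.hom_ext fun e => ?_, hx.hom_ext fun e => ?_⟩, hx.hom_ext fun e => ?_, hF'⟩
  · rw [← Category.assoc, hF, Category.assoc, hF'', Equiv.symm_apply_apply,
      specOverAut_inv_comp_assoc, Category.comp_id]
  · rw [← Category.assoc, hF'', Category.assoc, hF, Equiv.apply_symm_apply,
      specOverAut_comp_inv_assoc, Category.comp_id]
  · rw [← Category.assoc, ← Category.assoc, hF, Over.w, Category.assoc, Over.w,
      specOverAut_inv_hom]

end SemilinearPoints

/-! ### Automorphisms of semisimple based root data -/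

namespace BasedRootDatum

variable {R : BasedRootDatum.{u}}

theorem aut_ext {φ ψ : R.Aut} (h : ∀ m, φ.1.weightMap m = ψ.1.weightMap m) : φ = ψ :=
  Subtype.ext <| RootPairing.Equiv.weightHom_injective R.P <| LinearEquiv.ext h

instance isTorsionFree_M (R : BasedRootDatum.{u}) : Module.IsTorsionFree ℤ R.M :=
  have := Module.IsReflexive.of_isPerfPair R.P.toLinearMap
  inferInstance

theorem eq_of_pairing_right {x y : R.M'}
    (h : ∀ m, R.P.toLinearMap m x = R.P.toLinearMap m y) : x = y :=
  R.P.flip.toPerfPair.injective (LinearMap.ext h)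

/-- In a semisimple datum a linear map vanishing on the roots vanishes. -/
theorem IsSemisimple.linearMap_ext (hR : R.IsSemisimple) {N : Type*} [AddCommGroup N]
    [Module.IsTorsionFree ℤ N] {f g : R.M →ₗ[ℤ] N}
    (h : ∀ i, f (R.P.root i) = g (R.P.root i)) : f = g := by
  ext m
  obtain ⟨n, hn, hm⟩ := hR m
  have : Set.EqOn f g (Submodule.span ℤ (Set.range R.P.root)) :=
    LinearMap.eqOn_span (by rintro _ ⟨i, rfl⟩; exact h i)
  have := this hm
  rw [map_zsmul, map_zsmul] at this
  exact smul_right_injective N hn this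

theorem pairing_weightMap_coweightMap (φ : R.P.Aut) (m : R.M) (n : R.M') :
    R.P.toLinearMap (φ.weightMap m) n = R.P.toLinearMap m (φ.coweightMap n) :=
  LinearMap.congr_fun (φ.toHom.weight_coweight_transpose_apply R.P R.P n) m

/-- A pair of adjoint automorphisms of `M` and `M'` which permutes the roots and the simple roots is
an automorphism of the based root datum; compatibility with the coroots is automatic because a
reflection which preserves the roots is determined by its root. -/
theorem IsSemisimple.exists_aut (hR : R.IsSemisimple) (A : R.M ≃+ R.M) (B : R.M' ≃+ R.M')
    (hAB : ∀ x y, R.P.toLinearMap (A x) (B y) = R.P.toLinearMap x y) (π : R.ι ≃ R.ι)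
    (hπ : ∀ i, A (R.P.root i) = R.P.root (π i)) (hs : ∀ i ∈ R.base.support, π i ∈ R.base.support) :
    ∃ φ : R.Aut, (∀ m, φ.1.weightMap m = A m) ∧ ∀ n, φ.1.coweightMap (B n) = n := by
  have hB : ∀ i, B (R.P.coroot i) = R.P.coroot (π i) := fun i => by
    have hfin : (Set.range R.P.root).Finite := Set.finite_range _
    have key := Module.Dual.eq_of_preReflection_mapsTo' (R := ℤ) hfin
      (x := R.P.root (π i)) (Submodule.subset_span ⟨π i, rfl⟩)
      (f := R.P.toLinearMap.flip (B (R.P.coroot i)))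
      (g := R.P.toLinearMap.flip (R.P.coroot (π i)))
      (by
        rw [← hπ]
        exact (hAB _ _).trans (R.P.root_coroot_two i))
      (by
        rintro _ ⟨j, rfl⟩
        obtain ⟨j, rfl⟩ := π.surjective j
        refine ⟨π (R.P.reflectionPerm i j), ?_⟩
        rw [← hπ, ← hπ j, R.P.root_reflectionPerm, RootPairing.reflection_apply,
          Module.preReflection_apply, map_sub, map_zsmul, hπ i]
        refine congrArg (fun c : ℤ => A (R.P.root j) - c • R.P.root (π i)) ?_
        exact (hAB _ _).symm)
      (R.P.root_coroot_two _)
      (by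
        rintro _ ⟨j, rfl⟩
        exact ⟨R.P.reflectionPerm (π i) j, R.P.root_reflectionPerm _ _⟩)
    refine eq_of_pairing_right fun m => ?_
    have h2 : R.P.toLinearMap.flip (B (R.P.coroot i)) =
        R.P.toLinearMap.flip (R.P.coroot (π i)) :=
      hR.linearMap_ext fun j => LinearMap.congr_fun key
        ⟨R.P.root j, Submodule.subset_span ⟨j, rfl⟩⟩
    exact LinearMap.congr_fun h2 m
  refine ⟨⟨⟨⟨A.toIntLinearEquiv, B.symm.toIntLinearEquiv, π, ?_, ?_, ?_⟩, ?_, ?_⟩, ?_⟩, ?_, ?_⟩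
  · ext n m
    change R.P.toLinearMap (A m) n = R.P.toLinearMap m (B.symm n)
    rw [← hAB m, AddEquiv.apply_symm_apply]
  · ext i
    exact hπ i
  · ext i
    change B.symm _ = R.P.coroot (π.symm i)
    rw [AddEquiv.symm_apply_eq, hB, Equiv.apply_symm_apply]
  · exact A.bijective
  · exact B.symm.bijective
  · -- an injective self-map of the finite set of simple roots is surjective
    intro i
    refine ⟨fun hi => ?_, hs i⟩
    obtain ⟨j, hj, hji⟩ := Finset.surjOn_of_injOn_of_card_le π hs π.injective.injOn le_rfl hi
    rwa [← π.injective hji]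
  · exact fun m => rfl
  · exact fun n => B.symm_apply_apply n

end BasedRootDatum

/-! ### The action of semilinear automorphisms on the root datum -/

section Induces

open scoped MonObj

variable {k : Type u} [Field k]

/-- The map `F × G` on points which are themselves only semilinear over the base. -/
theorem lift_prodMap {X Y T T' : Over (Spec (.of k))} {s : Spec (.of k) ⟶ Spec (.of k)}
    {F : X.left ⟶ X.left} {G : Y.left ⟶ Y.left} (hF : X.hom ≫ s = F ≫ X.hom)
    (hG : Y.hom ≫ s = G ≫ Y.hom) {x : T ⟶ X} {y : T ⟶ Y} {x' : T' ⟶ X} {y' : T' ⟶ Y}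
    {a : T'.left ⟶ T.left} (hx : a ≫ x.left ≫ F = x'.left) (hy : a ≫ y.left ≫ G = y'.left) :
    a ≫ (lift x y).left ≫ prodMap hF hG = (lift x' y').left := by
  have h₁ : prodMap hF hG ≫ (fst X Y).left = (fst X Y).left ≫ F := pullback.lift_fst _ _ _
  have h₂ : prodMap hF hG ≫ (snd X Y).left = (snd X Y).left ≫ G := pullback.lift_snd _ _ _
  refine pullback.hom_ext (f := X.hom) (g := Y.hom) ?_ ?_
  · change (a ≫ (lift x y).left ≫ prodMap hF hG) ≫ (fst X Y).left =
      (lift x' y').left ≫ (fst X Y).left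
    rw [Category.assoc, Category.assoc, h₁, ← Over.comp_left, lift_fst, ← hx,
      ← Category.assoc (lift x y).left, ← Over.comp_left, lift_fst]
  · change (a ≫ (lift x y).left ≫ prodMap hF hG) ≫ (snd X Y).left =
      (lift x' y').left ≫ (snd X Y).left
    rw [Category.assoc, Category.assoc, h₂, ← Over.comp_left, lift_snd, ← hy,
      ← Category.assoc (lift x y).left, ← Over.comp_left, lift_snd]

theorem mul_left_eq {X T : Over (Spec (.of k))} [GrpObj X] (x y : T ⟶ X) :
    (x * y).left = (lift x y).left ≫ μ[X].left := rfl

variable {K : Type u} [Field K] [Algebra k K]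

theorem specOverAut_cancel (σ : K ≃+* K) {Z : Scheme.{u}} {g h : (specOver k K).left ⟶ Z}
    (H : specOverAut k σ ≫ g = specOverAut k σ ≫ h) : g = h := by
  rw [← specOverAut_inv_comp_assoc σ g, H, specOverAut_inv_comp_assoc]

/-- Semilinearity passes to a subscheme which is stable under the automorphism. -/
theorem base_of_comm {X Y : Over (Spec (.of k))} (i : X ⟶ Y) {s : Spec (.of k) ⟶ Spec (.of k)}
    {g : X.left ⟶ X.left} {F : Y.left ⟶ Y.left} (hF : Y.hom ≫ s = F ≫ Y.hom)
    (hg : g ≫ i.left = i.left ≫ F) : X.hom ≫ s = g ≫ X.hom := by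
  rw [← Over.w i, ← Category.assoc, hg, Category.assoc, Category.assoc, hF]

namespace SplittingOver

variable {𝓡 : PreBasedRootDatumScheme k} {R : BasedRootDatum.{u}} (f : SplittingOver 𝓡 R K)

/-- The semilinear automorphism `p` of `𝓡` and the automorphism `σ` of `K` lie over the same
automorphism of `k`, and the automorphism of `R_K ≅ 𝓡_K` over `σ` which they define is given on
`R` by `φ`. The map `coweightMap` of an automorphism of a root pairing is contravariant, which
explains its position. -/
structure Induces (p : semilinearAut 𝓡) (σ : AutPreserving k K) (φ : R.Aut) : Prop where
  res : AutPreserving.res k K σ = p.1.1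
  wt : ∀ m, specOverAut k (σ : K ≃+* K) ≫ (f.wt m).left ≫ p.1.2.1.hom =
    (f.wt (φ.1.weightMap m)).left
  cowt : ∀ n, specOverAut k (σ : K ≃+* K) ≫ (f.cowt (φ.1.coweightMap n)).left ≫ p.1.2.2.hom =
    (f.cowt n).left

variable {f} {p q : semilinearAut 𝓡} {σ τ : AutPreserving k K} {φ ψ : R.Aut}

theorem Induces.mul (hp : f.Induces p σ φ) (hq : f.Induces q τ ψ) :
    f.Induces (p * q) (σ * τ) (φ * ψ) where
  res := by rw [map_mul, hp.res, hq.res]; rfl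
  wt m := by
    have hs : specOverAut k ((σ * τ : AutPreserving k K) : K ≃+* K) =
      specOverAut k (σ : K ≃+* K) ≫ specOverAut k (τ : K ≃+* K) := specOverAut_mul _ _
    have hF : (p * q).1.2.1.hom = q.1.2.1.hom ≫ p.1.2.1.hom := rfl
    have h := hp.wt (ψ.1.weightMap m)
    rw [← hq.wt] at h
    rw [hs, hF]
    simp only [Category.assoc] at h ⊢
    exact h
  cowt n := by
    have hs : specOverAut k ((σ * τ : AutPreserving k K) : K ≃+* K) =
      specOverAut k (σ : K ≃+* K) ≫ specOverAut k (τ : K ≃+* K) := specOverAut_mul _ _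
    have hF : (p * q).1.2.2.hom = q.1.2.2.hom ≫ p.1.2.2.hom := rfl
    have h := hp.cowt n
    rw [← hq.cowt] at h
    rw [hs, hF]
    simp only [Category.assoc] at h ⊢
    exact h

variable (f) in
theorem Induces.one : f.Induces 1 1 1 where
  res := map_one _
  wt m := by
    change specOverAut k (1 : K ≃+* K) ≫ (f.wt m).left ≫ 𝟙 _ = _
    rw [specOverAut_one, Category.comp_id, Category.id_comp]
    rfl
  cowt n := by
    change specOverAut k (1 : K ≃+* K) ≫ (f.cowt n).left ≫ 𝟙 _ = _
    rw [specOverAut_one, Category.comp_id, Category.id_comp]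

theorem Induces.aut_unique (h : f.Induces p σ φ) (h' : f.Induces p σ ψ) : φ = ψ :=
  BasedRootDatum.aut_ext fun m => f.isConstant_wt.injective <| Over.OverMorphism.ext <|
    (h.wt m).symm.trans (h'.wt m)

theorem Induces.semilinear_unique (h : f.Induces p σ φ) (h' : f.Induces q σ φ) : p = q := by
  refine Subtype.ext (Prod.ext (h.res.symm.trans h'.res) (Prod.ext ?_ ?_))
  · exact Iso.ext <| f.isConstant_wt.hom_ext fun m => specOverAut_cancel (σ : K ≃+* K) <|
      (h.wt m).trans (h'.wt m).symm
  · refine Iso.ext <| f.isConstant_cowt.hom_ext fun n => specOverAut_cancel (σ : K ≃+* K) ?_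
    obtain ⟨n, rfl⟩ := (RootPairing.Equiv.coweightEquiv R.P R.P φ.1).surjective n
    exact (h.cowt n).trans (h'.cowt n).symm

theorem const_eq_iff {a b : ℤ} :
    ContinuousMap.const (specOver k K).left a = ContinuousMap.const _ b ↔ a = b :=
  ⟨fun h => ContinuousMap.congr_fun h default, fun h => by rw [h]⟩

theorem evalPair_semilinear {s : Spec (.of k) ⟶ Spec (.of k)}
    {F : 𝓡.M.left ⟶ 𝓡.M.left} {G : 𝓡.M'.left ⟶ 𝓡.M'.left} (hF : 𝓡.M.hom ≫ s = F ≫ 𝓡.M.hom)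
    (hG : 𝓡.M'.hom ≫ s = G ≫ 𝓡.M'.hom) {x x' : R.M} {y y' : R.M'} {a : K ≃+* K}
    (hx : specOverAut k a ≫ (f.wt x).left ≫ F = (f.wt x').left)
    (hy : specOverAut k a ≫ (f.cowt y).left ≫ G = (f.cowt y').left) :
    pullInt (specOverAut k a ≫ (lift (f.wt x) (f.cowt y)).left ≫ prodMap hF hG) 𝓡.pair =
      ContinuousMap.const _ (R.P.toLinearMap x' y') := by
  rw [lift_prodMap hF hG hx hy]
  exact f.pair_eq x' y'

variable (f) in
/-- Every semilinear automorphism acts on the split form: `K`-points of `𝓜` are elements of `M`. -/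
theorem exists_induces (hR : R.IsSemisimple) (p : semilinearAut 𝓡) (σ : AutPreserving k K)
    (h : AutPreserving.res k K σ = p.1.1) : ∃ φ, f.Induces p σ φ := by
  obtain ⟨⟨α, F, F'⟩, hp⟩ := p
  replace hp : IsSemilinear 𝓡 α⁻¹ F F' := hp
  replace h : AutPreserving.res k K σ = α := h
  subst h
  obtain ⟨A, hA⟩ := f.isConstant_wt.exists_perm σ F hp.base
  obtain ⟨B, hB⟩ := f.isConstant_cowt.exists_perm σ F' hp.base'
  obtain ⟨g, hg⟩ := hp.root
  obtain ⟨g', hg'⟩ := hp.simple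
  obtain ⟨π, hπ⟩ := f.isConstant_root.exists_perm σ g (base_of_comm _ hp.base hg)
  obtain ⟨ρ, hρ⟩ := f.isConstant_simple.exists_perm σ g' (base_of_comm _ hp.base hg')
  have hAadd : ∀ x y, A (x + y) = A x + A y := fun x y => by
    refine f.isConstant_wt.injective (Over.OverMorphism.ext ?_)
    rw [f.wt_add, ← hA, f.wt_add, mul_left_eq, mul_left_eq, ← lift_prodMap hp.base hp.base (hA x)
      (hA y), Category.assoc, Category.assoc, Category.assoc]
    exact congrArg _ (congrArg _ hp.mul.symm)
  have hBadd : ∀ x y, B (x + y) = B x + B y := fun x y => by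
    refine f.isConstant_cowt.injective (Over.OverMorphism.ext ?_)
    rw [f.cowt_add, ← hB, f.cowt_add, mul_left_eq, mul_left_eq,
      ← lift_prodMap hp.base' hp.base' (hB x) (hB y), Category.assoc, Category.assoc,
      Category.assoc]
    exact congrArg _ (congrArg _ hp.mul'.symm)
  have hroot : ∀ i, A (R.P.root i) = R.P.root (π i) := fun i => by
    refine f.isConstant_wt.injective (Over.OverMorphism.ext ?_)
    rw [← hA, ← f.root_incl, ← f.root_incl, Over.comp_left, Over.comp_left, ← hπ, Category.assoc,
      Category.assoc, Category.assoc]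
    exact congrArg _ (congrArg _ hg.symm)
  have hsimple : ∀ i : R.base.support, π i = ρ i := fun i => by
    refine f.isConstant_root.injective (Over.OverMorphism.ext ?_)
    rw [← cancel_mono 𝓡.rootIncl.left, ← hπ, ← f.simple_incl, ← f.simple_incl, Over.comp_left,
      Over.comp_left, ← hρ]
    simp only [Category.assoc]
    refine congrArg _ (congrArg _ ?_)
    have h₁ : g'.hom ≫ 𝓡.simpleIncl.left ≫ 𝓡.rootIncl.left =
        (𝓡.simpleIncl.left ≫ 𝓡.rootIncl.left) ≫ F.hom := hg'
    rw [h₁, hg, Category.assoc]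
  obtain ⟨φ, hφ, hφ'⟩ := hR.exists_aut ⟨A, hAadd⟩ ⟨B, hBadd⟩ (fun x y => by
      have h₁ := evalPair_semilinear (f := f) hp.base hp.base' (hA x) (hB y)
      have h₂ : pullInt (specOverAut k (σ : K ≃+* K) ≫ (lift (f.wt x) (f.cowt y)).left ≫
          prodMap hp.base hp.base') 𝓡.pair = ContinuousMap.const _ (R.P.toLinearMap x y) := by
        rw [pullInt_comp, pullInt_comp, hp.pair]
        exact congrArg (pullInt _) (f.pair_eq x y)
      exact const_eq_iff.1 (h₁.symm.trans h₂)) π hroot fun i hi => by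
    rw [hsimple ⟨i, hi⟩]
    exact (ρ _).2
  refine ⟨φ, rfl, fun m => ?_, fun n => ?_⟩
  · rw [hφ]
    exact hA m
  · obtain ⟨n, rfl⟩ := B.surjective n
    rw [← hB]
    have : φ.1.coweightMap (B n) = n := hφ' n
    rw [this]

theorem Induces.inv (hR : R.IsSemisimple) (h : f.Induces p σ φ) : f.Induces p⁻¹ σ⁻¹ φ⁻¹ := by
  obtain ⟨ψ, hψ⟩ := f.exists_induces hR p⁻¹ σ⁻¹ (by rw [map_inv, h.res]; rfl)
  have h₁ := h.mul hψ
  rw [mul_inv_cancel, mul_inv_cancel] at h₁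
  rw [inv_eq_of_mul_eq_one_right (h₁.aut_unique (Induces.one f))]
  exact hψ

variable (hp : f.Induces 1 σ φ)

include hp

theorem Induces.wt_of_one (m : R.M) :
    specOverAut k (σ : K ≃+* K) ≫ (f.wt m).left = (f.wt (φ.1.weightMap m)).left := by
  rw [← hp.wt]
  exact congrArg _ (Category.comp_id (f.wt m).left).symm

theorem Induces.cowt_of_one (n : R.M') :
    specOverAut k (σ : K ≃+* K) ≫ (f.cowt (φ.1.coweightMap n)).left = (f.cowt n).left := by
  refine Eq.trans ?_ (hp.cowt n)
  exact congrArg _ (Category.comp_id (f.cowt _).left).symm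

theorem Induces.root_of_one (i : R.ι) :
    specOverAut k (σ : K ≃+* K) ≫ (f.root i).left = (f.root (φ.1.indexEquiv i)).left := by
  rw [← cancel_mono 𝓡.rootIncl.left, Category.assoc, ← Over.comp_left, ← Over.comp_left,
    f.root_incl, f.root_incl, hp.wt_of_one]
  exact congrArg (fun m => (f.wt m).left) (congrFun φ.1.root_weightMap i)

theorem Induces.coroot_of_one (i : R.ι) :
    specOverAut k (σ : K ≃+* K) ≫ (f.coroot i).left = (f.coroot (φ.1.indexEquiv i)).left := by
  rw [← cancel_mono 𝓡.corootIncl.left, Category.assoc, ← Over.comp_left, ← Over.comp_left,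
    f.coroot_incl, f.coroot_incl, ← hp.cowt_of_one (R.P.coroot (φ.1.indexEquiv i))]
  have := congrFun φ.1.coroot_coweightMap (φ.1.indexEquiv i)
  rw [Function.comp_apply, Function.comp_apply, Equiv.symm_apply_apply] at this
  rw [this]

theorem Induces.simple_of_one (i : R.base.support) :
    specOverAut k (σ : K ≃+* K) ≫ (f.simple i).left =
      (f.simple ⟨φ.1.indexEquiv i, (φ.2 i).2 i.2⟩).left := by
  rw [← cancel_mono 𝓡.simpleIncl.left, Category.assoc, ← Over.comp_left, ← Over.comp_left,
    f.simple_incl, f.simple_incl, hp.root_of_one]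

end SplittingOver

end Induces

/-! ### The cocycle, and descent of semilinear automorphisms -/

section Cocycle

open scoped MonObj

variable {k : Type u} [Field k] {K : Type u} [Field K] [Algebra k K]

theorem res_galToAutPreserving (τ : K ≃ₐ[k] K) :
    AutPreserving.res k K (galToAutPreserving k K τ) = 1 := by
  ext x
  refine (algebraMap k K).injective ?_
  rw [AutPreserving.algebraMap_res]
  exact τ.commutes x

theorem exists_gal_of_res_eq_one {σ : AutPreserving k K} (h : AutPreserving.res k K σ = 1) :
    ∃ τ : K ≃ₐ[k] K, galToAutPreserving k K τ = σ := by
  refine ⟨AlgEquiv.ofRingEquiv (f := (σ : K ≃+* K)) fun x => ?_, rfl⟩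
  rw [← AutPreserving.algebraMap_res k K σ, h]
  rfl

theorem exists_gal_conj (σ : AutPreserving k K) (τ : K ≃ₐ[k] K) :
    ∃ τ' : K ≃ₐ[k] K, galToAutPreserving k K τ' = σ * galToAutPreserving k K τ * σ⁻¹ :=
  exists_gal_of_res_eq_one <| by
    rw [map_mul, map_mul, res_galToAutPreserving, mul_one, map_inv, mul_inv_cancel]

theorem galToAutPreserving_injective :
    Function.Injective (galToAutPreserving k K) := fun _ _ h =>
  AlgEquiv.ext fun x => RingEquiv.congr_fun (congrArg Subtype.val h) x

/-- The stabilizer of a `K`-point in the Galois group is the fixing subgroup of a subfield. -/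
theorem exists_intermediateField_stabilizer {X : Over (Spec (.of k))} (j : specOver k K ⟶ X) :
    ∃ L : IntermediateField k K, ∀ τ : K ≃ₐ[k] K,
      specOverMap (τ : K →ₐ[k] K) ≫ j = j ↔ τ ∈ L.fixingSubgroup := by
  obtain ⟨x, φ, hφ⟩ : ∃ (x : X.left) (φ : X.left.residueField x ⟶ .of K),
      j.left = Spec.map φ ≫ X.left.fromSpecResidueField x :=
    ⟨_, _, ((Scheme.SpecToEquivOfField K X.left).symm_apply_apply j.left).symm⟩
  refine ⟨IntermediateField.adjoin k (Set.range φ.hom), fun τ => ?_⟩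
  have h₁ : specOverMap (τ : K →ₐ[k] K) ≫ j = j ↔
      Spec.map (φ ≫ CommRingCat.ofHom (τ : K →+* K)) ≫ X.left.fromSpecResidueField x =
        Spec.map φ ≫ X.left.fromSpecResidueField x := by
    refine ⟨fun h => ?_, fun h => Over.OverMorphism.ext ?_⟩
    · have := congrArg Over.Hom.left h
      rw [Over.comp_left, hφ] at this
      rw [Spec.map_comp, Category.assoc]
      exact this
    · rw [Over.comp_left, hφ]
      rw [Spec.map_comp, Category.assoc] at h
      exact h
  rw [h₁, cancel_mono, Spec.map_inj]
  have h₂ : τ ∈ (IntermediateField.adjoin k (Set.range φ.hom)).fixingSubgroup ↔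
      ∀ y ∈ Set.range φ.hom, τ y = y := by
    rw [IntermediateField.mem_fixingSubgroup_iff]
    exact IntermediateField.forall_mem_adjoin_smul_eq_self_iff k (S := Set.range φ.hom) τ
  rw [h₂]
  constructor
  · rintro h _ ⟨y, rfl⟩
    exact congrArg (fun g : X.left.residueField x ⟶ .of K => g.hom y) h
  · intro h
    ext y
    exact h _ ⟨y, rfl⟩

/-- The pairs `(σ, φ)` of an automorphism `σ` of `K` with `σ(k) = k` and an element `φ` of `A` such
that conjugation by `φ` on `A` corresponds under `c` to conjugation by `σ` on the Galois group. -/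
def twistedPairs {A : Type*} [Group A] (c : (K ≃ₐ[k] K) →* A) :
    Subgroup (AutPreserving k K × A) where
  carrier := {q | ∀ τ τ', galToAutPreserving k K τ' = q.1 * galToAutPreserving k K τ * q.1⁻¹ →
    q.2 * c τ * q.2⁻¹ = c τ'}
  one_mem' := fun τ τ' h => by
    have : τ' = τ := galToAutPreserving_injective (by simpa using h)
    simp [this]
  mul_mem' := by
    intro q r hq hr τ τ' h
    obtain ⟨τ₁, h₁⟩ := exists_gal_conj r.1 τ
    have h₂ := hr τ τ₁ h₁
    have h₃ := hq τ₁ τ' (by rw [h, h₁]; simp [mul_assoc])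
    rw [← h₃, ← h₂]
    simp [mul_assoc]
  inv_mem' := by
    intro q hq τ τ' h
    have := hq τ' τ (by rw [h]; simp [mul_assoc])
    rw [← this]
    simp [mul_assoc]

namespace SplittingOver

variable {𝓡 : PreBasedRootDatumScheme k} {R : BasedRootDatum.{u}} (f : SplittingOver 𝓡 R K)

/-- The kernel of the cocycle is closed: it is the common stabilizer of the `K`-points of `𝓜`. -/
theorem exists_cocycleKer_eq_fixingSubgroup :
    ∃ L : IntermediateField k K, f.cocycleKer = L.fixingSubgroup := by
  choose L hL using fun m => exists_intermediateField_stabilizer (f.wt m)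
  refine ⟨⨆ m, L m, Subgroup.ext fun τ => ?_⟩
  rw [← Subgroup.zpowers_le (H := IntermediateField.fixingSubgroup _),
    ← IntermediateField.le_iff_le, iSup_le_iff]
  refine forall_congr' fun m => ?_
  rw [hL, IntermediateField.le_iff_le, Subgroup.zpowers_le]

theorem classifyingField_fixingSubgroup [IsGalois k K] :
    f.classifyingField.fixingSubgroup = f.cocycleKer := by
  obtain ⟨L, hL⟩ := f.exists_cocycleKer_eq_fixingSubgroup
  rw [classifyingField, hL, InfiniteGalois.fixedField_fixingSubgroup]

variable (hR : R.IsSemisimple)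

/-- The cocycle `Gal(K/k) → Aut R` of the splitting `f`. -/
noncomputable def cocycle : (K ≃ₐ[k] K) →* R.Aut where
  toFun τ := (f.exists_induces hR 1 (galToAutPreserving k K τ) (res_galToAutPreserving τ)).choose
  map_one' := Induces.aut_unique (f.exists_induces hR 1 (galToAutPreserving k K 1)
    (res_galToAutPreserving 1)).choose_spec (Induces.one f)
  map_mul' τ τ' := by
    have h := (f.exists_induces hR 1 (galToAutPreserving k K τ)
      (res_galToAutPreserving τ)).choose_spec
    have h' := (f.exists_induces hR 1 (galToAutPreserving k K τ')
      (res_galToAutPreserving τ')).choose_spec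
    refine Induces.aut_unique (f.exists_induces hR 1 (galToAutPreserving k K (τ * τ'))
      (res_galToAutPreserving _)).choose_spec ?_
    have := h.mul h'
    rwa [mul_one, ← map_mul] at this

theorem induces_cocycle (τ : K ≃ₐ[k] K) :
    f.Induces 1 (galToAutPreserving k K τ) (f.cocycle hR τ) :=
  (f.exists_induces hR 1 (galToAutPreserving k K τ) (res_galToAutPreserving τ)).choose_spec

theorem cocycle_ker : (f.cocycle hR).ker = f.cocycleKer := by
  ext τ
  have h := f.induces_cocycle hR τ
  rw [MonoidHom.mem_ker]
  constructor
  · intro h₁ m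
    rw [h₁] at h
    exact Over.OverMorphism.ext (h.wt_of_one m)
  · intro h₁
    refine BasedRootDatum.aut_ext fun m => f.isConstant_wt.injective (Over.OverMorphism.ext ?_)
    rw [← h.wt_of_one]
    exact congrArg Over.Hom.left (h₁ m)

variable {f}

/-- The actions of a semilinear automorphism and of the Galois group on `R` are compatible, because
the Galois group acts through the identity of `𝓡`. -/
theorem Induces.mem_twistedPairs {p : semilinearAut 𝓡} {σ : AutPreserving k K} {φ : R.Aut}
    (h : f.Induces p σ φ) : (σ, φ) ∈ twistedPairs (f.cocycle hR) := by
  intro τ τ' hτ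
  have h₁ := h.mul (f.induces_cocycle hR τ)
  have h₂ := (f.induces_cocycle hR τ').mul h
  rw [hτ, one_mul, inv_mul_cancel_right] at h₂
  rw [mul_one] at h₁
  rw [mul_inv_eq_iff_eq_mul]
  exact h₁.aut_unique h₂

/-- Galois descent for semilinear automorphisms: a pair `(σ, φ)` compatible with the cocycle comes
from a semilinear automorphism of `𝓡`. The maps on the five schemes are obtained separately, and
their compatibilities are checked on `K`-points. -/
theorem exists_semilinear [IsGalois k K] {σ : AutPreserving k K} {φ : R.Aut}
    (h : (σ, φ) ∈ twistedPairs (f.cocycle hR)) : ∃ p, f.Induces p σ φ := by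
  have key (τ : K ≃ₐ[k] K) : f.Induces 1 (σ * galToAutPreserving k K τ * σ⁻¹)
      (φ * f.cocycle hR τ * φ⁻¹) := by
    obtain ⟨τ', hτ'⟩ := exists_gal_conj σ τ
    rw [← hτ', h τ τ' hτ']
    exact f.induces_cocycle hR τ'
  have key' (τ : K ≃ₐ[k] K) := f.induces_cocycle hR τ
  have hidx (ψ : R.Aut) (i : R.ι) : (φ * ψ * φ⁻¹).1.indexEquiv (φ.1.indexEquiv i) =
      φ.1.indexEquiv (ψ.1.indexEquiv i) := by
    change φ.1.indexEquiv (ψ.1.indexEquiv (φ.1.indexEquiv.symm (φ.1.indexEquiv i))) = _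
    rw [Equiv.symm_apply_apply]
  obtain ⟨F, hFb, hF⟩ := f.isConstant_wt.exists_aut σ
    (RootPairing.Equiv.weightEquiv R.P R.P φ.1).toEquiv fun τ m m' hm => by
      obtain rfl : (f.cocycle hR τ).1.weightMap m = m' := f.isConstant_wt.injective <|
        Over.OverMorphism.ext <| ((key' τ).wt_of_one m).symm.trans hm
      refine ((key τ).wt_of_one (φ.1.weightMap m)).trans ?_
      refine congrArg (fun x => (f.wt x).left) ?_
      change φ.1.weightMap ((f.cocycle hR τ).1.weightMap
        ((RootPairing.Equiv.weightEquiv R.P R.P φ.1).symm (φ.1.weightMap m))) = _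
      rw [RootPairing.Equiv.weightEquiv_symm_weightMap]
      rfl
  obtain ⟨F', hFb', hF'⟩ := f.isConstant_cowt.exists_aut σ
    (RootPairing.Equiv.coweightEquiv R.P R.P φ.1).symm.toEquiv fun τ n n' hn => by
      obtain ⟨n, rfl⟩ :=
        (RootPairing.Equiv.coweightEquiv R.P R.P (f.cocycle hR τ).1).surjective n
      obtain rfl : n = n' := f.isConstant_cowt.injective <|
        Over.OverMorphism.ext <| ((key' τ).cowt_of_one n).symm.trans hn
      refine Eq.trans ?_ ((key τ).cowt_of_one _)
      refine congrArg (fun x => specOverAut k _ ≫ (f.cowt x).left) ?_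
      obtain ⟨n, rfl⟩ := (RootPairing.Equiv.coweightEquiv R.P R.P φ.1).surjective n
      change _ = (RootPairing.Equiv.coweightEquiv R.P R.P φ.1).symm
        ((f.cocycle hR τ).1.coweightMap (φ.1.coweightMap
          ((RootPairing.Equiv.coweightEquiv R.P R.P φ.1).symm _)))
      rw [RootPairing.Equiv.coweightMap_coweightEquiv_symm]
      rfl
  obtain ⟨g, hgb, hg⟩ := f.isConstant_root.exists_aut σ φ.1.indexEquiv fun τ i i' hi => by
      obtain rfl : (f.cocycle hR τ).1.indexEquiv i = i' := f.isConstant_root.injective <|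
        Over.OverMorphism.ext <| ((key' τ).root_of_one i).symm.trans hi
      rw [← hidx]
      exact (key τ).root_of_one _
  obtain ⟨g', hgb', hg'⟩ := f.isConstant_coroot.exists_aut σ φ.1.indexEquiv fun τ i i' hi => by
      obtain rfl : (f.cocycle hR τ).1.indexEquiv i = i' := f.isConstant_coroot.injective <|
        Over.OverMorphism.ext <| ((key' τ).coroot_of_one i).symm.trans hi
      rw [← hidx]
      exact (key τ).coroot_of_one _
  obtain ⟨s, hsb, hs⟩ := f.isConstant_simple.exists_aut σ
    (φ.1.indexEquiv.subtypeEquiv fun i => (φ.2 i).symm) fun τ i i' hi => by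
      obtain rfl : ⟨(f.cocycle hR τ).1.indexEquiv i, ((f.cocycle hR τ).2 i).2 i.2⟩ = i' :=
        f.isConstant_simple.injective <|
          Over.OverMorphism.ext <| ((key' τ).simple_of_one i).symm.trans hi
      refine ((key τ).simple_of_one _).trans ?_
      exact congrArg (fun x => (f.simple x).left) (Subtype.ext (hidx _ _))
  have hF'' (n : R.M') : specOverAut k (σ : K ≃+* K) ≫ (f.cowt (φ.1.coweightMap n)).left ≫ F'.hom =
      (f.cowt n).left := by
    rw [hF']
    exact congrArg (fun x => (f.cowt x).left)
      (RootPairing.Equiv.coweightEquiv_symm_coweightMap (P := R.P) (Q := R.P) φ.1 n)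
  have hF₁ (m : R.M) : specOverAut k (σ : K ≃+* K) ≫ (f.wt m).left ≫ F.hom =
      (f.wt (φ.1.weightMap m)).left := hF m
  have hroot : g.hom ≫ 𝓡.rootIncl.left = 𝓡.rootIncl.left ≫ F.hom := by
    refine f.isConstant_root.hom_ext fun i => specOverAut_cancel (σ : K ≃+* K) ?_
    rw [← Category.assoc (f.root i).left, ← Category.assoc (specOverAut k _), hg,
      ← Category.assoc (f.root i).left, ← Over.comp_left, ← Over.comp_left, f.root_incl,
      f.root_incl, hF₁]
    exact congrArg (fun x => (f.wt x).left) (congrFun φ.1.root_weightMap i).symm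
  have hcoroot : g'.hom ≫ 𝓡.corootIncl.left = 𝓡.corootIncl.left ≫ F'.hom := by
    refine f.isConstant_coroot.hom_ext fun i => specOverAut_cancel (σ : K ≃+* K) ?_
    rw [← Category.assoc (f.coroot i).left, ← Category.assoc (specOverAut k _), hg',
      ← Category.assoc (f.coroot i).left, ← Over.comp_left, ← Over.comp_left, f.coroot_incl,
      f.coroot_incl, ← hF'']
    have := congrFun φ.1.coroot_coweightMap (φ.1.indexEquiv i)
    rw [Function.comp_apply, Function.comp_apply, Equiv.symm_apply_apply] at this
    rw [this]
  have hsimple : s.hom ≫ 𝓡.simpleIncl.left = 𝓡.simpleIncl.left ≫ g.hom := by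
    refine f.isConstant_simple.hom_ext fun i => specOverAut_cancel (σ : K ≃+* K) ?_
    rw [← Category.assoc (f.simple i).left, ← Category.assoc (specOverAut k _), hs,
      ← Category.assoc (f.simple i).left, ← Over.comp_left, ← Over.comp_left, f.simple_incl,
      f.simple_incl, hg]
    rfl
  refine ⟨⟨(AutPreserving.res k K σ, F, F'), ⟨hFb, hFb', ?_, ?_, ?_, ⟨g, hroot⟩, ⟨g', hcoroot⟩,
    ⟨s, ?_⟩⟩⟩, rfl, hF₁, hF''⟩
  · refine f.isConstant_wt.hom_ext_prod_points f.isConstant_wt fun x y =>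
      specOverAut_cancel (σ : K ≃+* K) ?_
    have h₁ := lift_prodMap hFb hFb (hF₁ x) (hF₁ y)
    calc specOverAut k (σ : K ≃+* K) ≫ (lift (f.wt x) (f.wt y)).left ≫
        prodMap hFb hFb ≫ μ[𝓡.M].left
        = (lift (f.wt (φ.1.weightMap x)) (f.wt (φ.1.weightMap y))).left ≫ μ[𝓡.M].left := by
          rw [← h₁]
          simp only [Category.assoc]
      _ = (f.wt (φ.1.weightMap (x + y))).left := by
          rw [← mul_left_eq, ← f.wt_add, map_add]
      _ = specOverAut k (σ : K ≃+* K) ≫ (lift (f.wt x) (f.wt y)).left ≫ μ[𝓡.M].left ≫ F.hom := by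
          rw [← hF₁, f.wt_add, mul_left_eq, Category.assoc]
  · refine f.isConstant_cowt.hom_ext_prod_points f.isConstant_cowt fun x y =>
      specOverAut_cancel (σ : K ≃+* K) ?_
    obtain ⟨x, rfl⟩ := (RootPairing.Equiv.coweightEquiv R.P R.P φ.1).surjective x
    obtain ⟨y, rfl⟩ := (RootPairing.Equiv.coweightEquiv R.P R.P φ.1).surjective y
    have h₁ := lift_prodMap hFb' hFb' (hF'' x) (hF'' y)
    calc specOverAut k (σ : K ≃+* K) ≫
        (lift (f.cowt (φ.1.coweightMap x)) (f.cowt (φ.1.coweightMap y))).left ≫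
          prodMap hFb' hFb' ≫ μ[𝓡.M'].left
        = (lift (f.cowt x) (f.cowt y)).left ≫ μ[𝓡.M'].left := by
          rw [← h₁]
          simp only [Category.assoc]
      _ = (f.cowt (x + y)).left := by rw [← mul_left_eq, ← f.cowt_add]
      _ = specOverAut k (σ : K ≃+* K) ≫
          (lift (f.cowt (φ.1.coweightMap x)) (f.cowt (φ.1.coweightMap y))).left ≫
            μ[𝓡.M'].left ≫ F'.hom := by
          rw [← hF'', map_add, f.cowt_add, mul_left_eq, Category.assoc]
  · ext z
    obtain ⟨x, y, t, rfl⟩ := f.isConstant_wt.exists_prod_point f.isConstant_cowt z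
    obtain ⟨y, rfl⟩ := (RootPairing.Equiv.coweightEquiv R.P R.P φ.1).surjective y
    have h₁ := evalPair_semilinear (f := f) hFb hFb' (hF₁ x) (hF'' y)
    have h₂ : pullInt (specOverAut k (σ : K ≃+* K) ≫
        (lift (f.wt x) (f.cowt (φ.1.coweightMap y))).left) 𝓡.pair =
          ContinuousMap.const _ (R.P.toLinearMap x (φ.1.coweightMap y)) := by
      rw [pullInt_comp]
      exact congrArg (pullInt _) (f.pair_eq x _)
    rw [BasedRootDatum.pairing_weightMap_coweightMap, ← h₂, pullInt_comp, pullInt_comp,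
      pullInt_comp] at h₁
    have ht : (specOverAut k (σ : K ≃+* K)).base.hom t = t := Subsingleton.elim _ _
    have h₃ := ContinuousMap.congr_fun h₁ t
    set j := (lift (f.wt x) (f.cowt (φ.1.coweightMap y))).left
    change 𝓡.pair ((prodMap hFb hFb').base.hom
        (j.base.hom ((specOverAut k (σ : K ≃+* K)).base.hom t))) =
      𝓡.pair (j.base.hom ((specOverAut k (σ : K ≃+* K)).base.hom t)) at h₃
    rw [ht] at h₃
    exact h₃
  · change s.hom ≫ 𝓡.simpleIncl.left ≫ 𝓡.rootIncl.left =
      (𝓡.simpleIncl.left ≫ 𝓡.rootIncl.left) ≫ F.hom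
    rw [← Category.assoc, hsimple, Category.assoc, hroot, Category.assoc]

end SplittingOver

end Cocycle

/-! ### Graphs with a positive quadratic form -/

namespace SimpleGraph

/-- In a tree with root `r` every vertex has only one neighbour nearer to the root. -/
theorem IsTree.eq_of_adj_of_dist_eq {V : Type u} {G : SimpleGraph V} (hG : G.IsTree)
    {r u u' w : V} (hu : G.Adj u w) (hu' : G.Adj u' w)
    (h : G.dist r w = G.dist r u + 1) (h' : G.dist r w = G.dist r u' + 1) :
    u = u' := by
  obtain ⟨p, hp, hpd⟩ := hG.connected.exists_path_of_dist r u
  obtain ⟨q, hq, hqd⟩ := hG.connected.exists_path_of_dist r u'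
  have hp' : (p.concat hu).IsPath :=
    Walk.isPath_of_length_eq_dist _ (by rw [Walk.length_concat, hpd, h])
  have hq' : (q.concat hu').IsPath :=
    Walk.isPath_of_length_eq_dist _ (by rw [Walk.length_concat, hqd, h'])
  have := (hG.existsUnique_path r w).unique hp' hq'
  have := congrArg Walk.penultimate this
  rwa [Walk.penultimate_concat, Walk.penultimate_concat] at this

theorem dist_apply_le {V : Type u} {G : SimpleGraph V} (hG : G.Connected) (π : G ≃g G) (u v : V) :
    G.dist (π u) (π v) ≤ G.dist u v := by
  obtain ⟨p, hp⟩ := hG.exists_walk_length_eq_dist u v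
  rw [← hp, ← Walk.length_map π.toHom p]
  exact dist_le _

variable {V : Type u} [Fintype V] (G : SimpleGraph V) [DecidableRel G.Adj]

/-- The quadratic form `2 ∑ xᵢ² - ∑_{i ~ j} xᵢ xⱼ` (sum over ordered pairs of neighbours) of the
graph is positive on nonzero vectors with nonnegative integral entries. -/
def IsPositive : Prop :=
  ∀ x : V → ℕ, x ≠ 0 → ∑ i, ∑ j ∈ G.neighborFinset i, x i * x j < 2 * ∑ i, x i ^ 2

variable {G}

/-- An automorphism of a finite tree which fixes all leaves is the identity: at a moved vertex of
maximal distance from a leaf, look at a neighbour further away. -/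
theorem IsTree.eq_of_fixes_leaves (hG : G.IsTree) (π : G ≃g G)
    (h : ∀ v, G.degree v = 1 → π v = v) (v : V) : π v = v := by
  classical
  rcases subsingleton_or_nontrivial V with hV | hV
  · exact Subsingleton.elim _ _
  obtain ⟨r, hr⟩ := hG.exists_vert_degree_one_of_nontrivial
  by_contra hv
  obtain ⟨v, hv, hmax⟩ := (Finset.univ.filter fun v => π v ≠ v).exists_max_image (G.dist r)
    ⟨v, by simpa using hv⟩
  replace hv : π v ≠ v := by simpa using hv
  have hdeg : 1 < G.degree v := by
    have := hG.connected.preconnected.degree_pos_of_nontrivial v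
    have : G.degree v ≠ 1 := fun h' => hv (h v h')
    omega
  -- only one neighbour of `v` is closer to the root
  obtain ⟨w, hw, hd⟩ : ∃ w, G.Adj v w ∧ G.dist r w = G.dist r v + 1 := by
    obtain ⟨a, ha, b, hb, hab⟩ := Finset.one_lt_card.1 hdeg
    rw [mem_neighborFinset] at ha hb
    rcases hG.dist_eq_dist_add_one_of_adj r ha with h₁ | h₁
    · rcases hG.dist_eq_dist_add_one_of_adj r hb with h₂ | h₂
      · exact absurd (hG.eq_of_adj_of_dist_eq ha.symm hb.symm h₁ h₂) hab
      · exact ⟨b, hb, h₂⟩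
    · exact ⟨a, ha, h₁⟩
  have hπw : π w = w := by
    by_contra hw'
    have := hmax w (by simpa using hw')
    omega
  have hπv : G.Adj (π v) w := by
    have := π.map_adj_iff.2 hw
    rwa [hπw] at this
  have hle := dist_apply_le hG.connected π r v
  rw [h r hr] at hle
  refine hv (hG.eq_of_adj_of_dist_eq (r := r) hπv hw ?_ hd)
  rcases hG.dist_eq_dist_add_one_of_adj r hπv with h₁ | h₁ <;> omega

namespace IsPositive

variable (hpos : G.IsPositive) (hconn : G.Connected)

include hpos hconn

theorem isTree : G.IsTree := by
  rw [isTree_iff_connected_and_card]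
  refine ⟨hconn, le_antisymm ?_ hconn.card_vert_le_card_edgeSet_add_one⟩
  obtain ⟨v⟩ := hconn.nonempty
  have h := hpos 1 fun h => one_ne_zero (congrFun h v)
  have h₂ := G.sum_degrees_eq_twice_card_edges
  simp only [Pi.one_apply, mul_one, Finset.sum_const, card_neighborFinset_eq_degree, smul_eq_mul,
    one_pow, Finset.card_univ] at h
  rw [Nat.card_eq_fintype_card, Nat.card_eq_fintype_card, ← edgeFinset_card]
  omega

theorem sum_degree : ∑ v, G.degree v + 2 = 2 * Fintype.card V := by
  have := (hpos.isTree hconn).card_edgeFinset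
  rw [G.sum_degrees_eq_twice_card_edges]
  omega

/-- The bound on the number of leaves: test the form on the vector which is `1` on the leaves and
`2` elsewhere. -/
theorem card_leaves_le : (Finset.univ.filter fun v => G.degree v = 1).card ≤ 3 := by
  obtain ⟨v₀⟩ := hconn.nonempty
  set x : V → ℕ := fun v => if G.degree v = 1 then 1 else 2 with hx
  have h := hpos x fun h => by
    have := congrFun h v₀
    simp only [hx, Pi.zero_apply] at this
    split_ifs at this
  have hx' (v : V) : x v = 1 ∨ x v = 2 := by
    simp only [hx]
    split_ifs <;> simp
  set L := (Finset.univ.filter fun v => G.degree v = 1).card with hL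
  have hE := hpos.sum_degree hconn
  -- `x y ≥ 2 x + 2 y - 4` for `x, y ∈ {1, 2}`
  have h₁ : ∑ i, ∑ j ∈ G.neighborFinset i, (2 * x i + 2 * x j) ≤
      ∑ i, ∑ j ∈ G.neighborFinset i, x i * x j + ∑ i, ∑ _j ∈ G.neighborFinset i, 4 := by
    rw [← Finset.sum_add_distrib]
    refine Finset.sum_le_sum fun i _ => ?_
    rw [← Finset.sum_add_distrib]
    refine Finset.sum_le_sum fun j _ => ?_
    rcases hx' i with h | h <;> rcases hx' j with h' | h' <;> norm_num [h, h']
  have h₂ : ∑ i, ∑ j ∈ G.neighborFinset i, (2 * x i + 2 * x j) =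
      4 * ∑ i, G.degree i * x i := by
    have hswap : ∑ i, ∑ j ∈ G.neighborFinset i, x j = ∑ i, ∑ j ∈ G.neighborFinset i, x i := by
      rw [Finset.sum_comm' (t' := Finset.univ) (s' := fun j => G.neighborFinset j)]
      simp [adj_comm]
    simp only [Finset.sum_add_distrib, ← Finset.mul_sum]
    rw [hswap]
    simp only [Finset.sum_const, card_neighborFinset_eq_degree, smul_eq_mul]
    ring
  have h₃ : ∑ i, G.degree i * x i + L = 2 * ∑ i, G.degree i := by
    rw [hL, Finset.card_filter, ← Finset.sum_add_distrib, Finset.mul_sum]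
    refine Finset.sum_congr rfl fun i _ => ?_
    simp only [hx]
    split_ifs with h
    · rw [h]
      norm_num
    · ring
  have h₄ : ∑ i, x i ^ 2 + 3 * L = 4 * Fintype.card V := by
    rw [hL, Finset.card_filter, Finset.mul_sum, ← Finset.sum_add_distrib, ← Finset.card_univ,
      mul_comm 4, ← smul_eq_mul, ← Finset.sum_const]
    refine Finset.sum_congr rfl fun i _ => ?_
    simp only [hx]
    split_ifs <;> norm_num
  simp only [Finset.sum_const, card_neighborFinset_eq_degree, smul_eq_mul] at h₁
  rw [← Finset.sum_mul] at h₁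
  rw [h₂] at h₁
  omega

/-- There is at most one branch point: each contributes a leaf beyond the two of a path, and
there are at most three leaves. -/
theorem eq_of_three_le_degree [Nontrivial V] {u v : V} (hu : 3 ≤ G.degree u)
    (hv : 3 ≤ G.degree v) : u = v := by
  classical
  by_contra huv
  have hL := hpos.card_leaves_le hconn
  have hE := hpos.sum_degree hconn
  have h : ∑ i : V, (2 + (if i = u then 1 else 0) + (if i = v then 1 else 0)) ≤
      ∑ i : V, (G.degree i + if G.degree i = 1 then 1 else 0) := by
    refine Finset.sum_le_sum fun i _ => ?_
    have := hconn.preconnected.degree_pos_of_nontrivial i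
    split_ifs with h₁ h₂ h₃ <;> subst_vars <;> first | omega | simp_all
  rw [Finset.card_filter] at hL
  simp only [Finset.sum_add_distrib, Finset.sum_ite_eq', Finset.mem_univ, if_true,
    Finset.sum_const, Finset.card_univ, smul_eq_mul] at h
  omega

/-- A vertex of degree `d` forces `d` leaves in a tree, and there are at most three. -/
theorem degree_le_three [Nontrivial V] (z : V) : G.degree z ≤ 3 := by
  classical
  have hL := hpos.card_leaves_le hconn
  have hE := hpos.sum_degree hconn
  have h : ∑ i : V, (2 + (if i = z then G.degree z - 2 else 0)) ≤
      ∑ i : V, (G.degree i + if G.degree i = 1 then 1 else 0) := by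
    refine Finset.sum_le_sum fun i _ => ?_
    have := hconn.preconnected.degree_pos_of_nontrivial i
    split_ifs with h₁ h₂ h₃ <;> subst_vars <;> omega
  rw [Finset.card_filter] at hL
  simp only [Finset.sum_add_distrib, Finset.sum_ite_eq', Finset.mem_univ, if_true,
    Finset.sum_const, Finset.card_univ, smul_eq_mul] at h
  omega

/-- A graph without branch points has at most two leaves. -/
theorem exists_three_le_degree [Nontrivial V]
    (h3 : 3 ≤ (Finset.univ.filter fun v => G.degree v = 1).card) : ∃ z, 3 ≤ G.degree z := by
  by_contra! hlt
  have hE := hpos.sum_degree hconn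
  have h : ∑ i : V, (G.degree i + if G.degree i = 1 then 1 else 0) ≤ ∑ i : V, 2 := by
    refine Finset.sum_le_sum fun i _ => ?_
    have := hlt i
    split_ifs <;> omega
  rw [Finset.card_filter] at h3
  simp only [Finset.sum_add_distrib, Finset.sum_const, Finset.card_univ, smul_eq_mul] at h
  omega

omit hconn in
/-- A positive graph admits no nonzero nonnegative vector `x` such that `2 xᵢ` is at most the sum
of the values at the neighbours of `i`; such a vector exists for affine diagrams. -/
theorem eq_zero_of_two_mul_le {x : V → ℕ}
    (hx : ∀ i, x i ≠ 0 → 2 * x i ≤ ∑ j ∈ G.neighborFinset i, x j) : x = 0 := by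
  by_contra h0
  have h := hpos x h0
  rw [Finset.mul_sum] at h
  refine h.not_ge (Finset.sum_le_sum fun i _ => ?_)
  rw [← Finset.mul_sum, sq]
  rcases eq_or_ne (x i) 0 with h | h
  · simp [h]
  · calc 2 * (x i * x i) = x i * (2 * x i) := by ring
      _ ≤ _ := Nat.mul_le_mul_left _ (hx i h)

/-- A positive connected graph with an automorphism of order three is the graph `D₄`. -/
theorem exists_star (ρ : G ≃g G) (h3 : ∀ v, ρ (ρ (ρ v)) = v) (hne : ∃ v, ρ v ≠ v) :
    ∃ z a, ρ z = z ∧ ρ a ≠ a ∧ G.Adj z a ∧ (∀ v, G.Adj a v → v = z) ∧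
      ∀ v, v = z ∨ v = a ∨ v = ρ a ∨ v = ρ (ρ a) := by
  classical
  obtain ⟨v₀, hv₀⟩ := hne
  have : Nontrivial V := ⟨_, _, hv₀⟩
  have hadj {x y : V} (h : G.Adj x y) : G.Adj (ρ x) (ρ y) := ρ.map_adj_iff.2 h
  have hmov {y : V} (hy : ρ y ≠ y) : ρ (ρ y) ≠ ρ y ∧ ρ (ρ y) ≠ y :=
    ⟨fun h => hy (ρ.injective h), fun h => hy (by conv_rhs => rw [← h3 y, h])⟩
  have hcard {y : V} (hy : ρ y ≠ y) : ({y, ρ y, ρ (ρ y)} : Finset V).card = 3 :=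
    Finset.card_eq_three.2 ⟨_, _, _, hy.symm, (hmov hy).2.symm, (hmov hy).1.symm, rfl⟩
  have hdeg {u y : V} (hu : ρ u = u) (hy : ρ y ≠ y) (h : G.Adj u y) :
      ({y, ρ y, ρ (ρ y)} : Finset V) ⊆ G.neighborFinset u := by
    have h₁ := hadj h
    rw [hu] at h₁
    have h₂ := hadj h₁
    rw [hu] at h₂
    simp [Finset.insert_subset_iff, h, h₁, h₂]
  have hdeg3 {u y : V} (hu : ρ u = u) (hy : ρ y ≠ y) (h : G.Adj u y) : 3 ≤ G.degree u := by
    rw [← hcard hy]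
    exact Finset.card_le_card (hdeg hu hy h)
  -- the automorphism permutes three leaves cyclically, and fixes the branch point
  obtain ⟨l, hl, hl'⟩ : ∃ l, G.degree l = 1 ∧ ρ l ≠ l := by
    by_contra! h
    exact hv₀ ((hpos.isTree hconn).eq_of_fixes_leaves ρ h v₀)
  obtain ⟨z, hz⟩ := hpos.exists_three_le_degree hconn <| by
    rw [← hcard hl']
    refine Finset.card_le_card ?_
    simp [Finset.insert_subset_iff, hl, Iso.degree_eq]
  have hz' {u : V} (hu : 3 ≤ G.degree u) : u = z := hpos.eq_of_three_le_degree hconn hu hz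
  have hρz : ρ z = z := hz' (by rwa [Iso.degree_eq])
  obtain ⟨a, ha, hza⟩ : ∃ a, ρ a ≠ a ∧ G.Adj z a := by
    obtain ⟨p⟩ := hconn.preconnected z v₀
    obtain ⟨d, -, hd₁, hd₂⟩ := p.exists_boundary_dart {v | ρ v = v} hρz hv₀
    have := hz' (hdeg3 hd₁ hd₂ d.adj)
    exact ⟨d.snd, hd₂, this ▸ d.adj⟩
  have hN : G.neighborFinset z = {a, ρ a, ρ (ρ a)} := by
    refine (Finset.eq_of_subset_of_card_le (hdeg hρz ha hza) ?_).symm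
    rw [hcard ha]
    exact hpos.degree_le_three hconn z
  have haz : a ≠ z := hza.ne'
  have hleaf : ∀ w, G.Adj a w → w = z := by
    intro w hw
    by_contra hwz
    have hρw : ρ w ≠ w := fun h => hwz (hz' (hdeg3 h ha hw.symm))
    have hfix {y : V} (hy : ρ y ≠ y) : y ≠ z := fun h => hy (by rw [h, hρz])
    have hinv {y y' : V} (h : ρ y = y') : y = ρ (ρ y') := by rw [← h, h3]
    have hw' : ¬ (w = ρ a ∨ w = ρ (ρ a)) := by
      intro h
      have haρ : G.Adj a (ρ a) := by
        rcases h with rfl | rfl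
        · exact hw
        · simpa only [h3] using (hadj hw).symm
      have haρ' : G.Adj a (ρ (ρ a)) := by simpa only [h3] using (hadj (hadj haρ)).symm
      have hc : ({z, ρ a, ρ (ρ a)} : Finset V).card = 3 :=
        Finset.card_eq_three.2 ⟨_, _, _, (hfix (hmov ha).1).symm,
          (hfix (hmov (hmov ha).1).1).symm, (hmov ha).1.symm, rfl⟩
      refine haz (hz' ?_)
      rw [← hc]
      exact Finset.card_le_card (by simp [Finset.insert_subset_iff, haρ, haρ', hza.symm])
    -- otherwise the graph contains the affine diagram `E₆`, on which the form vanishes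
    obtain ⟨hwa₁, hwa₂⟩ := not_or.1 hw'
    have hwa : w ≠ a := hw.ne'
    have hb := (hmov ha).1
    have hv := (hmov hρw).1
    have e₁ : ρ w ≠ a := fun h => hwa₂ (hinv h)
    have e₂ : ρ w ≠ ρ a := fun h => hwa (ρ.injective h)
    have e₃ : ρ w ≠ ρ (ρ a) := fun h => hwa₁ (ρ.injective h)
    have e₄ : ρ (ρ w) ≠ a := fun h => hwa₁ (by rw [← h, h3])
    have e₅ : ρ (ρ w) ≠ ρ a := fun h => e₁ (ρ.injective h)
    have e₆ : ρ (ρ w) ≠ ρ (ρ a) := fun h => e₂ (ρ.injective h)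
    set x : V → ℕ := fun v => if v = z then 3 else if v = a ∨ v = ρ a ∨ v = ρ (ρ a) then 2 else
      if v = w ∨ v = ρ w ∨ v = ρ (ρ w) then 1 else 0 with hx
    have hxz : x z = 3 := by simp [hx]
    have hxa {v : V} (h : v = a ∨ v = ρ a ∨ v = ρ (ρ a)) : x v = 2 := by
      have : v ≠ z := by
        rcases h with rfl | rfl | rfl
        exacts [haz, hfix hb, hfix (hmov hb).1]
      simp [hx, this, h]
    have hxw {v : V} (h : v = w ∨ v = ρ w ∨ v = ρ (ρ w)) : x v = 1 := by
      have h₁ : v ≠ z := by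
        rcases h with rfl | rfl | rfl
        exacts [hwz, hfix hv, hfix (hmov hv).1]
      have h₂ : ¬ (v = a ∨ v = ρ a ∨ v = ρ (ρ a)) := by
        rintro (h₂ | h₂ | h₂) <;> rcases h with h | h | h <;> rw [h] at h₂ <;> contradiction
      simp [hx, h₁, h₂, h]
    have hsum {i : V} {s : Finset V} (hs : s ⊆ G.neighborFinset i) {n : ℕ}
        (hn : n ≤ ∑ j ∈ s, x j) : n ≤ ∑ j ∈ G.neighborFinset i, x j :=
      hn.trans (Finset.sum_le_sum_of_subset hs)
    have hA {b c : V} (hb : b = a ∨ b = ρ a ∨ b = ρ (ρ a)) (hc : c = w ∨ c = ρ w ∨ c = ρ (ρ w))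
        (hbz : G.Adj z b) (hbc : G.Adj b c) (hcz : z ≠ c) :
        2 * x b ≤ ∑ j ∈ G.neighborFinset b, x j ∧ 2 * x c ≤ ∑ j ∈ G.neighborFinset c, x j := by
      refine ⟨hsum (s := {z, c}) ?_ ?_, hsum (s := {b}) ?_ ?_⟩
      · simp [Finset.insert_subset_iff, hbz.symm, hbc]
      · rw [Finset.sum_pair hcz, hxz, hxa hb, hxw hc]
      · simp [hbc.symm]
      · rw [Finset.sum_singleton, hxw hc, hxa hb]
    have hzb {y : V} (h : G.Adj z y) : G.Adj z (ρ y) := by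
      have := hadj h
      rwa [hρz] at this
    obtain ⟨A₁, B₁⟩ := hA (Or.inl rfl) (Or.inl rfl) hza hw (Ne.symm hwz)
    obtain ⟨A₂, B₂⟩ := hA (Or.inr (Or.inl rfl)) (Or.inr (Or.inl rfl)) (hzb hza) (hadj hw)
      (hfix hv).symm
    obtain ⟨A₃, B₃⟩ := hA (Or.inr (Or.inr rfl)) (Or.inr (Or.inr rfl)) (hzb (hzb hza))
      (hadj (hadj hw)) (hfix (hmov hv).1).symm
    have h0 := hpos.eq_zero_of_two_mul_le (x := x) fun i hi => by
      by_cases h₁ : i = z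
      · subst h₁
        refine hsum (hdeg hρz ha hza) ?_
        rw [Finset.sum_insert (by simp [ha.symm, (hmov ha).2.symm]),
          Finset.sum_pair hb.symm, hxz, hxa (by simp), hxa (by simp), hxa (by simp)]
        norm_num
      by_cases h₂ : i = a ∨ i = ρ a ∨ i = ρ (ρ a)
      · rcases h₂ with rfl | rfl | rfl
        exacts [A₁, A₂, A₃]
      by_cases h₃ : i = w ∨ i = ρ w ∨ i = ρ (ρ w)
      · rcases h₃ with rfl | rfl | rfl
        exacts [B₁, B₂, B₃]
      · exact absurd (by simp [hx, h₁, h₂, h₃]) hi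
    have := congrFun h0 z
    rw [hxz] at this
    exact absurd this (by norm_num)
  refine ⟨z, a, hρz, ha, hza, hleaf, fun v => ?_⟩
  by_contra hv
  obtain ⟨p⟩ := hconn.preconnected z v
  obtain ⟨d, -, hd₁, hd₂⟩ := p.exists_boundary_dart {v | v = z ∨ v = a ∨ v = ρ a ∨ v = ρ (ρ a)}
    (Or.inl rfl) hv
  have hd := d.adj
  rcases hd₁ with h | h | h | h <;> rw [h] at hd
  · have : d.snd ∈ G.neighborFinset z := by rwa [mem_neighborFinset]
    rw [hN] at this
    simp only [Finset.mem_insert, Finset.mem_singleton] at this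
    exact hd₂ (Or.inr this)
  · exact hd₂ (Or.inl (hleaf _ hd))
  · have := hleaf _ (by simpa only [h3] using hadj (hadj hd))
    refine hd₂ (Or.inl ?_)
    rw [← h3 d.snd, this, hρz]
  · have := hleaf _ (by simpa only [h3] using hadj hd)
    refine hd₂ (Or.inl ?_)
    rw [← h3 d.snd, this, hρz, hρz]

end IsPositive

end SimpleGraph

/-! ### The Dynkin graph -/

namespace BasedRootDatum

variable (R : BasedRootDatum.{u})

/-- The Dynkin graph of a based root datum, with multiplicities and arrows forgotten: simple roots
are adjacent if they are distinct and not orthogonal. -/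
def dynkinGraph : SimpleGraph R.base.support where
  Adj i j := i ≠ j ∧ R.P.pairing i j ≠ 0
  symm := ⟨fun _ _ h => ⟨h.1.symm, fun h' => h.2 (R.P.pairing_eq_zero_iff.1 h')⟩⟩
  loopless := ⟨fun _ h => h.1 rfl⟩

noncomputable instance : Fintype R.ι := Fintype.ofFinite _

noncomputable instance : DecidableRel R.dynkinGraph.Adj := Classical.decRel _

variable {R}

theorem two_mul_rootForm (i j : R.ι) :
    2 * R.P.RootForm (R.P.root i) (R.P.root j) =
      R.P.pairing i j * R.P.RootForm (R.P.root j) (R.P.root j) :=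
  R.P.toInvariantForm.two_mul_apply_root_root i j

theorem rootForm_root_pos (i : R.ι) : 0 < R.P.RootForm (R.P.root i) (R.P.root i) :=
  R.P.rootForm_pos_of_ne_zero (Submodule.subset_span ⟨i, rfl⟩) (R.P.ne_zero i)

theorem pairing_nonpos {i j : R.ι} (hij : i ≠ j) (hi : i ∈ R.base.support)
    (hj : j ∈ R.base.support) : R.P.pairing i j ≤ 0 := by
  have := R.base.pairingIn_le_zero_of_ne hij hi hj
  rwa [← R.P.algebraMap_pairingIn ℤ i j]

/-- The Gram matrix of the simple roots is positive definite over `ℝ`. -/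
theorem gram_pos {y : R.base.support → ℝ} (hy : y ≠ 0) :
    0 < ∑ s, ∑ t, y s * y t *
      ((R.P.RootForm (R.P.root s) (R.P.root t) : ℤ) : ℝ) := by
  classical
  set b : Matrix R.base.support R.base.support ℤ :=
    Matrix.of fun s t => R.P.RootForm (R.P.root s) (R.P.root t) with hb
  have hsq : ∑ s, ∑ t, y s * y t * ((R.P.RootForm (R.P.root s) (R.P.root t) : ℤ) : ℝ) =
      ∑ i, (∑ s : R.base.support, (R.P.pairing s i : ℝ) * y s) ^ 2 := by
    simp only [RootPairing.rootForm_apply_apply, RootPairing.root_coroot'_eq_pairing, sq,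
      Finset.sum_mul_sum, Int.cast_sum, Int.cast_mul]
    symm
    refine Finset.sum_comm.trans (Finset.sum_congr rfl fun s _ => ?_)
    refine Finset.sum_comm.trans (Finset.sum_congr rfl fun t _ => ?_)
    rw [Finset.mul_sum]
    exact Finset.sum_congr rfl fun i _ => by ring
  -- the form is semidefinite with integral coefficients, so it is enough that it is nondegenerate
  -- over `ℤ`
  rw [hsq]
  refine lt_of_le_of_ne (Finset.sum_nonneg fun i _ => sq_nonneg _) fun h0 => hy ?_
  have h0' : ∀ i, ∑ s : R.base.support, (R.P.pairing s i : ℝ) * y s = 0 := fun i => by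
    have := (Finset.sum_eq_zero_iff_of_nonneg fun i _ => sq_nonneg _).1 h0.symm i
      (Finset.mem_univ i)
    exact pow_eq_zero_iff two_ne_zero |>.1 this
  by_contra hy
  have hdet : (b.map (Int.castRingHom ℝ)).det = 0 := by
    rw [← Matrix.exists_mulVec_eq_zero_iff]
    refine ⟨y, hy, funext fun t => ?_⟩
    simp only [Matrix.mulVec, dotProduct, Matrix.map_apply, hb, Matrix.of_apply,
      RootPairing.rootForm_apply_apply, RootPairing.root_coroot'_eq_pairing, Pi.zero_apply,
      eq_intCast, Int.cast_sum, Int.cast_mul, Finset.sum_mul]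
    rw [Finset.sum_comm]
    refine Finset.sum_eq_zero fun i _ => ?_
    simp only [mul_assoc, ← Finset.mul_sum]
    rw [h0', mul_zero]
  rw [← RingHom.mapMatrix_apply, ← RingHom.map_det, eq_intCast, Int.cast_eq_zero,
    ← Matrix.exists_mulVec_eq_zero_iff] at hdet
  obtain ⟨v, hv, hbv⟩ := hdet
  have hm : R.P.RootForm (∑ s, v s • R.P.root s) (∑ s, v s • R.P.root s) = 0 := by
    have (s : R.base.support) : R.P.RootForm (R.P.root s) (∑ t, v t • R.P.root t) = 0 := by
      have := congrFun hbv s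
      simp only [Matrix.mulVec, dotProduct, hb, Matrix.of_apply, Pi.zero_apply] at this
      simpa [map_sum, mul_comm] using this
    rw [map_sum]
    refine Finset.sum_eq_zero fun s _ => ?_
    have hs : R.P.RootForm (∑ t, v t • R.P.root t) (R.P.root s) =
      R.P.RootForm (R.P.root s) (∑ t, v t • R.P.root t) := R.P.rootForm_symmetric.eq _ _
    rw [map_smul, hs, this, smul_zero]
  have hm' := R.P.eq_zero_of_mem_rootSpan_of_rootForm_self_eq_zero
    (Submodule.sum_mem _ fun s _ => Submodule.smul_mem _ _ (Submodule.subset_span ⟨_, rfl⟩)) hm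
  have hli : LinearIndependent ℤ fun s : R.base.support => R.P.root s :=
    R.base.linearIndepOn_root
  exact hv (funext fun s => Fintype.linearIndependent_iff.1 hli v hm' s)

/-- The form of the Dynkin graph is bounded below by the Gram matrix of the unit vectors in the
directions of the simple roots, so it is positive. -/
theorem dynkinGraph_isPositive : R.dynkinGraph.IsPositive := by
  classical
  intro x hx
  set d : R.base.support → ℝ :=
    fun s => ((R.P.RootForm (R.P.root s) (R.P.root s) : ℤ) : ℝ) with hd
  have hdpos (s) : 0 < d s := Int.cast_pos.2 (rootForm_root_pos (s : R.ι))
  have hsq (s) : 0 < √(d s) := Real.sqrt_pos.2 (hdpos s)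
  have hy : (fun s => (x s : ℝ) / √(d s)) ≠ 0 := fun h => hx <| funext fun s => by
    have := congrFun h s
    simpa [(hsq s).ne'] using this
  have hterm (s t : R.base.support) :
      (x s : ℝ) / √(d s) * ((x t : ℝ) / √(d t)) *
        ((R.P.RootForm (R.P.root s) (R.P.root t) : ℤ) : ℝ) ≤
      (if s = t then (x s : ℝ) ^ 2 else 0) -
        (if R.dynkinGraph.Adj s t then (x s : ℝ) * x t else 0) / 2 := by
    by_cases hst : s = t
    · subst hst
      have h : (x s : ℝ) / √(d s) * ((x s : ℝ) / √(d s)) * d s = (x s : ℝ) ^ 2 := by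
        have := (hsq s).ne'
        nth_rw 3 [← Real.mul_self_sqrt (hdpos s).le]
        field_simp
      rw [if_pos rfl, if_neg (R.dynkinGraph.irrefl), zero_div, sub_zero]
      exact h.le
    · have hst' : (s : R.ι) ≠ t := fun h => hst (Subtype.ext h)
      have h₁ := two_mul_rootForm (s : R.ι) t
      have h₂ := two_mul_rootForm (t : R.ι) s
      have hsymm : R.P.RootForm (R.P.root t) (R.P.root s) =
        R.P.RootForm (R.P.root s) (R.P.root t) := R.P.rootForm_symmetric.eq _ _
      rw [hsymm] at h₂
      have hn₁ := pairing_nonpos hst' s.2 t.2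
      have hn₂ := pairing_nonpos hst'.symm t.2 s.2
      rw [if_neg hst, zero_sub]
      split_ifs with hadj
      · -- `4 b² = ⟨s, t⟩ ⟨t, s⟩ d_s d_t ≥ d_s d_t`
        have hp : R.P.pairing s t ≤ -1 := by
          have := hadj.2
          omega
        have hq : R.P.pairing t s ≤ -1 := by
          have := hadj.symm.2
          omega
        set b := R.P.RootForm (R.P.root s) (R.P.root t)
        have hds := rootForm_root_pos (s : R.ι)
        have hdt := rootForm_root_pos (t : R.ι)
        have hb : b ≤ 0 := by nlinarith
        have hb4 : R.P.RootForm (R.P.root s) (R.P.root s) * R.P.RootForm (R.P.root t) (R.P.root t) ≤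
            (-2 * b) ^ 2 := by
          have : (-2 * b) ^ 2 = (R.P.pairing s t * R.P.pairing t s) *
            (R.P.RootForm (R.P.root s) (R.P.root s) *
              R.P.RootForm (R.P.root t) (R.P.root t)) := by
            calc (-2 * b) ^ 2 = (2 * b) * (2 * b) := by ring
              _ = _ := by nth_rw 1 [h₁]; rw [h₂]; ring
          rw [this]
          refine le_mul_of_one_le_left (mul_pos hds hdt).le ?_
          nlinarith
        have hb4' : d s * d t ≤ (-2 * (b : ℝ)) ^ 2 := by
          have : ((R.P.RootForm (R.P.root s) (R.P.root s) *
            R.P.RootForm (R.P.root t) (R.P.root t) : ℤ) : ℝ) ≤ (((-2 * b) ^ 2 : ℤ) : ℝ) :=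
            Int.cast_le.2 hb4
          push_cast at this
          exact this
        have hbR : (b : ℝ) ≤ 0 := Int.cast_nonpos.2 hb
        have hsqrt : √(d s) * √(d t) ≤ -2 * (b : ℝ) := by
          rw [← Real.sqrt_mul (hdpos s).le]
          exact Real.sqrt_le_left (by linarith) |>.2 hb4'
        have hxx : (0 : ℝ) ≤ x s * x t := by positivity
        have hss := mul_pos (hsq s) (hsq t)
        rw [div_mul_div_comm, div_mul_eq_mul_div, div_le_iff₀ hss]
        nlinarith
      · have h0 : R.P.pairing s t = 0 := by
          by_contra h
          exact hadj ⟨hst, h⟩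
        rw [h0, zero_mul] at h₁
        have : R.P.RootForm (R.P.root s) (R.P.root t) = 0 := by omega
        rw [this]
        simp
  have h := (gram_pos hy).trans_le
    (Finset.sum_le_sum fun s _ => Finset.sum_le_sum fun t _ => hterm s t)
  simp only [Finset.sum_sub_distrib, Finset.sum_ite_eq, Finset.mem_univ, if_true,
    ← Finset.sum_div] at h
  have h' : ∑ s, ∑ t, (if R.dynkinGraph.Adj s t then (x s : ℝ) * x t else 0) =
      ((∑ i, ∑ j ∈ R.dynkinGraph.neighborFinset i, x i * x j : ℕ) : ℝ) := by
    push_cast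
    refine Finset.sum_congr rfl fun s _ => ?_
    rw [← Finset.sum_filter]
    refine Finset.sum_congr ?_ fun _ _ => rfl
    ext t
    simp
  have h'' : ∑ s, (x s : ℝ) ^ 2 = ((∑ i, x i ^ 2 : ℕ) : ℝ) := by push_cast; rfl
  rw [h', h''] at h
  have : ((∑ i, ∑ j ∈ R.dynkinGraph.neighborFinset i, x i * x j : ℕ) : ℝ) <
      ((2 * ∑ i, x i ^ 2 : ℕ) : ℝ) := by
    push_cast at h ⊢
    linarith
  exact_mod_cast this

/-- The Dynkin graph of a simple datum is connected: the roots in the span of the simple roots of a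
component are orthogonal to all others. -/
theorem IsSimple.dynkinGraph_connected (hR : R.IsSimple) : R.dynkinGraph.Connected := by
  have := hR.nonempty
  obtain ⟨i₀, hi₀⟩ := R.base.support_nonempty
  set r : R.base.support := ⟨i₀, hi₀⟩
  have hne : Nonempty R.base.support := ⟨r⟩
  rw [SimpleGraph.connected_iff_exists_forall_reachable]
  refine ⟨r, ?_⟩
  by_contra! hcon
  obtain ⟨t, ht⟩ := hcon
  set S : Set R.ι := {i | ∃ h : i ∈ R.base.support, R.dynkinGraph.Reachable r ⟨i, h⟩} with hS
  set T : Set R.ι := {i | ∃ h : i ∈ R.base.support, ¬ R.dynkinGraph.Reachable r ⟨i, h⟩} with hT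
  have hST {i j} (hi : i ∈ S) (hj : j ∈ T) : R.P.pairing i j = 0 := by
    obtain ⟨hi, hi'⟩ := hi
    obtain ⟨hj, hj'⟩ := hj
    by_contra h
    refine hj' (hi'.trans (SimpleGraph.Adj.reachable ⟨fun h' => hj' (h' ▸ hi'), h⟩))
  have horth {U W : Set R.ι} (h : ∀ i ∈ U, ∀ j ∈ W, R.P.pairing i j = 0) {x : R.M} {y : R.M'}
      (hx : x ∈ Submodule.span ℤ (R.P.root '' U)) (hy : y ∈ Submodule.span ℤ (R.P.coroot '' W)) :
      R.P.toLinearMap x y = 0 := by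
    have h₁ : Submodule.span ℤ (R.P.root '' U) ≤ LinearMap.ker (R.P.toLinearMap.flip y) := by
      rw [Submodule.span_le]
      rintro _ ⟨i, hi, rfl⟩
      have h₂ : Submodule.span ℤ (R.P.coroot '' W) ≤
          LinearMap.ker (R.P.toLinearMap (R.P.root i)) := by
        rw [Submodule.span_le]
        rintro _ ⟨j, hj, rfl⟩
        exact h i hi j hj
      exact h₂ hy
    exact h₁ hx
  have hTS {i} (hi : i ∈ T) {j} (hj : j ∈ S) : R.P.pairing i j = 0 :=
    R.P.pairing_eq_zero_iff.1 (hST hj hi)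
  let side (U : Set R.ι) (i : R.ι) : Prop :=
    R.P.root i ∈ Submodule.span ℤ (R.P.root '' U) ∧
      R.P.coroot i ∈ Submodule.span ℤ (R.P.coroot '' U)
  have hrefl {U : Set R.ι} {i j : R.ι} (hi : side U i) (hj : side U j) :
      side U (R.P.reflectionPerm j i) := by
    refine ⟨?_, ?_⟩
    · rw [R.P.root_reflectionPerm, RootPairing.reflection_apply]
      exact Submodule.sub_mem _ hi.1 (Submodule.smul_mem _ _ hj.1)
    · rw [R.P.coroot_reflectionPerm, RootPairing.coreflection_apply]
      exact Submodule.sub_mem _ hi.2 (Submodule.smul_mem _ _ hj.2)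
  have hfix {U W : Set R.ι} (hUW : ∀ i ∈ U, ∀ j ∈ W, R.P.pairing i j = 0) {i j : R.ι}
      (hi : side U i) (hj : j ∈ W) : R.P.reflectionPerm j i = i := by
    refine R.P.root.injective ?_
    rw [R.P.root_reflectionPerm, RootPairing.reflection_apply]
    have : R.P.coroot' j (R.P.root i) = 0 :=
      horth hUW hi.1 (Submodule.subset_span ⟨j, hj, rfl⟩)
    rw [this, zero_smul, sub_zero]
  have hself {U : Set R.ι} {i} (hi : i ∈ U) : side U i :=
    ⟨Submodule.subset_span ⟨i, hi, rfl⟩, Submodule.subset_span ⟨i, hi, rfl⟩⟩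
  have hside (i : R.ι) : side S i ∨ side T i := by
    refine R.base.induction_reflect i (p := fun i => side S i ∨ side T i) ?_ ?_ ?_
    · rintro i (h | h)
      exacts [Or.inl (hrefl h h), Or.inr (hrefl h h)]
    · intro i hi
      by_cases h : R.dynkinGraph.Reachable r ⟨i, hi⟩
      exacts [Or.inl (hself ⟨hi, h⟩), Or.inr (hself ⟨hi, h⟩)]
    · intro i j h hj
      by_cases h' : R.dynkinGraph.Reachable r ⟨j, hj⟩
      · have hjS : j ∈ S := ⟨hj, h'⟩
        rcases h with h | h
        · exact Or.inl (hrefl h (hself hjS))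
        · rw [hfix (fun i hi j hj => hTS hi hj) h hjS]
          exact Or.inr h
      · have hjT : j ∈ T := ⟨hj, h'⟩
        rcases h with h | h
        · rw [hfix (fun i hi j hj => hST hi hj) h hjT]
          exact Or.inl h
        · exact Or.inr (hrefl h (hself hjT))
  obtain ⟨i, hi, j, hj, hij⟩ := hR.irreducible {i | side S i}
    ⟨i₀, hself ⟨hi₀, SimpleGraph.Reachable.refl _⟩⟩ ⟨t, fun h => by
      have : R.P.pairing t t = 0 :=
        horth (fun i hi j hj => hST hi hj) h.1 (Submodule.subset_span ⟨t, ⟨t.2, ht⟩, rfl⟩)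
      rw [R.P.pairing_same] at this
      exact two_ne_zero this⟩
  exact hij (horth (fun i hi j hj => hST hi hj) hi.1 ((hside j).resolve_left hj).2)

/-! ### Diagram automorphisms -/

theorem weightMap_root (φ : R.P.Aut) (i : R.ι) :
    φ.weightMap (R.P.root i) = R.P.root (φ.indexEquiv i) :=
  congrFun φ.root_weightMap i

theorem coweightMap_coroot (φ : R.P.Aut) (i : R.ι) :
    φ.coweightMap (R.P.coroot (φ.indexEquiv i)) = R.P.coroot i := by
  have := congrFun φ.coroot_coweightMap (φ.indexEquiv i)
  rwa [Function.comp_apply, Function.comp_apply, Equiv.symm_apply_apply] at this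

/-- Pairings of `φ x` with the coroot of `φ α`. -/
theorem pairing_weightMap_coroot (φ : R.P.Aut) (x : R.M) (i : R.ι) :
    R.P.toLinearMap (φ.weightMap x) (R.P.coroot (φ.indexEquiv i)) =
      R.P.toLinearMap x (R.P.coroot i) := by
  rw [pairing_weightMap_coweightMap, coweightMap_coroot]

theorem pairing_indexEquiv (φ : R.P.Aut) (i j : R.ι) :
    R.P.pairing (φ.indexEquiv i) (φ.indexEquiv j) = R.P.pairing i j := by
  have := pairing_weightMap_coroot φ (R.P.root i) j
  rwa [weightMap_root] at this

/-- The automorphism of the Dynkin graph defined by an automorphism of the based root datum. -/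
def dynkinAut (φ : R.Aut) : R.dynkinGraph ≃g R.dynkinGraph where
  toEquiv := φ.1.indexEquiv.subtypeEquiv fun i => (φ.2 i).symm
  map_rel_iff' {i j} := and_congr (Equiv.apply_eq_iff_eq _).not
    (by rw [← pairing_indexEquiv φ.1 i j]; rfl)

/-- Automorphisms of a semisimple datum are determined by their action on the simple roots. -/
theorem IsSemisimple.eq_one (hR : R.IsSemisimple) {φ : R.Aut} (h : ∀ i, dynkinAut φ i = i) :
    φ = 1 := by
  refine aut_ext fun m => ?_
  have : φ.1.weightMap = LinearMap.id := hR.linearMap_ext fun i => by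
    refine LinearMap.eqOn_span (s := R.P.root '' R.base.support) ?_ (R.base.root_mem_span_int i)
    rintro _ ⟨j, hj, rfl⟩
    rw [weightMap_root, LinearMap.id_apply]
    exact congrArg R.P.root (congrArg Subtype.val (h ⟨j, hj⟩))
  rw [this]
  rfl

/-- The action of the automorphism group on the end vertices of the Dynkin graph. -/
noncomputable def leafPerm (R : BasedRootDatum.{u}) :
    R.Aut →* Equiv.Perm {v // R.dynkinGraph.degree v = 1} where
  toFun φ := (dynkinAut φ).toEquiv.subtypeEquiv fun v => by
    rw [← (dynkinAut φ).degree_eq v]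
    rfl
  map_one' := by
    ext v
    rfl
  map_mul' φ ψ := by
    ext v
    rfl

/-- Automorphisms are determined by their action on the at most three end vertices. -/
theorem IsSimple.exists_injective_perm (hR : R.IsSimple) :
    ∃ j : R.Aut →* Equiv.Perm (Fin 3), Function.Injective j := by
  classical
  have hconn := hR.dynkinGraph_connected
  have hcard : Fintype.card {v // R.dynkinGraph.degree v = 1} ≤ Fintype.card (Fin 3) := by
    rw [Fintype.card_subtype, Fintype.card_fin]
    exact dynkinGraph_isPositive.card_leaves_le hconn
  obtain ⟨e⟩ := Function.Embedding.nonempty_of_card_le hcard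
  refine ⟨(Equiv.Perm.viaEmbeddingHom e).comp R.leafPerm,
    (Equiv.Perm.viaEmbeddingHom_injective e).comp ?_⟩
  rw [injective_iff_map_eq_one]
  intro φ hφ
  refine hR.semisimple.eq_one
    ((dynkinGraph_isPositive.isTree hconn).eq_of_fixes_leaves _ fun v hv => ?_)
  exact congrArg Subtype.val (Equiv.congr_fun hφ ⟨v, hv⟩)

/-- The coroots separate the elements of `M`. -/
theorem IsSemisimple.eq_zero_of_simple_coroots (hR : R.IsSemisimple) {m : R.M}
    (h : ∀ i ∈ R.base.support, R.P.toLinearMap m (R.P.coroot i) = 0) : m = 0 := by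
  obtain ⟨n, hn, hm⟩ := hR m
  have h₁ : ∀ i, R.P.toLinearMap m (R.P.coroot i) = 0 := fun i => by
    have : Submodule.span ℤ (R.P.coroot '' R.base.support) ≤ LinearMap.ker (R.P.toLinearMap m) := by
      rw [Submodule.span_le]
      rintro _ ⟨j, hj, rfl⟩
      exact h j hj
    exact this (R.base.coroot_mem_span_int i)
  have h₂ : R.P.RootForm (n • m) (n • m) = 0 := by
    rw [RootPairing.rootForm_apply_apply]
    refine Finset.sum_eq_zero fun i _ => ?_
    have : R.P.coroot' i m = 0 := h₁ i
    rw [map_smul, this, smul_zero, zero_mul]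
  have h₃ := R.P.eq_zero_of_mem_rootSpan_of_rootForm_self_eq_zero hm h₂
  exact (smul_eq_zero.1 h₃).resolve_left hn

/-- An involution `s` of `M` which permutes the simple roots through `π`, compatibly with the simple
coroots, is an automorphism of the based root datum. -/
theorem IsSemisimple.exists_aut_of_involution (hR : R.IsSemisimple) (s : R.M →ₗ[ℤ] R.M)
    (hs : ∀ x, s (s x) = x) (hπ : ∀ i ∈ R.base.support, ∃ j ∈ R.base.support,
      s (R.P.root i) = R.P.root j ∧
        ∀ x, R.P.toLinearMap (s x) (R.P.coroot j) = R.P.toLinearMap x (R.P.coroot i)) :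
    ∃ φ : R.Aut, ∀ m, φ.1.weightMap m = s m := by
  have hroot (i : R.ι) : ∃ j, s (R.P.root i) = R.P.root j := by
    refine R.base.induction_reflect i (p := fun i => ∃ j, s (R.P.root i) = R.P.root j) ?_ ?_ ?_
    · rintro i ⟨j, hj⟩
      refine ⟨R.P.reflectionPerm j j, ?_⟩
      rw [R.P.root_reflectionPerm, R.P.root_reflectionPerm, R.P.reflection_apply_self,
        R.P.reflection_apply_self, map_neg, hj]
    · intro i hi
      obtain ⟨j, -, hj, -⟩ := hπ i hi
      exact ⟨j, hj⟩
    · rintro i j ⟨i', hi'⟩ hj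
      obtain ⟨j', -, hj', hjx⟩ := hπ j hj
      refine ⟨R.P.reflectionPerm j' i', ?_⟩
      rw [R.P.root_reflectionPerm, R.P.root_reflectionPerm, RootPairing.reflection_apply,
        RootPairing.reflection_apply, map_sub, map_smul, hi', hj', ← hi']
      congr 2
      exact (hjx _).symm
  choose π hπr using hroot
  have hππ (i) : π (π i) = i := R.P.root.injective (by rw [← hπr, ← hπr, hs])
  set A : R.M ≃ₗ[ℤ] R.M := LinearEquiv.ofInvolutive s hs
  set B : R.M' ≃ₗ[ℤ] R.M' := R.P.flip.toPerfPair.trans (A.dualMap.trans R.P.flip.toPerfPair.symm)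
  have hB (x : R.M) (y : R.M') : R.P.toLinearMap x (B y) = R.P.toLinearMap (s x) y := by
    have : R.P.flip.toPerfPair (B y) = A.dualMap (R.P.flip.toPerfPair y) := by
      simp [B]
    exact LinearMap.congr_fun this x
  obtain ⟨φ, hφ, -⟩ := hR.exists_aut A.toAddEquiv B.toAddEquiv
    (fun x y => (hB (s x) y).trans (by rw [hs])) ⟨π, π, hππ, hππ⟩ (fun i => hπr i) fun i hi => by
      obtain ⟨j, hj, hij, -⟩ := hπ i hi
      have : π i = j := R.P.root.injective (by rw [← hπr, hij])
      change π i ∈ _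
      rwa [this]
  exact ⟨φ, hφ⟩

/-! ### Involutions of root data of type `D₄` -/

/-- In a diagram of type `D₄` with branch point `z` and end vertices `a₁, a₂, a₃` of equal pairings
with `z`, all bonds are simple, because `2 z - p (a₁ + a₂ + a₃)` has nonnegative length. -/
theorem pairing_eq_neg_one_of_star {z : R.ι} {a : Fin 3 → R.ι}
    (haa : ∀ i j, i ≠ j → R.P.pairing (a i) (a j) = 0)
    {p q : ℤ} (hp : ∀ i, R.P.pairing z (a i) = p) (hq : ∀ i, R.P.pairing (a i) z = q)
    (hp0 : p < 0) (hq0 : q < 0) : p = -1 ∧ q = -1 := by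
  set B := R.P.RootForm with hB
  set Bz := B (R.P.root z) (R.P.root z) with hBz
  have hBzpos : 0 < Bz := rootForm_root_pos z
  have hsymm (x y) : B x y = B y x := R.P.rootForm_symmetric.eq x y
  have h₁ (i) : 2 * B (R.P.root z) (R.P.root (a i)) = q * Bz := by
    rw [hsymm, ← hq i]
    exact two_mul_rootForm (a i) z
  have h₂ (i) : 2 * B (R.P.root z) (R.P.root (a i)) =
      p * B (R.P.root (a i)) (R.P.root (a i)) := by
    rw [← hp i]
    exact two_mul_rootForm z (a i)
  have h₃ (i j) (hij : i ≠ j) : B (R.P.root (a i)) (R.P.root (a j)) = 0 := by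
    have := two_mul_rootForm (a i) (a j)
    rw [haa i j hij, zero_mul] at this
    exact (mul_eq_zero.1 this).resolve_left two_ne_zero
  have h := R.P.zero_le_rootForm
    ((2 : ℤ) • R.P.root z - p • (R.P.root (a 0) + R.P.root (a 1) + R.P.root (a 2)))
  rw [← hB] at h
  simp only [map_sub, map_add, map_smul, LinearMap.sub_apply, LinearMap.add_apply,
    LinearMap.smul_apply, smul_eq_mul] at h
  rw [h₃ 0 1 (by decide), h₃ 0 2 (by decide), h₃ 1 0 (by decide), h₃ 1 2 (by decide),
    h₃ 2 0 (by decide), h₃ 2 1 (by decide), hsymm (R.P.root (a 0)) (R.P.root z),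
    hsymm (R.P.root (a 1)) (R.P.root z), hsymm (R.P.root (a 2)) (R.P.root z), ← hBz] at h
  have e₀ := h₁ 0
  have e₁ := h₁ 1
  have e₂ := h₁ 2
  have f₀ := h₂ 0
  have f₁ := h₂ 1
  have f₂ := h₂ 2
  have key : 0 ≤ (4 - 3 * (p * q)) * Bz := by
    linear_combination h - p * (e₀ + e₁ + e₂) - p * (f₀ + f₁ + f₂)
  have hpq : p * q ≤ 1 := by
    by_contra hlt
    nlinarith
  constructor <;> nlinarith

/-- If an automorphism of order three exists, so that the diagram is `D₄`, then an automorphism of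
order two exists. On the span of the roots it interchanges two end vertices `a₁`, `a₂`; it is the
reflection `x ↦ x - ½ ⟨x, a₁ᵛ - a₂ᵛ⟩ (a₁ - a₂)`. It preserves `M`: if some `⟨x, a₁ᵛ - a₂ᵛ⟩` is odd,
then, using the automorphism of order three, `½ (a₁ - a₂)` lies in `M`. -/
theorem IsSimple.exists_involution (hR : R.IsSimple) {φ : R.Aut} (h3 : φ ^ 3 = 1) (h1 : φ ≠ 1) :
    ∃ τ : R.Aut, τ ≠ 1 ∧ τ ^ 2 = 1 := by
  have hss := hR.semisimple
  have h3' : φ * (φ * φ) = 1 := by rw [← h3]; simp [pow_succ, mul_assoc]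
  obtain ⟨z, a, hz, ha, hza, hleaf, hall⟩ :=
    dynkinGraph_isPositive.exists_star hR.dynkinGraph_connected (dynkinAut φ)
      (fun v => by
        have : dynkinAut (φ * (φ * φ)) v = v := by rw [h3']; rfl
        exact this) (by
        by_contra! h
        exact h1 (hss.eq_one h))
  set a₁ : R.ι := a.1 with ha₁
  set a₂ : R.ι := φ.1.indexEquiv a₁ with ha₂
  set a₃ : R.ι := φ.1.indexEquiv a₂ with ha₃
  have hφz : φ.1.indexEquiv z = z := congrArg Subtype.val hz
  have hφ3 : φ.1.indexEquiv a₃ = a₁ := by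
    have := congrArg (fun ψ : R.Aut => ψ.1.indexEquiv a₁) h3'
    exact this
  have ha21 : a₂ ≠ a₁ := fun h => ha (Subtype.ext h)
  have ha32 : a₃ ≠ a₂ := fun h => ha21 (φ.1.indexEquiv.injective h)
  have ha13 : a₁ ≠ a₃ := fun h => ha32 (φ.1.indexEquiv.injective (hφ3.trans h))
  have hsupp : ∀ i ∈ R.base.support, i = z ∨ i = a₁ ∨ i = a₂ ∨ i = a₃ := fun i hi => by
    rcases hall ⟨i, hi⟩ with h | h | h | h
    · exact Or.inl (congrArg Subtype.val h)
    · exact Or.inr (Or.inl (congrArg Subtype.val h))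
    · exact Or.inr (Or.inr (Or.inl (congrArg Subtype.val h)))
    · exact Or.inr (Or.inr (Or.inr (congrArg Subtype.val h)))
  have hs₁ : a₁ ∈ R.base.support := a.2
  have hs₂ : a₂ ∈ R.base.support := (φ.2 _).2 hs₁
  have hs₃ : a₃ ∈ R.base.support := (φ.2 _).2 hs₂
  -- the Cartan integers
  have c12 : R.P.pairing a₁ a₂ = 0 := by
    by_contra h
    have : (⟨a₂, hs₂⟩ : R.base.support) = z :=
      hleaf ⟨a₂, hs₂⟩ ⟨fun h => ha21 (congrArg Subtype.val h).symm, h⟩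
    have : a₂ = z := congrArg Subtype.val this
    have h' : a₁ = z := φ.1.indexEquiv.injective (this.trans hφz.symm)
    exact ha21 (this.trans h'.symm)
  have c23 : R.P.pairing a₂ a₃ = 0 := (pairing_indexEquiv φ.1 a₁ a₂).trans c12
  have c31 : R.P.pairing a₃ a₁ = 0 := by
    have := pairing_indexEquiv φ.1 a₂ a₃
    rw [hφ3] at this
    exact this.trans c23
  have c21 := R.P.pairing_eq_zero_iff.1 c12
  have c32 := R.P.pairing_eq_zero_iff.1 c23
  have c13 := R.P.pairing_eq_zero_iff.1 c31
  have z2 : R.P.pairing z a₂ = R.P.pairing z a₁ := by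
    have := pairing_indexEquiv φ.1 z a₁
    rwa [hφz] at this
  have z3 : R.P.pairing z a₃ = R.P.pairing z a₁ := by
    have := pairing_indexEquiv φ.1 z a₂
    rw [hφz] at this
    exact this.trans z2
  have z2' : R.P.pairing a₂ z = R.P.pairing a₁ z := by
    have := pairing_indexEquiv φ.1 a₁ z
    rwa [hφz] at this
  have z3' : R.P.pairing a₃ z = R.P.pairing a₁ z := by
    have := pairing_indexEquiv φ.1 a₂ z
    rw [hφz] at this
    exact this.trans z2'
  have hza' : (z : R.ι) ≠ a₁ := fun h => hza.1 (Subtype.ext h)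
  obtain ⟨z1, z1'⟩ := pairing_eq_neg_one_of_star (R := R) (z := z) (a := ![a₁, a₂, a₃])
    (by
      intro i j hij
      fin_cases i <;> fin_cases j <;> first | exact absurd rfl hij | assumption)
    (p := R.P.pairing z a₁) (q := R.P.pairing a₁ z)
    (by
      intro i
      fin_cases i
      exacts [rfl, z2, z3])
    (by
      intro i
      fin_cases i
      exacts [rfl, z2', z3'])
    (lt_of_le_of_ne (pairing_nonpos hza' z.2 hs₁) hza.2)
    (lt_of_le_of_ne (pairing_nonpos hza'.symm hs₁ z.2) hza.symm.2)
  rw [z1] at z2 z3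
  rw [z1'] at z2' z3'
  have p11 := R.P.root_coroot_two a₁
  have p22 := R.P.root_coroot_two a₂
  have p33 := R.P.root_coroot_two a₃
  have pzz := R.P.root_coroot_two z
  rw [← RootPairing.root_coroot_eq_pairing] at c12 c23 c31 c21 c32 c13 z1 z2 z3 z1' z2' z3'
  set α₁ := R.P.root a₁
  set α₂ := R.P.root a₂
  set α₃ := R.P.root a₃
  set ζ := R.P.root z
  -- `T x = ½ ⟨x, a₁ᵛ - a₂ᵛ⟩ (a₁ - a₂)`
  have hT (x : R.M) : ∃ t : R.M, (2 : ℤ) • t =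
      (R.P.toLinearMap x (R.P.coroot a₁) - R.P.toLinearMap x (R.P.coroot a₂)) • (α₁ - α₂) := by
    by_cases heven : ∀ x, Even (R.P.toLinearMap x (R.P.coroot a₁) -
        R.P.toLinearMap x (R.P.coroot a₂))
    · obtain ⟨d, hd⟩ := heven x
      exact ⟨d • (α₁ - α₂), by rw [hd, smul_smul, two_mul]⟩
    · push Not at heven
      obtain ⟨x₀, hx₀⟩ := heven
      have hodd := Int.not_even_iff_odd.1 hx₀
      -- a translate of `x₀` whose pairing with `a₃ᵛ` has a parity different from the other two
      obtain ⟨y, hy₁, hy₂⟩ : ∃ y, Even (R.P.toLinearMap y (R.P.coroot a₁) -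
          R.P.toLinearMap y (R.P.coroot a₂)) ∧ Odd (R.P.toLinearMap y (R.P.coroot a₁) -
          R.P.toLinearMap y (R.P.coroot a₃)) := by
        have r₁ (x : R.M) : R.P.toLinearMap (φ.1.weightMap x) (R.P.coroot a₁) =
            R.P.toLinearMap x (R.P.coroot a₃) := by
          rw [← pairing_weightMap_coroot φ.1 x a₃, hφ3]
        have r₂ (x : R.M) : R.P.toLinearMap (φ.1.weightMap x) (R.P.coroot a₂) =
            R.P.toLinearMap x (R.P.coroot a₁) := pairing_weightMap_coroot φ.1 x a₁
        have r₃ (x : R.M) : R.P.toLinearMap (φ.1.weightMap x) (R.P.coroot a₃) =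
            R.P.toLinearMap x (R.P.coroot a₂) := pairing_weightMap_coroot φ.1 x a₂
        by_cases h : Even (R.P.toLinearMap x₀ (R.P.coroot a₃) -
          R.P.toLinearMap x₀ (R.P.coroot a₁))
        · refine ⟨φ.1.weightMap x₀, ?_, ?_⟩
          · rw [r₁, r₂]
            exact h
          · rw [r₁, r₃]
            grind
        · refine ⟨φ.1.weightMap (φ.1.weightMap x₀), ?_, ?_⟩
          · rw [r₁, r₂, r₃, r₁]
            grind
          · rw [r₁, r₃, r₃, r₂]
            grind
      set n₁ := R.P.toLinearMap y (R.P.coroot a₁)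
      set n₂ := R.P.toLinearMap y (R.P.coroot a₂)
      set n₃ := R.P.toLinearMap y (R.P.coroot a₃)
      set n₀ := R.P.toLinearMap y (R.P.coroot z)
      set c := 2 * n₀ + n₁ + n₂ + n₃ with hc
      -- the coefficients are chosen such that both sides of `hm` have the same simple coordinates,
      -- that is, the same pairings with the simple coroots
      obtain ⟨c₁, hc₁⟩ : ∃ c₁, 2 * c₁ = n₁ - 1 + c := ⟨(n₁ - 1 + c) / 2, by grind⟩
      obtain ⟨c₂, hc₂⟩ : ∃ c₂, 2 * c₂ = n₂ + 1 + c := ⟨(n₂ + 1 + c) / 2, by grind⟩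
      obtain ⟨c₃, hc₃⟩ : ∃ c₃, 2 * c₃ = n₃ + c := ⟨(n₃ + c) / 2, by grind⟩
      have hm : (2 : ℤ) • (y - (c₁ • α₁ + c₂ • α₂ + c₃ • α₃ + c • ζ)) = α₁ - α₂ := by
        rw [← sub_eq_zero]
        refine hss.eq_zero_of_simple_coroots fun i hi => ?_
        rcases hsupp i hi with rfl | rfl | rfl | rfl <;>
        simp only [map_sub, map_add, map_smul, LinearMap.sub_apply, LinearMap.add_apply,
          LinearMap.smul_apply, smul_eq_mul] <;>
        simp only [c12, c23, c31, c21, c32, c13, z1, z2, z3, z1', z2', z3', p11, p22, p33, pzz] <;>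
        grind
      exact ⟨(R.P.toLinearMap x (R.P.coroot a₁) - R.P.toLinearMap x (R.P.coroot a₂)) •
        (y - (c₁ • α₁ + c₂ • α₂ + c₃ • α₃ + c • ζ)), by rw [smul_comm, hm]⟩
  choose T hT using hT
  have hcancel {x y : R.M} (h : (2 : ℤ) • x = (2 : ℤ) • y) : x = y :=
    smul_right_injective R.M (two_ne_zero (α := ℤ)) h
  let s : R.M →+ R.M :=
    { toFun := fun x => x - T x
      map_zero' := by
        rw [zero_sub, neg_eq_zero]
        exact hcancel (by rw [hT]; simp)
      map_add' := fun x y => by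
        have : T (x + y) = T x + T y := hcancel <| by
          rw [smul_add, hT, hT, hT, map_add, LinearMap.add_apply, LinearMap.add_apply, ← add_smul]
          congr 1
          ring
        rw [this]
        abel }
  have hs (x : R.M) : s x = x - T x := rfl
  have hpair (x : R.M) (c : R.M') : 2 * R.P.toLinearMap (T x) c =
      (R.P.toLinearMap x (R.P.coroot a₁) - R.P.toLinearMap x (R.P.coroot a₂)) *
        (R.P.toLinearMap α₁ c - R.P.toLinearMap α₂ c) := by
    have := congrArg (fun m => R.P.toLinearMap m c) (hT x)
    simpa only [map_smul, map_sub, LinearMap.smul_apply, LinearMap.sub_apply,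
      smul_eq_mul] using this
  have hTT (x : R.M) : T (T x) = (2 : ℤ) • T x := hcancel <| by
    have h₁ := hpair x (R.P.coroot a₁)
    have h₂ := hpair x (R.P.coroot a₂)
    rw [p11, c21] at h₁
    rw [p22, c12] at h₂
    rw [hT (T x), hT x, smul_smul]
    congr 1
    omega
  have hss' (x : R.M) : s (s x) = x := by
    rw [hs x, map_sub, hs x, hs (T x), hTT]
    module
  have hinv (x : R.M) (c : R.M') : 2 * R.P.toLinearMap (s x) c = 2 * R.P.toLinearMap x c -
      (R.P.toLinearMap x (R.P.coroot a₁) - R.P.toLinearMap x (R.P.coroot a₂)) *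
        (R.P.toLinearMap α₁ c - R.P.toLinearMap α₂ c) := by
    rw [← hpair, hs, map_sub, LinearMap.sub_apply]
    ring
  have hs_eq {x y : R.M} (h : (2 : ℤ) • x - (R.P.toLinearMap x (R.P.coroot a₁) -
      R.P.toLinearMap x (R.P.coroot a₂)) • (α₁ - α₂) = (2 : ℤ) • y) : s x = y :=
    hcancel <| by rw [hs, smul_sub, hT, h]
  obtain ⟨τ, hτ⟩ := hss.exists_aut_of_involution s.toIntLinearMap hss' fun i hi => by
    rcases hsupp i hi with rfl | rfl | rfl | rfl
    · refine ⟨z, z.2, hs_eq ?_, fun x => ?_⟩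
      · rw [z1, z2, sub_self, zero_smul, sub_zero]
      · have := hinv x (R.P.coroot z)
        rw [z1', z2'] at this
        change R.P.toLinearMap (s x) _ = _
        omega
    · refine ⟨a₂, hs₂, hs_eq ?_, fun x => ?_⟩
      · rw [p11, c12]
        module
      · have := hinv x (R.P.coroot a₂)
        rw [c12, p22] at this
        change R.P.toLinearMap (s x) _ = _
        omega
    · refine ⟨a₁, hs₁, hs_eq ?_, fun x => ?_⟩
      · rw [p22, c21]
        module
      · have := hinv x (R.P.coroot a₁)
        rw [c21, p11] at this
        change R.P.toLinearMap (s x) _ = _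
        omega
    · refine ⟨a₃, hs₃, hs_eq ?_, fun x => ?_⟩
      · rw [c31, c32, sub_self, zero_smul, sub_zero]
      · have := hinv x (R.P.coroot a₃)
        rw [c13, c23] at this
        change R.P.toLinearMap (s x) _ = _
        omega
  refine ⟨τ, fun h => ?_, aut_ext fun m => ?_⟩
  · have h₁ : τ.1.weightMap α₁ = α₁ := by rw [h]; rfl
    have h₂ : s α₁ = α₂ := hs_eq (by rw [p11, c12]; module)
    rw [hτ] at h₁
    have : α₂ = α₁ := h₂.symm.trans h₁
    exact ha21 (R.P.root.injective this)
  · rw [sq]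
    change τ.1.weightMap (τ.1.weightMap m) = m
    rw [hτ, hτ]
    exact hss' m

end BasedRootDatum

/-! ### Isomorphisms of sequences of groups -/

/-- A subgroup of `S × T` which is the graph of a bijection is the graph of an isomorphism. -/
theorem exists_mulEquiv_of_subgroup {S : Type u} {T : Type v} [Group S] [Group T]
    (W : Subgroup (S × T)) (hS : ∀ s, ∃ t, (s, t) ∈ W) (hT : ∀ t, ∃ s, (s, t) ∈ W)
    (h₁ : ∀ t, (1, t) ∈ W → t = 1) (h₂ : ∀ s, (s, 1) ∈ W → s = 1) :
    ∃ e : S ≃* T, ∀ s, (s, e s) ∈ W := by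
  choose F hF using hS
  have huniq {s t t'} (h : (s, t) ∈ W) (h' : (s, t') ∈ W) : t = t' := by
    have := W.mul_mem (W.inv_mem h) h'
    simp only [Prod.inv_mk, Prod.mk_mul_mk, inv_mul_cancel] at this
    exact inv_mul_eq_one.1 (h₁ _ this)
  have huniq' {s s' t} (h : (s, t) ∈ W) (h' : (s', t) ∈ W) : s = s' := by
    have := W.mul_mem (W.inv_mem h) h'
    simp only [Prod.inv_mk, Prod.mk_mul_mk, inv_mul_cancel] at this
    exact inv_mul_eq_one.1 (h₂ _ this)
  let e : S →* T :=
    { toFun := F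
      map_one' := huniq (hF 1) W.one_mem
      map_mul' := fun a b => huniq (hF _) (W.mul_mem (hF a) (hF b)) }
  refine ⟨MulEquiv.ofBijective e ⟨fun a b hab => ?_, fun t => ?_⟩, hF⟩
  · have h : F a = F b := hab
    have := hF a
    rw [h] at this
    exact huniq' this (hF b)
  · obtain ⟨s, hs⟩ := hT t
    exact ⟨s, huniq (hF s) hs⟩

namespace GrpSeq

/-- To identify the sequence of a homomorphism `p : B → D` with an exact sequence whose right-hand
group lies in `D`, it is enough to give an isomorphism of the middle groups over `D`. -/
theorem exists_iso_ofHom {B D : Type u} [Group B] [Group D] (p : B →* D) (T : GrpSeq.{u})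
    (hT : T.ShortExact) (ι : T.C →* D) (hι : Function.Injective ι) (e : B ≃* T.B)
    (he : ∀ b, ι (T.proj (e b)) = p b) :
    ∃ E : (ofHom p).Iso T, ∀ c : p.range, ι (E.right c) = c := by
  obtain ⟨hinj, hsurj, hex⟩ := hT
  obtain ⟨r, hr⟩ := exists_mulEquiv_of_subgroup
    ((ι.comp (MonoidHom.snd p.range T.C)).eqLocus
      (p.range.subtype.comp (MonoidHom.fst p.range T.C)))
    (fun c => by
      obtain ⟨_, b, rfl⟩ := c
      exact ⟨T.proj (e b), he b⟩)
    (fun d => by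
      obtain ⟨b', rfl⟩ := hsurj d
      refine ⟨⟨p (e.symm b'), _, rfl⟩, ?_⟩
      change ι (T.proj b') = p (e.symm b')
      rw [← he, e.apply_symm_apply])
    (fun d hd => hι (by rw [map_one]; exact hd))
    (fun c hc => by
      have : ι 1 = (c : D) := hc
      rw [map_one] at this
      exact Subtype.ext this.symm)
  have hker (b : B) : b ∈ p.ker ↔ e b ∈ T.incl.range := by
    rw [hex, MonoidHom.mem_ker, MonoidHom.mem_ker, ← he, ← map_one ι, hι.eq_iff]
  obtain ⟨l, hl⟩ := exists_mulEquiv_of_subgroup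
    ((T.incl.comp (MonoidHom.snd p.ker T.A)).eqLocus
      ((e.toMonoidHom.comp p.ker.subtype).comp (MonoidHom.fst p.ker T.A)))
    (fun b => (hker b).1 b.2)
    (fun a => by
      refine ⟨⟨e.symm (T.incl a), (hker _).2 ⟨a, (e.apply_symm_apply _).symm⟩⟩, ?_⟩
      exact (e.apply_symm_apply _).symm)
    (fun a ha => hinj (by
      have : T.incl a = e 1 := ha
      rw [this, map_one, map_one]))
    (fun b hb => by
      have : T.incl 1 = e b := hb
      rw [map_one, ← map_one e] at this
      exact Subtype.ext (e.injective this).symm)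
  refine ⟨⟨l, e, r, fun a => (hl a).symm, fun b => hι ?_⟩, hr⟩
  exact (hr ⟨p b, b, rfl⟩).trans (he b).symm

theorem Iso.splits {S : GrpSeq.{u}} {T : GrpSeq.{v}} (E : S.Iso T) (hT : T.Splits) : S.Splits := by
  obtain ⟨s, hs⟩ := hT
  refine ⟨(E.mid.symm.toMonoidHom.comp s).comp E.right.toMonoidHom, MonoidHom.ext fun c => ?_⟩
  refine E.right.injective ?_
  change E.right (S.proj (E.mid.symm (s (E.right c)))) = E.right c
  rw [E.proj_comm, MulEquiv.apply_symm_apply]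
  exact DFunLike.congr_fun hs _

theorem ofHom_splits_of_injective {B D : Type u} [Group B] [Group D] {p : B →* D}
    (hp : Function.Injective p) : (ofHom p).Splits :=
  ⟨(MonoidHom.ofInjective hp).symm.toMonoidHom, MonoidHom.ext fun c =>
    (MonoidHom.ofInjective hp).apply_symm_apply c⟩

end GrpSeq

theorem prodSeq_shortExact (E : Type u) [Group E] (k : Type u) [Field k] :
    (prodSeq E k).ShortExact := by
  refine ⟨fun a b h => (Prod.ext_iff.1 h).1, fun c => ⟨(1, c), rfl⟩, ?_⟩
  ext ⟨a, b⟩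
  constructor
  · rintro ⟨a', h⟩
    exact (Prod.ext_iff.1 h).2.symm
  · intro h
    exact ⟨a, Prod.ext rfl (Eq.symm h)⟩

theorem prodSeq_splits (E : Type u) [Group E] (k : Type u) [Field k] : (prodSeq E k).Splits :=
  ⟨MonoidHom.inr E (k ≃+* k), rfl⟩

/-! ### Restriction and extension of field automorphisms -/

section FieldExtensions

variable {k : Type u} {l : Type u} [Field k] [Field l] [Algebra k l]

theorem exists_autPreserving (σ : l ≃+* l) (α : k ≃+* k)
    (h : ∀ x, σ (algebraMap k l x) = algebraMap k l (α x)) :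
    ∃ σ' : AutPreserving k l, (σ' : l ≃+* l) = σ := by
  refine ⟨⟨σ, ?_⟩, rfl⟩
  change σ '' _ = _
  rw [← Set.range_comp]
  ext y
  constructor
  · rintro ⟨x, rfl⟩
    exact ⟨α x, (h x).symm⟩
  · rintro ⟨x, rfl⟩
    exact ⟨α.symm x, by rw [Function.comp_apply, h, RingEquiv.apply_symm_apply]⟩

theorem res_eq_of_forall {σ : AutPreserving k l} {α : k ≃+* k}
    (h : ∀ x, (σ : l ≃+* l) (algebraMap k l x) = algebraMap k l (α x)) :
    AutPreserving.res k l σ = α :=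
  RingEquiv.ext fun x => (algebraMap k l).injective <| by
    rw [AutPreserving.algebraMap_res, h]

theorem toExtending_surjective : Function.Surjective (AutPreserving.toExtending k l) := by
  rintro ⟨α, σ, hσ⟩
  obtain ⟨σ', rfl⟩ := exists_autPreserving σ α hσ
  exact ⟨σ', Subtype.ext (res_eq_of_forall hσ)⟩

theorem galSeq_shortExact : (galSeq k l).ShortExact := by
  refine ⟨galToAutPreserving_injective, toExtending_surjective, ?_⟩
  ext σ
  constructor
  · rintro ⟨τ, rfl⟩
    exact Subtype.ext (res_galToAutPreserving τ)
  · intro h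
    exact exists_gal_of_res_eq_one (congrArg Subtype.val h)

theorem trivSeq_shortExact
    (h : ∀ σ : AutPreserving k l, AutPreserving.res k l σ = 1 → σ = 1) :
    (trivSeq k l).ShortExact := by
  refine ⟨fun a b _ => rfl, toExtending_surjective, ?_⟩
  ext σ
  constructor
  · rintro ⟨a, rfl⟩
    exact (map_one _)
  · intro h'
    exact ⟨PUnit.unit, (h σ (congrArg Subtype.val h')).symm⟩

theorem IsSepClosure.exists_ringEquiv {K K' : Type*} [Field K] [Field K'] [Algebra l K]
    [Algebra l K'] [IsSepClosure l K] [IsSepClosure l K'] :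
    ∃ σ : K ≃+* K', ∀ x, σ (algebraMap l K x) = algebraMap l K' x :=
  ⟨IsSepClosure.equiv l K K', (IsSepClosure.equiv l K K').commutes⟩

/-- Automorphisms of a subextension of a separable closure extend to the separable closure: they
provide two ways of regarding it as a separable closure of the subextension. -/
theorem exists_extension {K : Type u} [Field K] [Algebra k K] [IsSepClosure k K]
    (i : l →ₐ[k] K) (ρ : l ≃+* l) : ∃ σ : K ≃+* K, ∀ x, σ (i x) = i (ρ x) := by
  have hc : IsSepClosed K := IsSepClosure.sep_closed k
  have hs : Algebra.IsSeparable k K := IsSepClosure.separable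
  let a₁ : Algebra l K := i.toRingHom.toAlgebra
  let a₂ : Algebra l K := (i.toRingHom.comp (ρ : l →+* l)).toAlgebra
  have : @IsScalarTower k l K _ a₁.toSMul _ :=
    @IsScalarTower.of_algebraMap_eq k l K _ _ _ _ a₁ _ fun x => (i.commutes x).symm
  have h₁ : @Algebra.IsSeparable l K _ _ a₁ :=
    letI := a₁
    Algebra.isSeparable_tower_top_of_isSeparable k l K
  have h₂ : @Algebra.IsSeparable l K _ _ a₂ :=
    @Algebra.IsSeparable.of_equiv_equiv l K l K _ _ _ _ a₁ a₂ ρ.symm (RingEquiv.refl K)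
      (RingHom.ext fun x => congrArg i (ρ.apply_symm_apply x)) h₁
  exact @IsSepClosure.exists_ringEquiv l _ K K _ _ a₁ a₂
    (@IsSepClosure.mk l _ K _ a₁ hc h₁) (@IsSepClosure.mk l _ K _ a₂ hc h₂)

end FieldExtensions

/-! ### Subgroups of `S₃` and their complements -/

/-- A subgroup `H` of `A` which complements the subgroup `C` relative to a subgroup `D` of `C`. Here
`A` is the automorphism group of a root datum, `C` the image of the cocycle `c`, and `D` the image of
the subgroup of the Galois group fixing a subextension `E`. Among the automorphisms of the separable
closure lying under a given semilinear automorphism, `H` singles out those which preserve `E` and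
have the right restriction to `E`. -/
structure IsTwistComplement {A : Type*} [Group A] (C D H : Subgroup A) : Prop where
  /-- The subgroup `D` contains no nontrivial normal subgroup of `C`. Hence an automorphism of the
  Galois group preserving the subgroup of `E` also preserves the kernel of `c`. -/
  core : ∀ x ∈ C, (∀ y ∈ C, y * x * y⁻¹ ∈ D) → x = 1
  /-- Every element of the normalizer of `C` can be moved by `C` into `H`, and even to an element
  normalizing `D`. -/
  exists_mul_mem : ∀ a, (∀ x, x ∈ C ↔ a * x * a⁻¹ ∈ C) →
    ∃ x ∈ C, a * x ∈ H ∧ ∀ d ∈ C, d ∈ D ↔ (a * x) * d * (a * x)⁻¹ ∈ D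
  /-- Every automorphism of `C` preserving `D` is, up to conjugation by an element of `D`,
  conjugation by an element of `H`. -/
  exists_conj : ∀ θ : C ≃* C, (∀ d : C, (d : A) ∈ D ↔ (θ d : A) ∈ D) →
    ∃ d : C, (d : A) ∈ D ∧ ∃ h ∈ H, ∀ x : C, h * x * h⁻¹ = θ (d * x * d⁻¹)
  /-- The elements of `C` lying in `H` belong to `D`. -/
  inf_le : ∀ h ∈ H, h ∈ C → h ∈ D
  /-- An element of `H` and an element of `D` which act in the same way on `C` are equal. -/
  eq_of_conj : ∀ d ∈ D, ∀ h ∈ H, (∀ x ∈ C, h * x * h⁻¹ = d * x * d⁻¹) → h = d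

section Permutations

variable {A : Type*} [Group A]

theorem mem_zpowers_iff_of_sq_eq_one {s : A} (hs : s ^ 2 = 1) {x : A} :
    x ∈ Subgroup.zpowers s ↔ x = 1 ∨ x = s := by
  constructor
  · rintro ⟨n, rfl⟩
    have hs' : s ^ (2 : ℤ) = 1 := by exact_mod_cast hs
    obtain ⟨m, rfl | rfl⟩ := Int.even_or_odd' n
    · exact Or.inl (by simp [zpow_mul, hs'])
    · exact Or.inr (by simp [zpow_add, zpow_mul, hs'])
  · rintro (rfl | rfl)
    exacts [one_mem _, Subgroup.mem_zpowers _]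

theorem exists_generator {C : Subgroup A} {p : ℕ} [Fact p.Prime] (hC : Nat.card C = p) :
    ∃ r : A, r ≠ 1 ∧ r ^ p = 1 ∧ ∀ x, x ∈ C ↔ ∃ n : ℕ, n < p ∧ x = r ^ n := by
  have hfin : Finite C := Nat.finite_of_card_ne_zero (hC ▸ (Fact.out : p.Prime).ne_zero)
  have : Nontrivial C := (Finite.one_lt_card_iff_nontrivial).1 (hC ▸ (Fact.out : p.Prime).one_lt)
  obtain ⟨r, hr⟩ := exists_ne (1 : C)
  have ho : orderOf (r : A) = p := by
    rw [Subgroup.orderOf_coe]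
    exact orderOf_eq_prime (hC ▸ pow_card_eq_one') hr
  refine ⟨r, fun h => hr (Subtype.ext h), ho ▸ pow_orderOf_eq_one _, fun x => ⟨fun hx => ?_, ?_⟩⟩
  · have hz := zpowers_eq_top_of_prime_card hC hr
    have : (⟨x, hx⟩ : C) ∈ Subgroup.zpowers r := hz ▸ Subgroup.mem_top _
    rw [← mem_powers_iff_mem_zpowers] at this
    obtain ⟨n, hn⟩ := this
    refine ⟨n % p, Nat.mod_lt _ (Fact.out : p.Prime).pos, ?_⟩
    have hn' : (r : A) ^ n = x := congrArg Subtype.val hn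
    rw [← ho, pow_mod_orderOf, hn']
  · rintro ⟨n, -, rfl⟩
    exact C.pow_mem r.2 n

theorem exists_involution_of_card_two {C : Subgroup A} (hC : Nat.card C = 2) :
    ∃ r : A, r ≠ 1 ∧ r ^ 2 = 1 ∧ ∀ x, x ∈ C ↔ x = 1 ∨ x = r := by
  obtain ⟨r, hr, hr2, hmem⟩ := exists_generator hC
  refine ⟨r, hr, hr2, fun x => (hmem x).trans ⟨?_, ?_⟩⟩
  · rintro ⟨n, hn, rfl⟩
    interval_cases n <;> simp
  · rintro (rfl | rfl)
    · exact ⟨0, by simp, by simp⟩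
    · exact ⟨1, by simp, by simp⟩

/-- A subgroup of order two of `S₃` is its own normalizer. -/
theorem isTwistComplement_of_card_two {j : A →* Equiv.Perm (Fin 3)} (hj : Function.Injective j)
    {C : Subgroup A} (hC : Nat.card C = 2) : IsTwistComplement C ⊥ ⊥ := by
  obtain ⟨r, hr, hr2, hmem'⟩ := exists_involution_of_card_two hC
  have hS3 : ∀ a r : Equiv.Perm (Fin 3), r ≠ 1 ∧ r ^ 2 = 1 ∧ a * r * a⁻¹ = r → a = 1 ∨ a = r := by
    decide
  have hrC : r ∈ C := (hmem' r).2 (Or.inr rfl)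
  refine ⟨fun x _ h => by simpa using h 1 C.one_mem, fun a ha => ?_, fun θ hθ => ?_,
    fun h hh _ => hh, ?_⟩
  · have har : a * r * a⁻¹ = r := by
      refine ((hmem' _).1 ((ha r).1 hrC)).resolve_left fun h => hr ?_
      rwa [conj_eq_one_iff] at h
    have haC : a ∈ C := (hmem' a).2 <| by
      have := hS3 (j a) (j r) ⟨fun h => hr (hj (h.trans j.map_one.symm)),
        by rw [← map_pow, hr2, map_one], by rw [← map_inv, ← map_mul, ← map_mul, har]⟩
      rwa [← map_one j, hj.eq_iff, hj.eq_iff] at this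
    exact ⟨a⁻¹, C.inv_mem haC, by simp, by simp⟩
  · refine ⟨1, rfl, 1, rfl, fun x => ?_⟩
    have hθr : (θ ⟨r, hrC⟩ : A) = r := by
      refine ((hmem' _).1 (θ ⟨r, hrC⟩).2).resolve_left fun h => hr ?_
      have : θ ⟨r, hrC⟩ = 1 := Subtype.ext h
      rw [map_eq_one_iff _ θ.injective] at this
      exact congrArg Subtype.val this
    obtain ⟨x, hx⟩ := x
    rcases (hmem' x).1 hx with rfl | rfl
    · have : (⟨1, hx⟩ : C) = 1 := rfl
      simp [this]
    · simp [hθr]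
  · rintro d rfl h rfl _
    rfl

/-- A complement of the subgroup of order three in `S₃` realizes its nontrivial automorphism. -/
theorem isTwistComplement_of_card_three {j : A →* Equiv.Perm (Fin 3)} (hj : Function.Injective j)
    {C : Subgroup A} (hC : Nat.card C = 3)
    (hA : ∀ r : A, r ^ 3 = 1 → r ≠ 1 → ∃ s : A, s ≠ 1 ∧ s ^ 2 = 1) :
    ∃ H, IsTwistComplement C ⊥ H := by
  obtain ⟨r, hr, hr3, hmem⟩ := exists_generator hC
  obtain ⟨s, hs, hs2⟩ := hA r hr3 hr
  have hjr : j r ≠ 1 := fun h => hr (hj (h.trans j.map_one.symm))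
  have hjs : j s ≠ 1 := fun h => hs (hj (h.trans j.map_one.symm))
  have hjr3 : j r ^ 3 = 1 := by rw [← map_pow, hr3, map_one]
  have hjs2 : j s ^ 2 = 1 := by rw [← map_pow, hs2, map_one]
  have hrC : r ∈ C := (hmem r).2 ⟨1, by simp, by simp⟩
  have hH (h : A) : h ∈ Subgroup.zpowers s ↔ h = 1 ∨ h = s := mem_zpowers_iff_of_sq_eq_one hs2
  refine ⟨Subgroup.zpowers s, fun x _ h => by simpa using h 1 C.one_mem, fun a _ => ?_,
    fun θ hθ => ?_, fun h hh hC => ?_, ?_⟩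
  · have hS3 : ∀ a r s : Equiv.Perm (Fin 3), r ≠ 1 → r ^ 3 = 1 → s ≠ 1 → s ^ 2 = 1 →
      ∃ n < 3, a * r ^ n = 1 ∨ a * r ^ n = s := by decide
    obtain ⟨n, hn, h⟩ := hS3 (j a) (j r) (j s) hjr hjr3 hjs hjs2
    rw [← map_one j, ← map_pow, ← map_mul, hj.eq_iff, hj.eq_iff] at h
    exact ⟨r ^ n, C.pow_mem hrC n, (hH _).2 h, fun d _ => conj_eq_one_iff.symm⟩
  · have hS3 : ∀ r s : Equiv.Perm (Fin 3), r ≠ 1 → r ^ 3 = 1 → s ≠ 1 → s ^ 2 = 1 →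
      s * r * s⁻¹ = r ^ 2 := by decide
    have hsr : s * r * s⁻¹ = r ^ 2 := hj (by simpa using hS3 (j r) (j s) hjr hjr3 hjs hjs2)
    have key (h : A) (hθr : h * r * h⁻¹ = θ ⟨r, hrC⟩) (x : C) : h * x * h⁻¹ = θ x := by
      obtain ⟨x, hx⟩ := x
      obtain ⟨n, -, rfl⟩ := (hmem x).1 hx
      have : (⟨r ^ n, hx⟩ : C) = ⟨r, hrC⟩ ^ n := rfl
      rw [this, map_pow, Subgroup.coe_pow, Subgroup.coe_pow, ← hθr, conj_pow]
    obtain ⟨n, hn, hθr⟩ := (hmem _).1 (θ ⟨r, hrC⟩).2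
    refine ⟨1, rfl, ?_⟩
    suffices ∃ h ∈ Subgroup.zpowers s, h * r * h⁻¹ = θ ⟨r, hrC⟩ by
      obtain ⟨h, hh, h'⟩ := this
      exact ⟨h, hh, fun x => by simpa using key h h' x⟩
    interval_cases n
    · refine absurd ?_ hr
      have : θ ⟨r, hrC⟩ = 1 := Subtype.ext (by simpa using hθr)
      rw [map_eq_one_iff _ θ.injective] at this
      exact congrArg Subtype.val this
    · exact ⟨1, one_mem _, by simpa using hθr.symm⟩
    · exact ⟨s, Subgroup.mem_zpowers s, by rw [hsr, hθr]⟩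
  · have hS3 : ∀ r s : Equiv.Perm (Fin 3), r ^ 3 = 1 → s ≠ 1 → s ^ 2 = 1 →
      ∀ n < 3, s ≠ r ^ n := by decide
    refine ((hH h).1 hh).resolve_right ?_
    rintro rfl
    obtain ⟨n, hn, h⟩ := (hmem _).1 hC
    exact hS3 (j r) (j _) hjr3 hjs hjs2 n hn (by rw [h, map_pow])
  · have hS3 : ∀ r s : Equiv.Perm (Fin 3), r ≠ 1 → r ^ 3 = 1 → s ≠ 1 → s ^ 2 = 1 →
      s * r * s⁻¹ ≠ r := by decide
    rintro d rfl h hh hx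
    refine ((hH h).1 hh).resolve_right ?_
    rintro rfl
    refine hS3 (j r) (j _) hjr hjr3 hjs hjs2 ?_
    rw [← map_inv, ← map_mul, ← map_mul, hx r hrC]
    simp

/-- An automorphism of `S₃` which fixes a transposition `t` is conjugation by `1` or `t`. -/
theorem isTwistComplement_of_card_six {j : A →* Equiv.Perm (Fin 3)} (hj : Function.Bijective j)
    {D : Subgroup A} (hD : Nat.card D = 2) : IsTwistComplement ⊤ D ⊥ := by
  obtain ⟨t, ht, ht2, hmem⟩ := exists_involution_of_card_two hD
  have hjt : j t ≠ 1 := fun h => ht (hj.1 (h.trans j.map_one.symm))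
  have hjt2 : j t ^ 2 = 1 := by rw [← map_pow, ht2, map_one]
  refine ⟨fun x _ h => ?_, fun a _ => ⟨a⁻¹, trivial, by simp, by simp⟩, fun θ hθ => ?_,
    fun h hh _ => ?_, ?_⟩
  · have hS3 : ∀ x t : Equiv.Perm (Fin 3), t ^ 2 = 1 →
      (∀ y, y * x * y⁻¹ = 1 ∨ y * x * y⁻¹ = t) → x = 1 := by decide
    refine hj.1 ((hS3 (j x) (j t) hjt2 fun y => ?_).trans j.map_one.symm)
    obtain ⟨y, rfl⟩ := hj.2 y
    rw [← map_inv, ← map_mul, ← map_mul, ← map_one j, hj.1.eq_iff, hj.1.eq_iff]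
    exact (hmem _).1 (h y trivial)
  · obtain ⟨r, hr⟩ := hj.2 (finRotate 3)
    have hgen (x : A) : ∃ n : ℕ, ∃ m : ℕ, x = r ^ n * t ^ m := by
      have hS3 : ∀ t x : Equiv.Perm (Fin 3), t ≠ 1 → t ^ 2 = 1 →
        ∃ n < 3, ∃ m < 2, x = finRotate 3 ^ n * t ^ m := by decide
      obtain ⟨n, -, m, -, h⟩ := hS3 (j t) (j x) hjt hjt2
      exact ⟨n, m, hj.1 (by simpa [hr] using h)⟩
    have hr3 : r ^ 3 = 1 := hj.1 (by rw [map_pow, hr, map_one]; decide)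
    have hr1 : r ≠ 1 := fun h => by
      rw [h, map_one] at hr
      exact absurd hr (by decide)
    have htr : t * r * t⁻¹ = r ^ 2 := by
      have hS3 : ∀ t : Equiv.Perm (Fin 3), t ≠ 1 → t ^ 2 = 1 →
        t * finRotate 3 * t⁻¹ = finRotate 3 ^ 2 := by decide
      exact hj.1 (by simpa [hr] using hS3 (j t) hjt hjt2)
    let θ' : A ≃* A := (Subgroup.topEquiv.symm.trans θ).trans Subgroup.topEquiv
    have hθ' (x : (⊤ : Subgroup A)) : (θ x : A) = θ' x := rfl
    have hθt : θ' t = t := by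
      have := (hmem _).1 ((hθ ⟨t, trivial⟩).1 ((hmem t).2 (Or.inr rfl)))
      refine this.resolve_left fun h => ht ?_
      exact (map_eq_one_iff θ' θ'.injective).1 h
    have hθr : θ' r = r ∨ θ' r = r ^ 2 := by
      have hS3 : ∀ x : Equiv.Perm (Fin 3), x ≠ 1 → x ^ 3 = 1 →
        x = finRotate 3 ∨ x = finRotate 3 ^ 2 := by decide
      have := hS3 (j (θ' r))
        (fun h => hr1 ((map_eq_one_iff θ' θ'.injective).1 (hj.1 (h.trans j.map_one.symm))))
        (by rw [← map_pow, ← map_pow, hr3, map_one, map_one])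
      rwa [← hr, ← map_pow, hj.1.eq_iff, hj.1.eq_iff] at this
    have key (d : A) (h₁ : θ' (d * r * d⁻¹) = r) (h₂ : θ' (d * t * d⁻¹) = t) (x : A) :
        θ' (d * x * d⁻¹) = x := by
      obtain ⟨n, m, rfl⟩ := hgen x
      rw [← conj_mul, ← conj_pow, ← conj_pow, map_mul, map_pow, map_pow, h₁, h₂]
    suffices ∃ d ∈ D, θ' (d * r * d⁻¹) = r ∧ θ' (d * t * d⁻¹) = t by
      obtain ⟨d, hd, h₁, h₂⟩ := this
      refine ⟨⟨d, trivial⟩, hd, 1, rfl, fun x => ?_⟩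
      rw [hθ']
      simpa using (key d h₁ h₂ x).symm
    rcases hθr with h | h
    · exact ⟨1, D.one_mem, by simpa using h, by simpa using hθt⟩
    · refine ⟨t, (hmem t).2 (Or.inr rfl), ?_, by simpa using hθt⟩
      rw [htr, map_pow, h, ← pow_mul, pow_succ, hr3, one_mul]
  · rw [Subgroup.mem_bot.1 hh]
    exact D.one_mem
  · have hS3 : ∀ t : Equiv.Perm (Fin 3), t ≠ 1 → t * finRotate 3 * t⁻¹ ≠ finRotate 3 ∨
      t * Equiv.swap 0 1 * t⁻¹ ≠ Equiv.swap 0 1 := by decide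
    rintro d hd h rfl hx
    refine (((hmem d).1 hd).resolve_right ?_).symm
    rintro rfl
    have hc (y : Equiv.Perm (Fin 3)) : j d * y * (j d)⁻¹ = y := by
      obtain ⟨y, rfl⟩ := hj.2 y
      rw [← map_inv, ← map_mul, ← map_mul, ← hx y trivial]
      simp
    exact (hS3 (j d) hjt).elim (· (hc _)) (· (hc _))

end Permutations

/-! ### Semilinear automorphisms and automorphisms of subextensions -/

section Restriction

variable {k K E : Type u} [Field k] [Field K] [Algebra k K] [Field E] [Algebra k E]

theorem exists_conj_mulEquiv (σ : AutPreserving k K) : ∃ γ : (K ≃ₐ[k] K) ≃* (K ≃ₐ[k] K),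
    ∀ τ, galToAutPreserving k K (γ τ) = σ * galToAutPreserving k K τ * σ⁻¹ := by
  obtain ⟨γ, hγ⟩ := exists_mulEquiv_of_subgroup
    (((galToAutPreserving k K).comp (MonoidHom.snd (K ≃ₐ[k] K) (K ≃ₐ[k] K))).eqLocus
      (((MulAut.conj σ).toMonoidHom.comp (galToAutPreserving k K)).comp
        (MonoidHom.fst (K ≃ₐ[k] K) (K ≃ₐ[k] K))))
    (fun τ => exists_gal_conj σ τ)
    (fun τ' => by
      obtain ⟨τ, hτ⟩ := exists_gal_conj σ⁻¹ τ'
      refine ⟨τ, ?_⟩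
      change galToAutPreserving k K τ' = σ * galToAutPreserving k K τ * σ⁻¹
      rw [hτ]
      group)
    (fun τ' h => galToAutPreserving_injective <| by
      have : galToAutPreserving k K τ' = σ * galToAutPreserving k K 1 * σ⁻¹ := h
      rw [this, map_one, mul_one, mul_inv_cancel])
    (fun τ h => galToAutPreserving_injective <| by
      have : galToAutPreserving k K 1 = σ * galToAutPreserving k K τ * σ⁻¹ := h
      rw [map_one, eq_comm, conj_eq_one_iff] at this
      rw [this, map_one])
  exact ⟨γ, hγ⟩

theorem mem_twistedPairs_iff {A : Type*} [Group A] {c : (K ≃ₐ[k] K) →* A} {σ : AutPreserving k K}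
    {a : A} {γ : (K ≃ₐ[k] K) ≃* (K ≃ₐ[k] K)}
    (hγ : ∀ τ, galToAutPreserving k K (γ τ) = σ * galToAutPreserving k K τ * σ⁻¹) :
    (σ, a) ∈ twistedPairs c ↔ ∀ τ, a * c τ * a⁻¹ = c (γ τ) := by
  refine ⟨fun h τ => h τ _ (hγ τ), fun h τ τ' hτ => ?_⟩
  rw [h, galToAutPreserving_injective ((hγ τ).trans hτ.symm)]

/-- An automorphism of a Galois extension preserves a subextension if and only if conjugation by it
preserves the corresponding subgroup of the Galois group. -/
theorem exists_restriction_iff [IsGalois k K] (i : E →ₐ[k] K) {σ : AutPreserving k K}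
    {γ : (K ≃ₐ[k] K) ≃* (K ≃ₐ[k] K)}
    (hγ : ∀ τ, galToAutPreserving k K (γ τ) = σ * galToAutPreserving k K τ * σ⁻¹) :
    (∃ ρ : E ≃+* E, ∀ x, (σ : K ≃+* K) (i x) = i (ρ x)) ↔
      ∀ τ, τ ∈ i.fieldRange.fixingSubgroup ↔ γ τ ∈ i.fieldRange.fixingSubgroup := by
  have hi : Function.Injective i := i.toRingHom.injective
  have hmem (τ : K ≃ₐ[k] K) : τ ∈ i.fieldRange.fixingSubgroup ↔ ∀ x, τ (i x) = i x := by
    rw [IntermediateField.mem_fixingSubgroup_iff]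
    exact ⟨fun h x => h _ ⟨x, rfl⟩, by rintro h _ ⟨x, rfl⟩; exact h x⟩
  have hγσ (τ : K ≃ₐ[k] K) (x : K) : γ τ ((σ : K ≃+* K) x) = (σ : K ≃+* K) (τ x) := by
    have : galToAutPreserving k K (γ τ) * σ = σ * galToAutPreserving k K τ := by
      rw [hγ, inv_mul_cancel_right]
    exact RingEquiv.congr_fun (congrArg Subtype.val this) x
  constructor
  · rintro ⟨ρ, hρ⟩ τ
    rw [hmem, hmem]
    refine Iff.trans (forall_congr' fun x => ?_) ρ.surjective.forall.symm
    rw [← hρ, hγσ, (σ : K ≃+* K).injective.eq_iff]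
  · intro h
    have hrange (y : K) : (∃ x, i x = y) ↔ ∀ τ ∈ i.fieldRange.fixingSubgroup, τ y = y := by
      have := InfiniteGalois.fixedField_fixingSubgroup i.fieldRange
      rw [← AlgHom.mem_fieldRange, ← this, IntermediateField.mem_fixedField_iff, this]
    have hσ (y : K) : (∃ x, i x = (σ : K ≃+* K) y) ↔ ∃ x, i x = y := by
      rw [hrange, hrange, γ.surjective.forall]
      refine forall_congr' fun τ => ?_
      rw [← h, hγσ, (σ : K ≃+* K).injective.eq_iff]
    choose F hF using fun x => (hσ (i x)).2 ⟨x, rfl⟩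
    refine ⟨RingEquiv.ofBijective (RingHom.mk' ⟨⟨F, hi ?_⟩, fun x y => hi ?_⟩
      fun x y => hi ?_) ⟨RingHom.injective _, fun y => ?_⟩, fun x => (hF x).symm⟩
    · rw [hF, map_one, map_one]
    · simp only [map_mul, hF]
    · change i (F (x + y)) = i (F x + F y)
      simp only [map_add, hF]
    · obtain ⟨z, hz⟩ := (σ : K ≃+* K).surjective (i y)
      obtain ⟨x, rfl⟩ := (hσ z).1 ⟨y, hz.symm⟩
      exact ⟨x, hi ((hF x).trans hz)⟩

end Restriction

namespace SplittingOver

variable {k K : Type u} [Field k] [Field K] [Algebra k K] [IsSepClosure k K]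
  {𝓡 : PreBasedRootDatumScheme k} {R : BasedRootDatum.{u}} (f : SplittingOver 𝓡 R K)

theorem _root_.exists_autPreserving_res_eq (α : k ≃+* k) :
    ∃ σ : AutPreserving k K, AutPreserving.res k K σ = α := by
  obtain ⟨σ, hσ⟩ := exists_extension (Algebra.ofId k K) α
  obtain ⟨σ, rfl⟩ := exists_autPreserving σ α hσ
  exact ⟨σ, res_eq_of_forall hσ⟩

/-- Every semilinear automorphism lies over some automorphism of the separable closure. -/
theorem exists_lift (hR : R.IsSemisimple) (p : semilinearAut 𝓡) :
    ∃ (σ : AutPreserving k K) (φ : R.Aut), f.Induces p σ φ := by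
  obtain ⟨σ, hσ⟩ := exists_autPreserving_res_eq (K := K) p.1.1
  exact ⟨σ, f.exists_induces hR p σ hσ⟩

/-- If the field `E` corresponds to a subgroup of the Galois group which contains the kernel of the
cocycle and whose image `D` under the cocycle is part of an `IsTwistComplement`, then
semilinear automorphisms are the same thing as automorphisms of `E` preserving `k`: they correspond
to each other if they are restrictions of the same automorphism of the separable closure which
preserves `E` and induces an element of `H` on the root datum. -/
theorem exists_mulEquiv_autPreserving [IsGalois k K] (hR : R.IsSemisimple)
    {E : Type u} [Field E] [Algebra k E] (i : E →ₐ[k] K) {H : Subgroup R.Aut}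
    (hker : (f.cocycle hR).ker ≤ i.fieldRange.fixingSubgroup)
    (hT : IsTwistComplement (f.cocycle hR).range
      (i.fieldRange.fixingSubgroup.map (f.cocycle hR)) H) :
    ∃ e : semilinearAut 𝓡 ≃* AutPreserving k E,
      ∀ p, AutPreserving.res k E (e p) = p.1.1 := by
  set c := f.cocycle hR with hc
  set N := i.fieldRange.fixingSubgroup with hN
  have hi : Function.Injective i := i.toRingHom.injective
  have hmem (τ : K ≃ₐ[k] K) : τ ∈ N ↔ ∀ x, τ (i x) = i x := by
    rw [hN, IntermediateField.mem_fixingSubgroup_iff]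
    exact ⟨fun h x => h _ ⟨x, rfl⟩, by rintro h _ ⟨x, rfl⟩; exact h x⟩
  have hmem' (τ : K ≃ₐ[k] K) : c τ ∈ N.map c ↔ τ ∈ N := by
    rw [← Subgroup.mem_comap, Subgroup.comap_map_eq, sup_eq_left.2 hker]
  -- restrictions to `E` restrict further to `k`
  have hres {σ : AutPreserving k K} {ρ : E ≃+* E} (h : ∀ x, (σ : K ≃+* K) (i x) = i (ρ x)) (x : k) :
      ρ (algebraMap k E x) = algebraMap k E (AutPreserving.res k K σ x) := by
    refine hi ?_
    rw [← h, i.commutes, i.commutes, AutPreserving.algebraMap_res]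
  let W : Subgroup (semilinearAut 𝓡 × AutPreserving k E) :=
    { carrier := {q | ∃ σ : AutPreserving k K, ∃ h ∈ H, f.Induces q.1 σ h ∧
        ∀ x, (σ : K ≃+* K) (i x) = i ((q.2 : E ≃+* E) x)}
      one_mem' := ⟨1, 1, H.one_mem, Induces.one f, fun _ => rfl⟩
      mul_mem' := by
        rintro q q' ⟨σ, h, hh, hI, hσ⟩ ⟨σ', h', hh', hI', hσ'⟩
        refine ⟨σ * σ', h * h', H.mul_mem hh hh', hI.mul hI', fun x => ?_⟩
        change (σ : K ≃+* K) ((σ' : K ≃+* K) (i x)) = i ((q.2 : E ≃+* E) ((q'.2 : E ≃+* E) x))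
        rw [hσ', hσ]
      inv_mem' := by
        rintro q ⟨σ, h, hh, hI, hσ⟩
        refine ⟨σ⁻¹, h⁻¹, H.inv_mem hh, ?_, fun x => ?_⟩
        · exact hI.inv hR
        · change (σ : K ≃+* K).symm (i x) = i ((q.2 : E ≃+* E).symm x)
          rw [RingEquiv.symm_apply_eq, hσ, RingEquiv.apply_symm_apply] }
  have hW {p : semilinearAut 𝓡} {ρ : AutPreserving k E} : (p, ρ) ∈ W ↔
      ∃ σ : AutPreserving k K, ∃ h ∈ H, f.Induces p σ h ∧
        ∀ x, (σ : K ≃+* K) (i x) = i ((ρ : E ≃+* E) x) := Iff.rfl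
  suffices ∃ e : semilinearAut 𝓡 ≃* AutPreserving k E, ∀ p, (p, e p) ∈ W by
    obtain ⟨e, he⟩ := this
    refine ⟨e, fun p => ?_⟩
    obtain ⟨σ, h, -, hI, hσ⟩ := hW.1 (he p)
    rw [← hI.res]
    exact res_eq_of_forall (hres hσ)
  refine exists_mulEquiv_of_subgroup W ?_ ?_ ?_ ?_
  · intro p
    obtain ⟨σ, φ, hI⟩ := f.exists_lift hR p
    obtain ⟨γ, hγ⟩ := exists_conj_mulEquiv σ
    have hφ := (mem_twistedPairs_iff hγ).1 (hI.mem_twistedPairs hR)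
    obtain ⟨_, ⟨τ, rfl⟩, hH, hD⟩ := hT.exists_mul_mem φ fun x => by
      constructor
      · rintro ⟨τ, rfl⟩
        exact ⟨γ τ, (hφ τ).symm⟩
      · rintro ⟨τ, hτ⟩
        refine ⟨γ.symm τ, ?_⟩
        have h₁ := hφ (γ.symm τ)
        rw [γ.apply_symm_apply, ← hc, hτ] at h₁
        exact mul_left_cancel (mul_right_cancel h₁)
    -- the lift `σ` is corrected by an element of the Galois group
    have hI' := hI.mul (f.induces_cocycle hR τ)
    rw [mul_one] at hI'
    obtain ⟨γ', hγ'⟩ := exists_conj_mulEquiv (σ * galToAutPreserving k K τ)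
    have hφ' := (mem_twistedPairs_iff hγ').1 (hI'.mem_twistedPairs hR)
    obtain ⟨ρ, hρ⟩ := (exists_restriction_iff i hγ').2 fun τ' => by
      rw [← hN, ← hmem', hD _ ⟨τ', rfl⟩, ← hmem' (γ' τ')]
      exact Iff.of_eq (congrArg (· ∈ N.map c) (hφ' τ'))
    obtain ⟨ρ, rfl⟩ := exists_autPreserving ρ _ (hres hρ)
    exact ⟨ρ, hW.2 ⟨_, _, hH, hI', hρ⟩⟩
  · intro ρ
    obtain ⟨σ, hσ⟩ := exists_extension i (ρ : E ≃+* E)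
    obtain ⟨σ, rfl⟩ := exists_autPreserving σ (AutPreserving.res k E ρ) fun x => by
      rw [← i.commutes, hσ, ← AutPreserving.algebraMap_res, i.commutes]
    obtain ⟨γ, hγ⟩ := exists_conj_mulEquiv σ
    have hγN := (exists_restriction_iff i hγ).1 ⟨_, hσ⟩
    rw [← hN] at hγN
    -- conjugation by `σ` preserves the kernel of the cocycle, the core of `N`
    have hcore (τ : K ≃ₐ[k] K) : c τ = 1 ↔ ∀ τ', τ' * τ * τ'⁻¹ ∈ N := by
      constructor
      · intro h τ'
        rw [← hmem', map_mul, map_mul, h, mul_one, ← map_mul, mul_inv_cancel, map_one]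
        exact one_mem _
      · intro h
        refine hT.core _ ⟨τ, rfl⟩ ?_
        rintro _ ⟨τ', rfl⟩
        rw [← map_inv, ← map_mul, ← map_mul, hmem']
        exact h τ'
    have hγc (τ : K ≃ₐ[k] K) : c τ = 1 ↔ c (γ τ) = 1 := by
      rw [hcore, hcore]
      refine Iff.trans (forall_congr' fun τ' => ?_) γ.surjective.forall.symm
      rw [hγN, map_mul, map_mul, map_inv]
    obtain ⟨θ, hθ⟩ := exists_mulEquiv_of_subgroup
      (c.rangeRestrict.prod (c.rangeRestrict.comp γ.toMonoidHom)).range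
      (by
        rintro ⟨_, τ, rfl⟩
        exact ⟨_, τ, rfl⟩)
      (by
        rintro ⟨_, τ, rfl⟩
        refine ⟨_, γ.symm τ, Prod.ext rfl (Subtype.ext ?_)⟩
        exact congrArg c (γ.apply_symm_apply τ))
      (by
        rintro t ⟨τ, hτ⟩
        have h₁ : c τ = 1 := congrArg Subtype.val (Prod.ext_iff.1 hτ).1
        have h₂ : c (γ τ) = t := congrArg Subtype.val (Prod.ext_iff.1 hτ).2
        exact Subtype.ext (h₂.symm.trans ((hγc τ).1 h₁)))
      (by
        rintro t ⟨τ, hτ⟩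
        have h₁ : c τ = t := congrArg Subtype.val (Prod.ext_iff.1 hτ).1
        have h₂ : c (γ τ) = 1 := congrArg Subtype.val (Prod.ext_iff.1 hτ).2
        exact Subtype.ext (h₁.symm.trans ((hγc τ).2 h₂)))
    have hθc (τ : K ≃ₐ[k] K) : (θ (c.rangeRestrict τ) : R.Aut) = c (γ τ) := by
      obtain ⟨τ', h'⟩ := hθ (c.rangeRestrict τ)
      have h₁ : c τ' = c τ := congrArg Subtype.val (Prod.ext_iff.1 h').1
      have h₂ : c (γ τ') = θ (c.rangeRestrict τ) := congrArg Subtype.val (Prod.ext_iff.1 h').2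
      rw [← h₂, ← inv_mul_eq_one, ← map_inv, ← map_mul, ← map_inv, ← map_mul, ← hγc, map_mul,
        map_inv, h₁, inv_mul_cancel]
    obtain ⟨⟨_, hd⟩, ⟨δ, hδ, rfl⟩, h, hh, hconj⟩ := hT.exists_conj θ (by
      rintro ⟨_, τ, rfl⟩
      change c τ ∈ _ ↔ (θ (c.rangeRestrict τ) : R.Aut) ∈ _
      rw [hθc, hmem', hmem', hγN])
    have hQ : (σ * galToAutPreserving k K δ, h) ∈ twistedPairs c := by
      intro τ τ' hτ'
      refine (hconj (c.rangeRestrict τ)).trans ?_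
      change (θ (c.rangeRestrict δ * c.rangeRestrict τ * (c.rangeRestrict δ)⁻¹) : R.Aut) = _
      rw [← map_inv, ← map_mul, ← map_mul, hθc]
      refine congrArg c (galToAutPreserving_injective ?_)
      rw [hτ', hγ, map_mul, map_mul, map_inv]
      group
    obtain ⟨p, hp⟩ := exists_semilinear hR hQ
    refine ⟨p, hW.2 ⟨_, h, hh, hp, fun x => ?_⟩⟩
    change (σ : K ≃+* K) (δ (i x)) = _
    rw [(hmem δ).1 hδ, hσ]
  · rintro ρ hρ
    obtain ⟨σ, h, hh, hI, hσ⟩ := hW.1 hρ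
    obtain ⟨τ, rfl⟩ := exists_gal_of_res_eq_one hI.res
    obtain rfl := hI.aut_unique (f.induces_cocycle hR τ)
    have hτ := (hmem τ).1 ((hmem' τ).1 (hT.inf_le _ hh ⟨τ, rfl⟩))
    exact Subtype.ext (RingEquiv.ext fun x => hi ((hσ x).symm.trans (hτ x)))
  · rintro p hp
    obtain ⟨σ, h, hh, hI, hσ⟩ := hW.1 hp
    obtain ⟨τ, rfl⟩ := exists_gal_of_res_eq_one (σ := σ) <| res_eq_of_forall fun x => by
      rw [← i.commutes]
      exact (hσ _).trans (i.commutes x)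
    have hτ : τ ∈ N := (hmem τ).2 hσ
    have : h = c τ := hT.eq_of_conj _ ((hmem' τ).2 hτ) h hh <| by
      rintro _ ⟨τ', rfl⟩
      rw [hI.mem_twistedPairs hR τ' (τ * τ' * τ⁻¹) (by simp only [map_mul, map_inv]), ← hc,
        map_mul, map_mul, map_inv]
    subst this
    exact hI.semilinear_unique (f.induces_cocycle hR τ)

end SplittingOver

/-! ### The exact sequence of a simple scheme of based root datum -/

theorem eq_of_conj_eq_conj_of_bijective {A : Type*} [Group A] {j : A →* Equiv.Perm (Fin 3)}
    (hj : Function.Bijective j) {a b : A} (h : ∀ x, a * x * a⁻¹ = b * x * b⁻¹) : a = b := by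
  have hS3 : ∀ a b : Equiv.Perm (Fin 3), (∀ x, a * x * a⁻¹ = b * x * b⁻¹) → a = b := by decide
  refine hj.1 (hS3 _ _ fun y => ?_)
  obtain ⟨x, rfl⟩ := hj.2 y
  rw [← map_inv, ← map_inv, ← map_mul, ← map_mul, ← map_mul, ← map_mul, h]

namespace SplittingOver

variable {k K : Type u} [Field k] [Field K] [Algebra k K] [IsSepClosure k K]
  {𝓡 : PreBasedRootDatumScheme k} {R : BasedRootDatum.{u}} (f : SplittingOver 𝓡 R K)

/-- The group `Gal(l/k)` of the classifying field has the order of the image of the cocycle. -/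
theorem card_gal_classifyingField (hR : R.IsSemisimple) [Finite R.Aut] :
    Nat.card (f.classifyingField ≃ₐ[k] f.classifyingField) = Nat.card (f.cocycle hR).range := by
  have hl : f.classifyingField.fixingSubgroup = (f.cocycle hR).ker := by
    rw [f.classifyingField_fixingSubgroup, f.cocycle_ker]
  have hn : f.classifyingField.fixingSubgroup.Normal := hl ▸ MonoidHom.normal_ker _
  have hg : IsGalois k f.classifyingField := (InfiniteGalois.normal_iff_isGalois _).1 hn
  have hr : Module.finrank k f.classifyingField = Nat.card (f.cocycle hR).range := by
    rw [IntermediateField.finrank_eq_fixingSubgroup_index, hl, Subgroup.index_ker]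
  have : FiniteDimensional k f.classifyingField :=
    Module.finite_of_finrank_pos (hr ▸ Nat.card_pos)
  rw [IsGalois.card_aut_eq_finrank, hr]

/-- If the cocycle is trivial, a semilinear automorphism amounts to an automorphism of the root
datum together with an automorphism of the base field. -/
theorem exists_mulEquiv_prod (hR : R.IsSemisimple) (hc : ∀ τ, f.cocycle hR τ = 1) :
    ∃ e : semilinearAut 𝓡 ≃* R.Aut × (k ≃+* k), ∀ p, (e p).2 = p.1.1 := by
  let W : Subgroup (semilinearAut 𝓡 × (R.Aut × (k ≃+* k))) :=
    { carrier := {q | q.2.2 = q.1.1.1 ∧ ∃ σ : AutPreserving k K, f.Induces q.1 σ q.2.1}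
      one_mem' := ⟨rfl, 1, Induces.one f⟩
      mul_mem' := by
        rintro q q' ⟨h, σ, hσ⟩ ⟨h', σ', hσ'⟩
        exact ⟨congrArg₂ (· * ·) h h', σ * σ', hσ.mul hσ'⟩
      inv_mem' := by
        rintro q ⟨h, σ, hσ⟩
        exact ⟨congrArg (·⁻¹) h, σ⁻¹, hσ.inv hR⟩ }
  suffices ∃ e : semilinearAut 𝓡 ≃* R.Aut × (k ≃+* k), ∀ p, (p, e p) ∈ W by
    obtain ⟨e, he⟩ := this
    exact ⟨e, fun p => (he p).1⟩
  refine exists_mulEquiv_of_subgroup W ?_ ?_ ?_ ?_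
  · intro p
    obtain ⟨σ, φ, h⟩ := f.exists_lift hR p
    exact ⟨(φ, p.1.1), rfl, σ, h⟩
  · rintro ⟨φ, α⟩
    obtain ⟨σ, rfl⟩ := exists_autPreserving_res_eq (K := K) α
    obtain ⟨p, hp⟩ := exists_semilinear (f := f) hR (σ := σ) (φ := φ) fun τ τ' _ => by
      rw [hc, hc, mul_one, mul_inv_cancel]
    exact ⟨p, hp.res, σ, hp⟩
  · rintro ⟨φ, α⟩ ⟨h, σ, hσ⟩
    obtain ⟨τ, rfl⟩ := exists_gal_of_res_eq_one hσ.res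
    have h' := hσ.aut_unique (f.induces_cocycle hR τ)
    rw [hc] at h'
    exact Prod.ext h' h
  · rintro p ⟨h, σ, hσ⟩
    obtain ⟨τ, rfl⟩ := exists_gal_of_res_eq_one (hσ.res.trans h.symm)
    have h' := f.induces_cocycle hR τ
    rw [hc] at h'
    exact hσ.semilinear_unique h'

/-- If the cocycle is surjective and the automorphism group of the root datum has trivial centre,
there are no nontrivial automorphisms over `k`. -/
theorem semilinearAutToAut_injective (hR : R.IsSemisimple)
    (hc : Function.Surjective (f.cocycle hR))
    (hA : ∀ a b : R.Aut, (∀ x, a * x * a⁻¹ = b * x * b⁻¹) → a = b) :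
    Function.Injective (semilinearAutToAut 𝓡) := by
  rw [injective_iff_map_eq_one]
  intro p hp
  obtain ⟨σ, φ, h⟩ := f.exists_lift hR p
  obtain ⟨τ, rfl⟩ := exists_gal_of_res_eq_one (h.res.trans hp)
  obtain rfl : φ = f.cocycle hR τ := hA _ _ fun x => by
    obtain ⟨τ', rfl⟩ := hc x
    rw [h.mem_twistedPairs hR τ' (τ * τ' * τ⁻¹) (by simp only [map_mul, map_inv]), map_mul,
      map_mul, map_inv]
  exact h.semilinear_unique (f.induces_cocycle hR τ)

end SplittingOver

theorem mainTheorem8 {k : Type u} [Field k]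
    (R : BasedRootDatum.{u}) (hR : R.IsSimple)
    (𝓡 : BasedRootDatumScheme k) (h𝓡 : 𝓡.IsOfType R)
    (K : Type u) [Field K] [Algebra k K] [IsSepClosure k K]
    (f : SplittingOver 𝓡.toPreBasedRootDatumScheme R K)
    (l : IntermediateField k K) (hl : l = f.classifyingField)
    (g : ℕ) (hg : g = Nat.card (l ≃ₐ[k] l)) :
    (g = 1 →
      (∃ e : (semilinearSeq 𝓡.toPreBasedRootDatumScheme).Iso (prodSeq R.Aut k),
        ∀ c : (semilinearAutToAut 𝓡.toPreBasedRootDatumScheme).range,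
          (e.right c : k ≃+* k) = (c : k ≃+* k)) ∧
      (semilinearSeq 𝓡.toPreBasedRootDatumScheme).Splits) ∧
    (g = 2 ∨ g = 3 →
      ∃ e : (semilinearSeq 𝓡.toPreBasedRootDatumScheme).Iso (galSeq k l),
        ∀ c : (semilinearAutToAut 𝓡.toPreBasedRootDatumScheme).range,
          (AutExtending k l).subtype (e.right c) = (c : k ≃+* k)) ∧
    (g = 6 →
      (∀ l₃ : IntermediateField k l, Module.finrank k l₃ = 3 →
        ¬ Normal k l₃ ∧
        ∃ e : (semilinearSeq 𝓡.toPreBasedRootDatumScheme).Iso (trivSeq k l₃),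
          ∀ c : (semilinearAutToAut 𝓡.toPreBasedRootDatumScheme).range,
            (AutExtending k l₃).subtype (e.right c) = (c : k ≃+* k)) ∧
      (semilinearSeq 𝓡.toPreBasedRootDatumScheme).Splits) := by
  subst hl
  have hs := hR.semisimple
  obtain ⟨j, hj⟩ := BasedRootDatum.IsSimple.exists_injective_perm hR
  have hfin : Finite R.Aut := Finite.of_injective j hj
  rw [f.card_gal_classifyingField hs] at hg
  have hker : f.classifyingField.fixingSubgroup = (f.cocycle hs).ker := by
    rw [f.classifyingField_fixingSubgroup, f.cocycle_ker]
  refine ⟨fun h1 => ?_, fun h23 => ?_, fun h6 => ?_⟩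
  · obtain ⟨e, he⟩ := f.exists_mulEquiv_prod hs fun τ => by
      have := Subgroup.card_eq_one.1 (hg.symm.trans h1)
      exact (Subgroup.eq_bot_iff_forall _).1 this _ ⟨τ, rfl⟩
    obtain ⟨E, hE⟩ := GrpSeq.exists_iso_ofHom
      (semilinearAutToAut 𝓡.toPreBasedRootDatumScheme) (prodSeq R.Aut k)
      (prodSeq_shortExact R.Aut k) (MonoidHom.id _) Function.injective_id e he
    exact ⟨⟨E, hE⟩, GrpSeq.Iso.splits E (prodSeq_splits R.Aut k)⟩
  · obtain ⟨H, hT⟩ : ∃ H, IsTwistComplement (f.cocycle hs).range ⊥ H := by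
      rcases h23 with rfl | rfl
      · exact ⟨⊥, isTwistComplement_of_card_two hj hg.symm⟩
      · exact isTwistComplement_of_card_three hj hg.symm fun r h3 h1 => hR.exists_involution h3 h1
    have hD : f.classifyingField.val.fieldRange.fixingSubgroup = (f.cocycle hs).ker := by
      rw [IntermediateField.fieldRange_val, hker]
    obtain ⟨e, he⟩ := f.exists_mulEquiv_autPreserving hs f.classifyingField.val hD.ge (H := H) <| by
      rw [hD, (Subgroup.map_eq_bot_iff _).2 le_rfl]
      exact hT
    exact GrpSeq.exists_iso_ofHom _ (galSeq k f.classifyingField) galSeq_shortExact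
      (AutExtending k f.classifyingField).subtype Subtype.val_injective e he
  · have hcard : Nat.card (Equiv.Perm (Fin 3)) = 6 := by
      rw [Nat.card_perm, Nat.card_fin]
      rfl
    have hrange : (f.cocycle hs).range = ⊤ := by
      refine Subgroup.eq_top_of_le_card _ ?_
      rw [← hg, h6, ← hcard]
      exact Nat.card_le_card_of_injective j hj
    have hsurj := MonoidHom.range_eq_top.1 hrange
    have hA : Nat.card R.Aut = 6 := by
      rw [← h6, hg, hrange, Subgroup.card_top]
    have hjb := hj.bijective_of_nat_card_le (hcard.trans hA.symm).le
    have hinj := f.semilinearAutToAut_injective hs hsurj fun a b =>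
      eq_of_conj_eq_conj_of_bijective hjb
    refine ⟨fun l₃ hl₃ => ?_, GrpSeq.ofHom_splits_of_injective hinj⟩
    let i : l₃ →ₐ[k] K := f.classifyingField.val.comp l₃.val
    have hN : (f.cocycle hs).ker ≤ i.fieldRange.fixingSubgroup := by
      rw [← hker]
      refine IntermediateField.fixingSubgroup_antitone ?_
      rintro _ ⟨x, rfl⟩
      exact x.1.2
    -- `S₃` has order six, so the image of the subgroup fixing `l₃` has order two
    have hindex : (i.fieldRange.fixingSubgroup.map (f.cocycle hs)).index = 3 := by
      rw [Subgroup.index_map_eq _ hsurj hN, ← IntermediateField.finrank_eq_fixingSubgroup_index,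
        ← hl₃]
      exact (AlgEquiv.ofInjectiveField i).toLinearEquiv.finrank_eq.symm
    have hD : Nat.card (i.fieldRange.fixingSubgroup.map (f.cocycle hs)) = 2 := by
      have := Subgroup.card_mul_index (i.fieldRange.fixingSubgroup.map (f.cocycle hs))
      rw [hindex, hA] at this
      omega
    have hT := isTwistComplement_of_card_six hjb hD
    constructor
    · -- a subgroup of order two of `S₃` is not normal
      intro hn
      have hn' : Normal k i.fieldRange := Normal.of_algEquiv (AlgEquiv.ofInjectiveField i)
      have : IsGalois k i.fieldRange := ⟨⟩
      have hnorm : (i.fieldRange.fixingSubgroup.map (f.cocycle hs)).Normal :=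
        Subgroup.Normal.map inferInstance _ hsurj
      have hbot := (Subgroup.eq_bot_iff_forall _).2 fun x hx =>
        hT.core x trivial fun y _ => hnorm.conj_mem x hx y
      rw [hbot, Subgroup.card_bot] at hD
      exact absurd hD (by decide)
    · obtain ⟨e, he⟩ := f.exists_mulEquiv_autPreserving hs i hN (by rw [hrange]; exact hT)
      refine GrpSeq.exists_iso_ofHom _ (trivSeq k l₃) (trivSeq_shortExact fun ρ hρ => ?_)
        (AutExtending k l₃).subtype Subtype.val_injective e he
      obtain ⟨p, rfl⟩ := e.surjective ρ
      have : p = 1 := hinj ((he p).symm.trans (hρ.trans (map_one _).symm))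
      rw [this, map_one]
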